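/- **Setting.** Let $M=(\mathcal S,\mathcal A,P,r,H,d_1)$ be a finite-horizon, non-stationary tabular MDP with $S=|\mathcal S|$, $A=|\mathcal A|$, $H\ge 1$, transition kernels $P_h(\cdot\mid s,a)$ and random rewards $r_h\in[0,1]$ which, given $(s_h,a_h)$, are conditionally independent of $s_{h+1}$ and have mean $r_h(s_h,a_h)$. For a policy $\pi$ let $V^\pi_h$ be its value functions, $v^\pi=\mathbb E_{d_1}[V_1^\pi]$, $d^\pi_h(s,a)$ its state-action occupancy at step $h$; let $V^\star_h$ and $v^\star$ be the optimal values. The data $\mathcal D$ are $n$ independent episodes $(s_h^\tau,a_h^\tau,r_h^\tau,s_{h+1}^\tau)_{h\le H}$ of a behavior policy $\mu$, and $$d_m:=\min\{d^\mu_h(s,a): h\in[H],\ s \text{ reachable at step } h \text{ by some policy},\ a\in\mathcal A\}.$$ **APVI** with input $\delta\in(0,1)$ and $\iota=\log(HSA/\delta)$: let $n_{s,a}$ be the number of visits of $(s,a)$ at step $h$, and $\widehat P_h,\widehat r_h$ the empirical transition frequencies and mean rewards ($\widehat P_h(\cdot\mid s,a)=1/S$, $\widehat r_h=0$ if $n_{s,a}=0$).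 Start with $\widehat V_{H+1}=0$. For $h=H,\dots,1$ set $$\Gamma_h(s,a)=2\sqrt{\frac{\mathrm{Var}_{\widehat P_h(\cdot\mid s,a)}(\widehat r_h(s,a)+\widehat V_{h+1})\,\iota}{n_{s,a}}}+\frac{14H\iota}{n_{s,a}}\quad\text{if } n_{s,a}\ge 1,\qquad \Gamma_h(s,a)=KH\iota\quad\text{if } n_{s,a}=0,$$ with a fixed constant $K>0$; set $\overline Q_h=\max\{\min\{\widehat r_h+\widehat P_h\widehat V_{h+1}-\Gamma_h,\,H-h+1\},0\}$; let $\widehat\pi_h(\cdot\mid s)$ be any maximizer of $\langle\overline Q_h(s,\cdot),\cdot\rangle$ over distributions on $\mathcal A$, and $\widehat V_h(s)=\langle\overline Q_h(s,\cdot),\widehat\pi_h(\cdot\mid s)\rangle$. The output is $\widehat\pi$. **Proposition.** Under uniform data coverage ($d_m>0$) APVI attains the minimax sample complexity $\widetilde O(H^3/(d_m\epsilon^2))$, in the following sense. 1. *(Intrinsic bound.)* If $d_m>0$ and $n\ge1$, then for every optimal policy $\pi^\star$ $$\sum_{h=1}^H\ \sum_{(s,a):\,d^\mu_h(s,a)>0}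 d^{\pi^\star}_h(s,a)\sqrt{\frac{\mathrm{Var}\big(r_h+V^\star_{h+1}(s_{h+1})\mid s_h=s,a_h=a\big)}{n\,d^\mu_h(s,a)}}\ \le\ \sqrt{\frac{H^3}{n\,d_m}} .$$ 2. *(Upper bound.)* There are absolute constants $C>0$ and $k\in\mathbb N$ such that for every $M$ and $\mu$ with $d_m>0$, all $\delta\in(0,1)$, $\epsilon>0$, $K>0$ and all $$n\ \ge\ C\,L^k\left(\frac{H^3}{d_m\epsilon^2}+\frac{H^3}{d_m\epsilon}\right),\qquad L=\log\Big(\frac{3HSA}{\delta d_m}\big(1+\tfrac1\epsilon\big)\Big),$$ with probability at least $1-\delta$ over $\mathcal D$, every output $\widehat\pi$ of APVI (whatever the tie-breaking) satisfies $0\le v^\star-v^{\widehat\pi}\le\epsilon$. (For $\epsilon\le1$ the second term is dominated by the first, so the requirement is $n\ge\widetilde O(H^3/(d_m\epsilon^2))$.) 3. *(Matching lower bound.)* There is an absolute constant $c>0$ such that, whenever $S\ge3$, $A\ge2$, $H\ge2$, $0<d\le c/A$, $0<\epsilon\le cH$ and $n\le cH^3/(d\epsilon^2)$, for every (possibly randomized)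 algorithm that maps $n$ episodes to a policy $\widehat\pi$ there is an instance $(M,\mu)$ with these $S,A,H$ and with $d_m=d$ on which $v^\star-v^{\widehat\pi}>\epsilon$ with probability at least $c$. -/

import Mathlib

open MeasureTheory

noncomputable section

namespace OfflineRL

/-- The mean of `f` under the weights `p` on a finite set. -/
def wmean {S : Type*} [Fintype S] (p f : S → ℝ) : ℝ := ∑ s, p s * f s

/-- The variance of `f` under the weights `p` on a finite set. -/
def wvar {S : Type*} [Fintype S] (p f : S → ℝ) : ℝ := ∑ s, p s * (f s - wmean p f) ^ 2

/-- A (non-stationary, randomized) policy: a distribution over actions for every step and state.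
Steps are numbered from `0`; in a problem of horizon `H` only the steps `h < H` matter. -/
abbrev Policy (S A : Type*) [Fintype A] : Type _ := ℕ → S → stdSimplex ℝ A

/-- A finite-horizon non-stationary tabular MDP of horizon `H`. The steps are `0, …, H - 1`
(the components at steps `h ≥ H` are never used). The reward observed at step `h` in `(s, a)` is
drawn from the law `R h s a`, which is supported on `[0, 1]`, and is conditionally independent of
the next state given `(s, a)`. -/
structure MDP (S A : Type*) [Fintype S] (H : ℕ) where
  /-- initial state distribution -/
  init : stdSimplex ℝ S
  /-- transition kernels -/
  P : ℕ → S → A → stdSimplex ℝ S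
  /-- reward laws -/
  R : ℕ → S → A → ProbabilityMeasure ℝ
  R_mem : ∀ h s a, ∀ᵐ x ∂(R h s a : Measure ℝ), x ∈ Set.Icc (0 : ℝ) 1

section model

variable {S A : Type*} [Fintype S] [Fintype A] {H : ℕ}

/-- The expected instantaneous reward `r_h(s, a)`. -/
def MDP.r (M : MDP S A H) (h : ℕ) (s : S) (a : A) : ℝ := ∫ x, x ∂(M.R h s a : Measure ℝ)

/-- The value function `V^π_h`, with `V^π_h = 0` past the horizon. -/
def MDP.V (M : MDP S A H) (π : Policy S A) (h : ℕ) (s : S) : ℝ :=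
  if h < H then
    ∑ a, π h s a * (M.r h s a + wmean (M.P h s a) (fun s' => M.V π (h + 1) s'))
  else 0
termination_by H - h

/-- The optimal value function `V⋆_h`, with `V⋆_h = 0` past the horizon. -/
def MDP.Vstar (M : MDP S A H) (h : ℕ) (s : S) : ℝ :=
  if h < H then
    ⨆ a, (M.r h s a + wmean (M.P h s a) (fun s' => M.Vstar (h + 1) s'))
  else 0
termination_by H - h

/-- The performance `v^π` of a policy. -/
def MDP.v (M : MDP S A H) (π : Policy S A) : ℝ := wmean M.init (M.V π 0)

/-- The optimal performance `v⋆`. -/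
def MDP.vstar (M : MDP S A H) : ℝ := wmean M.init (M.Vstar 0)

/-- `π` is an optimal policy. -/
def MDP.IsOptimal (M : MDP S A H) (π : Policy S A) : Prop := M.v π = M.vstar

/-- The marginal probability `ℙ[s_h = s]` under the policy `π`. -/
def MDP.stateOcc (M : MDP S A H) (π : Policy S A) : ℕ → S → ℝ
  | 0, s => M.init s
  | h + 1, s' => ∑ s, ∑ a, M.stateOcc π h s * π h s a * M.P h s a s'

/-- The marginal state-action occupancy `d^π_h(s, a)`. -/
def MDP.occ (M : MDP S A H) (π : Policy S A) (h : ℕ) (s : S) (a : A) : ℝ :=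
  M.stateOcc π h s * π h s a

/-- State `s` can be reached at step `h` by some policy. -/
def MDP.Reachable (M : MDP S A H) (h : ℕ) (s : S) : Prop :=
  ∃ π : Policy S A, 0 < M.stateOcc π h s

/-- The uniform coverage coefficient `d_m`: the minimum of `d^μ_h(s, a)` over the steps `h`, the
states `s` that some policy reaches at step `h`, and all actions `a`. -/
def MDP.dm (M : MDP S A H) (μ : Policy S A) : ℝ :=
  sInf {x | ∃ h s a, h < H ∧ M.Reachable h s ∧ x = M.occ μ h s a}

/-- The conditional variance of `r_h + V⋆_{h+1}(s_{h+1})` given `(s_h, a_h) = (s, a)`, where `r_h`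
is the random reward. -/
def MDP.stepVar (M : MDP S A H) (h : ℕ) (s : S) (a : A) : ℝ :=
  ∑ s', M.P h s a s' * ∫ x, (x + M.Vstar (h + 1) s' -
    (M.r h s a + wmean (M.P h s a) (M.Vstar (h + 1)))) ^ 2 ∂(M.R h s a : Measure ℝ)

open Classical in
/-- The intrinsic offline learning bound for the behavior policy `μ`, the optimal policy `πs` and
`n` episodes. -/
def MDP.intrinsicBound (M : MDP S A H) (μ πs : Policy S A) (n : ℕ) : ℝ :=
  ∑ h ∈ Finset.range H, ∑ s, ∑ a,
    if 0 < M.occ μ h s a then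
      M.occ πs h s a * √(M.stepVar h s a / (n * M.occ μ h s a))
    else 0

end model

/-- An episode `(s_0, …, s_H)`, `(a_0, …, a_{H-1})`, `(r_0, …, r_{H-1})`. -/
abbrev Episode (S A : Type*) (H : ℕ) : Type _ := (Fin (H + 1) → S) × (Fin H → A) × (Fin H → ℝ)

/-- A data set of `n` episodes. -/
abbrev Dataset (S A : Type*) (H n : ℕ) : Type _ := Fin n → Episode S A H

section law

variable {S A : Type*} [Fintype S] [Fintype A] [MeasurableSpace S] [MeasurableSpace A] {H : ℕ}

/-- The law of an episode rolled out by the policy `μ`. -/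
def MDP.episodeLaw (M : MDP S A H) (μ : Policy S A) : Measure (Episode S A H) :=
  ∑ s : Fin (H + 1) → S, ∑ a : Fin H → A,
    ENNReal.ofReal (M.init (s 0) *
      ∏ h : Fin H, (μ h (s h.castSucc) (a h) * M.P h (s h.castSucc) (a h) (s h.succ))) •
    (Measure.pi fun h : Fin H => (M.R h (s h.castSucc) (a h) : Measure ℝ)).map
      (fun r => ((s, a, r) : Episode S A H))

/-- The law of `n` independent episodes rolled out by `μ`. -/
def MDP.dataLaw (M : MDP S A H) (μ : Policy S A) (n : ℕ) : Measure (Dataset S A H n) :=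
  Measure.pi fun _ => M.episodeLaw μ

end law

section algorithm

variable {S A : Type*} [Fintype S] [Fintype A] [DecidableEq S] [DecidableEq A] {H n : ℕ}

/-- The number `n_{s_h,a_h}` of visits to `(s, a)` at step `h`. -/
def count (D : Dataset S A H n) (h : Fin H) (s : S) (a : A) : ℕ :=
  (Finset.univ.filter fun τ => (D τ).1 h.castSucc = s ∧ (D τ).2.1 h = a).card

/-- The plug-in estimator of the transition kernel. -/
def Phat (D : Dataset S A H n) (h : Fin H) (s : S) (a : A) (s' : S) : ℝ :=
  if count D h s a = 0 then 1 / (Fintype.card S : ℝ)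
  else ((Finset.univ.filter fun τ => (D τ).1 h.castSucc = s ∧ (D τ).2.1 h = a ∧
    (D τ).1 h.succ = s').card : ℝ) / (count D h s a : ℝ)

/-- The plug-in estimator of the mean reward. -/
def rhat (D : Dataset S A H n) (h : Fin H) (s : S) (a : A) : ℝ :=
  if count D h s a = 0 then 0
  else (∑ τ, if (D τ).1 h.castSucc = s ∧ (D τ).2.1 h = a then (D τ).2.2 h else 0) /
    (count D h s a : ℝ)

/-- The log factor `ι = log (H S A / δ)`. -/
def iota (S A : Type*) [Fintype S] [Fintype A] (H : ℕ) (δ : ℝ) : ℝ :=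
  Real.log ((H : ℝ) * Fintype.card S * Fintype.card A / δ)

/-- The pessimistic penalty `Γ_h(s, a)` computed from `V`, the estimate of the value function at
the next step; `K` is the constant used at locations without data. -/
def penalty (δ K : ℝ) (D : Dataset S A H n) (h : Fin H) (V : S → ℝ) (s : S) (a : A) : ℝ :=
  if count D h s a = 0 then K * H * iota S A H δ
  else 2 * √(wvar (Phat D h s a) (fun s' => rhat D h s a + V s') * iota S A H δ /
      (count D h s a : ℝ)) + 14 * H * iota S A H δ / (count D h s a : ℝ)

/-- The truncated pessimistic `Q`-function at step `h`; as steps are numbered from `0`, the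
truncation level is `H - h`. -/
def Qbar (δ K : ℝ) (D : Dataset S A H n) (h : Fin H) (V : S → ℝ) (s : S) (a : A) : ℝ :=
  max (min (rhat D h s a + wmean (Phat D h s a) V - penalty δ K D h V s a)
    ((H : ℝ) - (h : ℕ))) 0

/-- The value estimates of APVI along its own policy `π`, backwards from the horizon. -/
def Vhat (δ K : ℝ) (D : Dataset S A H n) (π : Policy S A) (h : ℕ) (s : S) : ℝ :=
  if hh : h < H then
    ∑ a, π h s a * Qbar δ K D ⟨h, hh⟩ (fun s' => Vhat δ K D π (h + 1) s') s a
  else 0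
termination_by H - h

/-- `π` is an output of APVI on the data set `D` (ties in the `argmax` are broken arbitrarily):
at each step and state `π` maximizes the average of the truncated pessimistic `Q`-function. -/
def IsAPVIOutput (δ K : ℝ) (D : Dataset S A H n) (π : Policy S A) : Prop :=
  ∀ (h : Fin H) (s : S) (p : stdSimplex ℝ A),
    wmean p (Qbar δ K D h (Vhat δ K D π (h + 1)) s) ≤
      wmean (π h s) (Qbar δ K D h (Vhat δ K D π (h + 1)) s)

end algorithm

end OfflineRL

end

/-! The power $H^3$ in the first two parts comes from the law of total variance. Along a trajectory
the square of a value function telescopes (`MDP.telescope`), so the conditional variances of the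
next value add up to $O(H^2)$ in expectation, although a single one may already be of order $H^2$.
Cauchy–Schwarz over the $H$ steps (`MDP.sum_occ_sqrt_le`) then bounds the expected sum of standard
deviations by $O(\sqrt{H^3})$. Applied to $V^\star$ along an optimal policy and divided by $\sqrt{n
d_m}$, this is the intrinsic bound.

For the upper bound put $u=\sqrt{l/(n d_m)}$ with $l$ a logarithmic factor. With high probability,
at every reachable location, the truncated estimate `Qbar` differs from the true Bellman backup of
the next value estimate by at most $O(u)$ times the standard deviation of that estimate, plus
$O(u+Hu^2)$ (`MDP.abs_Qbar_sub_le`). Pessimism plays no role: under uniform coverage the penalty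
itself has this size and is counted as error. `MDP.vstar_sub_v_le` converts such a one-step bound
into suboptimality by splitting $v^\star-v^{\widehat\pi}$ at the estimated value. One half is summed
along $\widehat\pi$; the other along an optimal policy, where $V^\star$ replaces the estimate inside
the variance at the price of their uniform distance.

The obstacle is that the value estimate at step $h+1$ is computed from the same episodes as the
transition counts at step $h$. It only depends, however, on the episodes from step $h+1$ on. Given
that part, the visits to $(s,a)$ at step $h$ are independent Bernoulli variables whose parameters
follow from $s_{h+1}$ by Bayes' rule (`pathSum_backward`, `MDP.subBernstein_visit`). Bernstein's
inequality therefore applies with the value estimate as a frozen coefficient, without any covering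
of value functions. What remains is a sum of Bayes probabilities over the observed $s_{h+1}$; it
involves only the state counts at step $h+1$, which uniform coverage makes accurate up to a relative
error $O(u)$. For a centred function the main term vanishes, and no factor $S$ appears
(`MDP.abs_sum_backward_sub_le`).

For the lower bound, a waiting state is left with probability $1/(2H)$ per step, towards an
absorbing state of reward one or of reward zero, and one action shifts the odds by $\pm\kappa$ with
an unknown sign at each step. Wrong guesses at a fixed proportion of the steps cost about $\kappa
H$, so $\kappa\sim\epsilon/H$. An episode informs about one sign only if the action is tried there
(probability $d$) and the state is left, so two instances differing in one sign have affinity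
$1-O(\kappa^2 d/H)$ per episode, and $n\lesssim H^3/(d\epsilon^2)$ episodes cannot tell them apart.
Assouad's lemma (`exists_sum_div_eight_le`) yields large expected regret, and a reverse Markov
inequality makes it a statement in probability. -/

set_option linter.unusedSectionVars false

namespace OfflineRL

/-! ### Means and variances under finite weights. -/

section weights

variable {S : Type*} [Fintype S]

lemma wmean_add (p f g : S → ℝ) : wmean p (fun s => f s + g s) = wmean p f + wmean p g := by
  simp only [wmean, mul_add, Finset.sum_add_distrib]

lemma wmean_sub (p f g : S → ℝ) : wmean p (fun s => f s - g s) = wmean p f - wmean p g := by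
  simp only [wmean, mul_sub, Finset.sum_sub_distrib]

lemma wmean_const {p : S → ℝ} (hp : ∑ s, p s = 1) (c : ℝ) : wmean p (fun _ => c) = c := by
  simp only [wmean, ← Finset.sum_mul, hp, one_mul]

lemma wmean_mono {p f g : S → ℝ} (hp : ∀ s, 0 ≤ p s) (h : ∀ s, 0 < p s → f s ≤ g s) :
    wmean p f ≤ wmean p g := by
  refine Finset.sum_le_sum fun s _ => ?_
  rcases (hp s).eq_or_lt with h0 | h0
  · simp [← h0]
  · exact mul_le_mul_of_nonneg_left (h s h0) h0.le

lemma wmean_nonneg {p f : S → ℝ} (hp : ∀ s, 0 ≤ p s) (h : ∀ s, 0 ≤ f s) : 0 ≤ wmean p f :=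
  Finset.sum_nonneg fun s _ => mul_nonneg (hp s) (h s)

lemma wmean_le_of_le {p f : S → ℝ} (hp : ∀ s, 0 ≤ p s) (hp1 : ∑ s, p s = 1) {c : ℝ}
    (h : ∀ s, f s ≤ c) : wmean p f ≤ c :=
  (wmean_mono hp fun s _ => h s).trans_eq (wmean_const hp1 c)

lemma wvar_nonneg {p : S → ℝ} (hp : ∀ s, 0 ≤ p s) (f : S → ℝ) : 0 ≤ wvar p f :=
  Finset.sum_nonneg fun s _ => mul_nonneg (hp s) (sq_nonneg _)

/-- The second moment around `c` is the variance plus the squared bias. -/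
lemma wmean_sub_sq {p : S → ℝ} (hp : ∑ s, p s = 1) (f : S → ℝ) (c : ℝ) :
    wmean p (fun s => (f s - c) ^ 2) = wvar p f + (wmean p f - c) ^ 2 := by
  have h : ∀ s, p s * (f s - c) ^ 2 = p s * (f s - wmean p f) ^ 2
      + 2 * (wmean p f - c) * (p s * f s) + ((c ^ 2 - (wmean p f) ^ 2)) * p s := fun s => by ring
  simp only [wvar]
  rw [wmean, Finset.sum_congr rfl fun s _ => h s, Finset.sum_add_distrib, Finset.sum_add_distrib,
    ← Finset.mul_sum, ← Finset.mul_sum, hp]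
  change _ + 2 * (wmean p f - c) * wmean p f + _ = _
  ring

lemma wvar_eq {p : S → ℝ} (hp : ∑ s, p s = 1) (f : S → ℝ) :
    wvar p f = wmean p (fun s => f s ^ 2) - wmean p f ^ 2 := by
  have := wmean_sub_sq hp f 0
  simp only [sub_zero] at this
  linarith

lemma wvar_add_const {p : S → ℝ} (hp : ∑ s, p s = 1) (f : S → ℝ) (c : ℝ) :
    wvar p (fun s => c + f s) = wvar p f := by
  have : wmean p (fun s => c + f s) = c + wmean p f := by rw [wmean_add, wmean_const hp]
  simp only [wvar, this, add_sub_add_left_eq_sub]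

/-- Jensen's inequality for the square. -/
lemma wmean_sq_le {p : S → ℝ} (hp : ∀ s, 0 ≤ p s) (hp1 : ∑ s, p s = 1) (f : S → ℝ) :
    wmean p f ^ 2 ≤ wmean p (fun s => f s ^ 2) := by
  linarith [wvar_eq hp1 f, wvar_nonneg hp f]

lemma wmean_abs_le_sqrt {p : S → ℝ} (hp : ∀ s, 0 ≤ p s) (hp1 : ∑ s, p s = 1) (f : S → ℝ) :
    wmean p (fun s => |f s|) ≤ √(wmean p (fun s => f s ^ 2)) := by
  refine Real.le_sqrt_of_sq_le ?_
  simpa only [sq_abs] using wmean_sq_le hp hp1 (fun s => |f s|)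

/-- The standard deviation is subadditive, with a uniform bound on the perturbation. -/
lemma sqrt_wvar_le {p : S → ℝ} (hp : ∀ s, 0 ≤ p s) (hp1 : ∑ s, p s = 1) {f g : S → ℝ} {c : ℝ}
    (hc : 0 ≤ c) (h : ∀ s, 0 < p s → |f s - g s| ≤ c) : √(wvar p f) ≤ √(wvar p g) + c := by
  have hv := wvar_nonneg hp g
  refine Real.sqrt_le_left (by positivity) |>.mpr ?_
  -- The second moment of $f$ is smallest around its own mean, so it may be centred at the mean of
  -- $g$ instead.
  have h1 : wvar p f ≤ wmean p (fun s => (f s - wmean p g) ^ 2) := by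
    rw [wmean_sub_sq hp1]; nlinarith [sq_nonneg (wmean p f - wmean p g)]
  have h2 : wmean p (fun s => (f s - wmean p g) ^ 2)
      ≤ wmean p (fun s => (g s - wmean p g) ^ 2 + (2 * c * |g s - wmean p g| + c ^ 2)) := by
    refine wmean_mono hp fun s hs => ?_
    have h3 := h s hs
    have : |f s - wmean p g| ≤ |g s - wmean p g| + c := by
      calc |f s - wmean p g| = |(f s - g s) + (g s - wmean p g)| := by ring_nf
        _ ≤ |f s - g s| + |g s - wmean p g| := abs_add_le _ _
        _ ≤ _ := by linarith
    have := pow_le_pow_left₀ (abs_nonneg _) this 2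
    rw [sq_abs, add_sq, sq_abs] at this
    linarith
  have h4 : wmean p (fun s => 2 * c * |g s - wmean p g|) ≤ 2 * c * √(wvar p g) := by
    have := wmean_abs_le_sqrt hp hp1 (fun s => g s - wmean p g)
    have e : wmean p (fun s => 2 * c * |g s - wmean p g|)
        = 2 * c * wmean p (fun s => |g s - wmean p g|) := by
      simp only [wmean, Finset.mul_sum]; exact Finset.sum_congr rfl fun s _ => by ring
    rw [e]
    exact mul_le_mul_of_nonneg_left this (by positivity)
  rw [wmean_add, wmean_add, wmean_const hp1] at h2
  have h5 : wmean p (fun s => (g s - wmean p g) ^ 2) = wvar p g := rfl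
  rw [add_sq, Real.sq_sqrt hv]
  linarith

lemma exists_pos_of_stdSimplex (p : stdSimplex ℝ S) : ∃ s, 0 < p s := by
  by_contra! h
  have h1 := stdSimplex.sum_eq_one p
  have : ∑ s, p s ≤ 0 := Finset.sum_nonpos fun s _ => h s
  linarith

end weights

/-! ### Value functions, occupancies, and telescoping along a trajectory. -/

section model

variable {S A : Type*} [Fintype S] [Fintype A] {H : ℕ}

lemma MDP.r_nonneg (M : MDP S A H) (h : ℕ) (s : S) (a : A) : 0 ≤ M.r h s a := by
  refine integral_nonneg_of_ae ?_
  filter_upwards [M.R_mem h s a] with x hx using hx.1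

lemma MDP.integrable_of_continuous (M : MDP S A H) (h : ℕ) (s : S) (a : A) {f : ℝ → ℝ}
    (hf : Continuous f) : Integrable f (M.R h s a : Measure ℝ) := by
  obtain ⟨C, hC⟩ := isCompact_Icc.exists_bound_of_continuousOn
    (hf.continuousOn (s := Set.Icc (0 : ℝ) 1))
  refine Integrable.of_bound hf.aestronglyMeasurable C ?_
  filter_upwards [M.R_mem h s a] with x hx using hC x hx

lemma MDP.r_le_one (M : MDP S A H) (h : ℕ) (s : S) (a : A) : M.r h s a ≤ 1 := by
  have : M.r h s a ≤ ∫ _, (1 : ℝ) ∂(M.R h s a : Measure ℝ) := by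
    refine integral_mono_ae (M.integrable_of_continuous h s a continuous_id)
      (integrable_const _) ?_
    filter_upwards [M.R_mem h s a] with x hx using hx.2
  simpa using this

lemma MDP.V_of_lt (M : MDP S A H) (π : Policy S A) {h : ℕ} (hh : h < H) (s : S) :
    M.V π h s = wmean (π h s) (fun a => M.r h s a + wmean (M.P h s a) (M.V π (h + 1))) := by
  rw [MDP.V, if_pos hh]; rfl

lemma MDP.V_of_le (M : MDP S A H) (π : Policy S A) {h : ℕ} (hh : H ≤ h) (s : S) :
    M.V π h s = 0 := by
  rw [MDP.V, if_neg hh.not_gt]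

/-- The optimal action-value function. -/
noncomputable def MDP.Qstar (M : MDP S A H) (h : ℕ) (s : S) (a : A) : ℝ :=
  M.r h s a + wmean (M.P h s a) (M.Vstar (h + 1))

lemma MDP.Vstar_of_lt (M : MDP S A H) {h : ℕ} (hh : h < H) (s : S) :
    M.Vstar h s = ⨆ a, M.Qstar h s a := by
  rw [MDP.Vstar, if_pos hh]; rfl

lemma MDP.Vstar_of_le (M : MDP S A H) {h : ℕ} (hh : H ≤ h) (s : S) : M.Vstar h s = 0 := by
  rw [MDP.Vstar, if_neg hh.not_gt]

lemma MDP.Qstar_le_Vstar (M : MDP S A H) {h : ℕ} (hh : h < H) (s : S) (a : A) :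
    M.Qstar h s a ≤ M.Vstar h s := by
  rw [M.Vstar_of_lt hh]
  exact le_ciSup (Set.finite_range _).bddAbove a

lemma MDP.Vstar_mem [Nonempty A] (M : MDP S A H) :
    ∀ (k h : ℕ), H - h = k → ∀ s, 0 ≤ M.Vstar h s ∧ M.Vstar h s ≤ ((H - h : ℕ) : ℝ) := by
  intro k
  induction k with
  | zero =>
    intro h hk s
    have hh : H ≤ h := by omega
    simp [M.Vstar_of_le hh]
  | succ k ih =>
    intro h hk s
    have hh : h < H := by omega
    have ih' := ih (h + 1) (by omega)
    have e : ((H - h : ℕ) : ℝ) = ((H - (h + 1) : ℕ) : ℝ) + 1 := by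
      rw [← Nat.cast_add_one]; congr 1; omega
    constructor
    · refine le_trans ?_ (M.Qstar_le_Vstar hh s (Classical.arbitrary A))
      exact add_nonneg (M.r_nonneg _ _ _) (wmean_nonneg (stdSimplex.zero_le _) fun s => (ih' s).1)
    · rw [M.Vstar_of_lt hh]
      refine ciSup_le fun a => ?_
      have := wmean_le_of_le (stdSimplex.zero_le (M.P h s a)) (stdSimplex.sum_eq_one _)
        (fun s => (ih' s).2)
      have := M.r_le_one h s a
      rw [MDP.Qstar]; linarith

lemma MDP.Vstar_nonneg [Nonempty A] (M : MDP S A H) (h : ℕ) (s : S) : 0 ≤ M.Vstar h s :=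
  (M.Vstar_mem _ h rfl s).1

lemma MDP.Vstar_le_sub [Nonempty A] (M : MDP S A H) (h : ℕ) (s : S) :
    M.Vstar h s ≤ ((H - h : ℕ) : ℝ) :=
  (M.Vstar_mem _ h rfl s).2

lemma MDP.Vstar_le [Nonempty A] (M : MDP S A H) (h : ℕ) (s : S) : M.Vstar h s ≤ H :=
  (M.Vstar_le_sub h s).trans (by exact_mod_cast Nat.sub_le _ _)

lemma MDP.V_nonneg (M : MDP S A H) (π : Policy S A) :
    ∀ (k h : ℕ), H - h = k → ∀ s, 0 ≤ M.V π h s := by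
  intro k
  induction k with
  | zero => intro h hk s; rw [M.V_of_le π (by omega)]
  | succ k ih =>
    intro h hk s
    rw [M.V_of_lt π (by omega)]
    exact wmean_nonneg (stdSimplex.zero_le _) fun a => add_nonneg (M.r_nonneg _ _ _)
      (wmean_nonneg (stdSimplex.zero_le _) (ih (h + 1) (by omega)))

lemma MDP.V_le_Vstar (M : MDP S A H) (π : Policy S A) :
    ∀ (k h : ℕ), H - h = k → ∀ s, M.V π h s ≤ M.Vstar h s := by
  intro k
  induction k with
  | zero => intro h hk s; rw [M.V_of_le π (by omega), M.Vstar_of_le (by omega)]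
  | succ k ih =>
    intro h hk s
    have hh : h < H := by omega
    rw [M.V_of_lt π hh]
    refine wmean_le_of_le (stdSimplex.zero_le _) (stdSimplex.sum_eq_one _) fun a => ?_
    refine le_trans ?_ (M.Qstar_le_Vstar hh s a)
    have := wmean_mono (stdSimplex.zero_le (M.P h s a)) fun s' _ => ih (h + 1) (by omega) s'
    rw [MDP.Qstar]; linarith

lemma MDP.v_nonneg (M : MDP S A H) (π : Policy S A) : 0 ≤ M.v π :=
  wmean_nonneg (stdSimplex.zero_le _) (M.V_nonneg π _ 0 rfl)

lemma MDP.v_le_vstar (M : MDP S A H) (π : Policy S A) : M.v π ≤ M.vstar :=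
  wmean_mono (stdSimplex.zero_le _) fun s _ => M.V_le_Vstar π _ 0 rfl s

lemma MDP.vstar_le [Nonempty A] (M : MDP S A H) : M.vstar ≤ H :=
  wmean_le_of_le (stdSimplex.zero_le _) (stdSimplex.sum_eq_one _) (M.Vstar_le 0)

lemma MDP.stateOcc_nonneg (M : MDP S A H) (π : Policy S A) (h : ℕ) (s : S) :
    0 ≤ M.stateOcc π h s := by
  induction h generalizing s with
  | zero => exact stdSimplex.zero_le _ _
  | succ h ih =>
    exact Finset.sum_nonneg fun x _ => Finset.sum_nonneg fun a _ =>
      mul_nonneg (mul_nonneg (ih x) (stdSimplex.zero_le _ _)) (stdSimplex.zero_le _ _)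

lemma MDP.occ_nonneg (M : MDP S A H) (π : Policy S A) (h : ℕ) (s : S) (a : A) :
    0 ≤ M.occ π h s a :=
  mul_nonneg (M.stateOcc_nonneg _ _ _) (stdSimplex.zero_le _ _)

lemma MDP.sum_occ (M : MDP S A H) (π : Policy S A) (h : ℕ) (s : S) :
    ∑ a, M.occ π h s a = M.stateOcc π h s := by
  simp only [MDP.occ, ← Finset.mul_sum, stdSimplex.sum_eq_one, mul_one]

/-- Chapman–Kolmogorov: the expectation of `f(s_{h+1})`. -/
lemma MDP.sum_occ_wmean (M : MDP S A H) (π : Policy S A) (h : ℕ) (f : S → ℝ) :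
    ∑ s, ∑ a, M.occ π h s a * wmean (M.P h s a) f = ∑ s, M.stateOcc π (h + 1) s * f s := by
  simp only [MDP.stateOcc, Finset.sum_mul, wmean, Finset.mul_sum]
  symm
  rw [Finset.sum_comm]
  refine Finset.sum_congr rfl fun s _ => ?_
  rw [Finset.sum_comm]
  refine Finset.sum_congr rfl fun a _ => Finset.sum_congr rfl fun s' _ => ?_
  simp only [MDP.occ]; ring

lemma MDP.sum_stateOcc (M : MDP S A H) (π : Policy S A) (h : ℕ) :
    ∑ s, M.stateOcc π h s = 1 := by
  induction h with
  | zero => exact stdSimplex.sum_eq_one _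
  | succ h ih =>
    have := M.sum_occ_wmean π h (fun _ => 1)
    simp only [wmean_const (stdSimplex.sum_eq_one _), mul_one, M.sum_occ, ih] at this
    exact this.symm

lemma MDP.sum_sum_occ (M : MDP S A H) (π : Policy S A) (h : ℕ) :
    ∑ s, ∑ a, M.occ π h s a = 1 := by
  simp only [M.sum_occ, M.sum_stateOcc]

/-- Telescoping along the trajectory of `π`: a one-step bound for `F` sums up. -/
lemma MDP.telescope (M : MDP S A H) (π : Policy S A) (F : ℕ → S → ℝ) (e : ℕ → S → A → ℝ)
    (hF : ∀ h s, h < H → 0 < M.stateOcc π h s →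
      F h s ≤ wmean (π h s) (fun a => wmean (M.P h s a) (F (h + 1)) + e h s a))
    (hH : ∀ s, F H s ≤ 0) :
    wmean M.init (F 0) ≤ ∑ h ∈ Finset.range H, ∑ s, ∑ a, M.occ π h s a * e h s a := by
  have key : ∀ k ≤ H, wmean M.init (F 0) ≤
      ∑ h ∈ Finset.range k, ∑ s, ∑ a, M.occ π h s a * e h s a
        + ∑ s, M.stateOcc π k s * F k s := by
    intro k hk
    induction k with
    | zero => simp [wmean, MDP.stateOcc]
    | succ k ih =>
      refine (ih (by omega)).trans ?_
      rw [Finset.sum_range_succ, add_assoc]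
      refine add_le_add le_rfl ?_
      rw [← M.sum_occ_wmean, ← Finset.sum_add_distrib]
      refine Finset.sum_le_sum fun s _ => ?_
      rw [← Finset.sum_add_distrib]
      rcases (M.stateOcc_nonneg π k s).eq_or_lt with h0 | h0
      · simp [MDP.occ, ← h0]
      · refine (mul_le_mul_of_nonneg_left (hF k s (by omega) h0) h0.le).trans_eq ?_
        rw [wmean, Finset.mul_sum]
        refine Finset.sum_congr rfl fun a _ => ?_
        simp only [MDP.occ]; ring
  refine (key H le_rfl).trans ?_
  have : ∑ s, M.stateOcc π H s * F H s ≤ 0 :=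
    Finset.sum_nonpos fun s _ => mul_nonpos_of_nonneg_of_nonpos (M.stateOcc_nonneg _ _ _) (hH s)
  linarith

/-- Cauchy–Schwarz for the expected sum of standard deviations along a trajectory. -/
lemma MDP.sum_occ_sqrt_le (M : MDP S A H) (π : Policy S A) (v : ℕ → S → A → ℝ) {B : ℝ}
    (hv : ∀ h s a, 0 ≤ v h s a)
    (hB : ∑ h ∈ Finset.range H, ∑ s, ∑ a, M.occ π h s a * v h s a ≤ B) :
    ∑ h ∈ Finset.range H, ∑ s, ∑ a, M.occ π h s a * √(v h s a) ≤ √(H * B) := by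
  have e : ∀ f : ℕ → S → A → ℝ, ∑ h ∈ Finset.range H, ∑ s, ∑ a, f h s a
      = ∑ x ∈ Finset.range H ×ˢ (Finset.univ : Finset (S × A)), f x.1 x.2.1 x.2.2 := by
    intro f
    rw [Finset.sum_product]
    refine Finset.sum_congr rfl fun h _ => ?_
    rw [← Finset.univ_product_univ, Finset.sum_product]
  refine Real.le_sqrt_of_sq_le ?_
  have h1 : ∑ h ∈ Finset.range H, ∑ s, ∑ a, M.occ π h s a = H := by
    simp [M.sum_sum_occ]
  rw [e] at hB h1 ⊢
  -- Write $d\sqrt v=\sqrt d\cdot\sqrt{dv}$; the occupancies have total mass $H$ over all steps.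
  have cs := Finset.sum_mul_sq_le_sq_mul_sq (Finset.range H ×ˢ (Finset.univ : Finset (S × A)))
    (fun x => √(M.occ π x.1 x.2.1 x.2.2)) (fun x => √(M.occ π x.1 x.2.1 x.2.2 * v x.1 x.2.1 x.2.2))
  simp only [Real.sq_sqrt (M.occ_nonneg π _ _ _),
    Real.sq_sqrt (mul_nonneg (M.occ_nonneg π _ _ _) (hv _ _ _)), h1] at cs
  have e2 : ∀ x : ℕ × S × A, √(M.occ π x.1 x.2.1 x.2.2) *
      √(M.occ π x.1 x.2.1 x.2.2 * v x.1 x.2.1 x.2.2)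
        = M.occ π x.1 x.2.1 x.2.2 * √(v x.1 x.2.1 x.2.2) := fun x => by
    rw [Real.sqrt_mul (M.occ_nonneg π _ _ _), ← mul_assoc,
      Real.mul_self_sqrt (M.occ_nonneg π _ _ _)]
  simp only [e2] at cs
  exact cs.trans (mul_le_mul_of_nonneg_left hB (Nat.cast_nonneg _))

lemma MDP.dm_le (M : MDP S A H) (μ : Policy S A) {h : ℕ} (hh : h < H) {s : S}
    (hs : M.Reachable h s) (a : A) : M.dm μ ≤ M.occ μ h s a := by
  refine csInf_le ⟨0, ?_⟩ ⟨h, s, a, hh, hs, rfl⟩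
  rintro x ⟨h, s, a, -, -, rfl⟩
  exact M.occ_nonneg _ _ _ _

lemma MDP.nonempty_action (M : MDP S A H) (μ : Policy S A) : Nonempty A := by
  obtain ⟨s, -⟩ := exists_pos_of_stdSimplex M.init
  obtain ⟨a, -⟩ := exists_pos_of_stdSimplex (μ 0 s)
  exact ⟨a⟩

end model

/-! ### Law of total variance for $V^\star$ and the intrinsic bound. -/

section intrinsic

variable {S A : Type*} [Fintype S] [Fintype A] {H : ℕ}

lemma MDP.stepVar_nonneg (M : MDP S A H) (h : ℕ) (s : S) (a : A) : 0 ≤ M.stepVar h s a :=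
  Finset.sum_nonneg fun _ _ => mul_nonneg (stdSimplex.zero_le _ _)
    (integral_nonneg fun _ => sq_nonneg _)

lemma MDP.stepVar_eq (M : MDP S A H) (h : ℕ) (s : S) (a : A) :
    M.stepVar h s a = ∫ x, x ^ 2 ∂(M.R h s a : Measure ℝ)
      + 2 * M.r h s a * wmean (M.P h s a) (M.Vstar (h + 1))
      + wmean (M.P h s a) (fun s' => M.Vstar (h + 1) s' ^ 2) - M.Qstar h s a ^ 2 := by
  have h1 : ∀ c : ℝ, ∫ x, (x + c) ^ 2 ∂(M.R h s a : Measure ℝ)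
      = ∫ x, x ^ 2 ∂(M.R h s a : Measure ℝ) + 2 * c * M.r h s a + c ^ 2 := by
    intro c
    have e : ∀ x : ℝ, (x + c) ^ 2 = (x ^ 2 + 2 * c * x) + c ^ 2 := fun x => by ring
    simp only [e]
    rw [integral_add, integral_add, integral_const_mul, integral_const]
    · simp [MDP.r]
    · exact M.integrable_of_continuous _ _ _ (by fun_prop)
    · exact M.integrable_of_continuous _ _ _ (by fun_prop)
    · exact M.integrable_of_continuous _ _ _ (by fun_prop)
    · exact integrable_const _
  have hQ : M.Qstar h s a = M.r h s a + wmean (M.P h s a) (M.Vstar (h + 1)) := rfl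
  have h2 : ∀ s', M.P h s a s' * ∫ x, (x + M.Vstar (h + 1) s' -
      (M.r h s a + wmean (M.P h s a) (M.Vstar (h + 1)))) ^ 2 ∂(M.R h s a : Measure ℝ)
      = M.P h s a s' * (∫ x, x ^ 2 ∂(M.R h s a : Measure ℝ)
          - 2 * M.Qstar h s a * M.r h s a + M.Qstar h s a ^ 2)
        + (2 * M.r h s a - 2 * M.Qstar h s a) * (M.P h s a s' * M.Vstar (h + 1) s')
        + M.P h s a s' * M.Vstar (h + 1) s' ^ 2 := by
    intro s'
    simp only [add_sub_assoc, h1]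
    rw [hQ]; ring
  rw [MDP.stepVar, Finset.sum_congr rfl fun s' _ => h2 s', Finset.sum_add_distrib,
    Finset.sum_add_distrib, ← Finset.sum_mul, ← Finset.mul_sum, stdSimplex.sum_eq_one]
  change _ + _ * wmean (M.P h s a) (M.Vstar (h + 1))
    + wmean (M.P h s a) (fun s' => M.Vstar (h + 1) s' ^ 2) = _
  rw [hQ]; ring

/-- The constant collects $\mathbb E[r^2]\le1$ and the cross term $2r\,PV^\star\le2(H-h-1)$. The
rest is in the form needed to telescope $(V^\star)^2$. -/
lemma MDP.stepVar_le [Nonempty A] (M : MDP S A H) (h : ℕ) (hh : h < H) (s : S) (a : A) :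
    M.stepVar h s a ≤ (2 * ((H : ℝ) - h) - 1)
      + wmean (M.P h s a) (fun s' => M.Vstar (h + 1) s' ^ 2) - M.Qstar h s a ^ 2 := by
  rw [M.stepVar_eq]
  have h1 : ∫ x, x ^ 2 ∂(M.R h s a : Measure ℝ) ≤ 1 := by
    have : ∫ x, x ^ 2 ∂(M.R h s a : Measure ℝ) ≤ ∫ _, (1 : ℝ) ∂(M.R h s a : Measure ℝ) := by
      refine integral_mono_ae (M.integrable_of_continuous h s a (by fun_prop))
        (integrable_const _) ?_
      filter_upwards [M.R_mem h s a] with x hx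
      exact pow_le_one₀ hx.1 hx.2
    simpa using this
  have h2 : wmean (M.P h s a) (M.Vstar (h + 1)) ≤ (H : ℝ) - h - 1 := by
    refine wmean_le_of_le (stdSimplex.zero_le _) (stdSimplex.sum_eq_one _) fun s' => ?_
    refine (M.Vstar_le_sub (h + 1) s').trans_eq ?_
    rw [Nat.cast_sub (by omega)]; push_cast; ring
  have h3 : 0 ≤ wmean (M.P h s a) (M.Vstar (h + 1)) :=
    wmean_nonneg (stdSimplex.zero_le _) (M.Vstar_nonneg _)
  have h4 : M.r h s a * wmean (M.P h s a) (M.Vstar (h + 1)) ≤ 1 * ((H : ℝ) - h - 1) :=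
    mul_le_mul (M.r_le_one _ _ _) h2 h3 zero_le_one
  linarith

/-- An optimal policy plays greedily with respect to `Q⋆` wherever it goes. -/
lemma MDP.IsOptimal.Vstar_eq [Nonempty A] {M : MDP S A H} {π : Policy S A} (hπ : M.IsOptimal π)
    {h : ℕ} (hh : h < H) {s : S} {a : A} (ha : 0 < M.occ π h s a) :
    M.Vstar h s = M.Qstar h s a := by
  have key := M.telescope π (fun h s => M.V π h s - M.Vstar h s)
    (fun h s a => M.Qstar h s a - M.Vstar h s) ?_ ?_
  · have h0 : wmean M.init (fun s => M.V π 0 s - M.Vstar 0 s) = 0 := by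
      rw [wmean_sub]; exact sub_eq_zero.mpr hπ
    have hn : ∀ k ∈ Finset.range H, ∀ s a, 0 ≤ M.occ π k s a * (M.Vstar k s - M.Qstar k s a) :=
      fun k hk s a => mul_nonneg (M.occ_nonneg _ _ _ _)
        (sub_nonneg.mpr (M.Qstar_le_Vstar (Finset.mem_range.mp hk) _ _))
    have h1 : ∑ k ∈ Finset.range H, ∑ s, ∑ a, M.occ π k s a * (M.Vstar k s - M.Qstar k s a)
        ≤ 0 := by
      rw [← neg_nonneg, ← h0]
      refine key.trans_eq ?_
      simp only [← Finset.sum_neg_distrib]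
      refine Finset.sum_congr rfl fun _ _ => Finset.sum_congr rfl fun _ _ =>
        Finset.sum_congr rfl fun _ _ => by ring
    -- The gaps $V^\star-Q^\star$ are nonnegative and their occupancy-weighted sum is at most the
    -- regret, which is zero; hence each weighted gap vanishes.
    have h2 : M.occ π h s a * (M.Vstar h s - M.Qstar h s a) ≤ 0 := by
      refine le_trans ?_ h1
      refine le_trans ?_ (Finset.single_le_sum (fun k hk => Finset.sum_nonneg fun s _ =>
        Finset.sum_nonneg fun a _ => hn k hk s a) (Finset.mem_range.mpr hh))
      refine le_trans ?_ (Finset.single_le_sum (fun s _ =>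
        Finset.sum_nonneg fun a _ => hn h (Finset.mem_range.mpr hh) s a) (Finset.mem_univ s))
      exact Finset.single_le_sum (f := fun a => M.occ π h s a * (M.Vstar h s - M.Qstar h s a))
        (fun a _ => hn h (Finset.mem_range.mpr hh) s a) (Finset.mem_univ a)
    have h3 := M.Qstar_le_Vstar hh s a
    nlinarith
  · intro k s hk _
    rw [M.V_of_lt π hk, ← wmean_const (stdSimplex.sum_eq_one (π k s)) (M.Vstar k s), ← wmean_sub,
      wmean_const (stdSimplex.sum_eq_one _)]
    refine le_of_eq ?_
    congr 1; funext a
    rw [wmean_sub, MDP.Qstar]; ring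
  · intro s; simp [M.V_of_le, M.Vstar_of_le]

lemma sum_range_odd_desc (H : ℕ) :
    ∑ h ∈ Finset.range H, (2 * ((H : ℝ) - h) - 1) = (H : ℝ) ^ 2 := by
  have h1 : ∀ n : ℕ, ∑ h ∈ Finset.range n, (h : ℝ) = n * (n - 1) / 2 := by
    intro n
    induction n with
    | zero => simp
    | succ n ih => rw [Finset.sum_range_succ, ih]; push_cast; ring
  rw [Finset.sum_sub_distrib, ← Finset.mul_sum, Finset.sum_sub_distrib, h1]
  simp; ring

/-- Law of total variance along an optimal policy. -/
lemma MDP.IsOptimal.sum_occ_stepVar_le [Nonempty A] {M : MDP S A H} {π : Policy S A}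
    (hπ : M.IsOptimal π) :
    ∑ h ∈ Finset.range H, ∑ s, ∑ a, M.occ π h s a * M.stepVar h s a ≤ (H : ℝ) ^ 2 := by
  have key := M.telescope π (fun h s => M.Vstar h s ^ 2)
    (fun h s a => (2 * ((H : ℝ) - h) - 1) - M.stepVar h s a) ?_ ?_
  · have h0 : 0 ≤ wmean M.init (fun s => M.Vstar 0 s ^ 2) :=
      wmean_nonneg (stdSimplex.zero_le _) fun _ => sq_nonneg _
    have h1 := h0.trans key
    simp only [mul_sub (M.occ π _ _ _) _ (M.stepVar _ _ _), Finset.sum_sub_distrib] at h1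
    simp only [← Finset.sum_mul, M.sum_sum_occ, one_mul, sum_range_odd_desc] at h1
    linarith
  · intro h s hh hs
    -- Optimality enters here: $V^\star=Q^\star$ on every action that is played, so $(V^\star)^2$ is
    -- the mean of $(Q^\star)^2$.
    refine le_trans ?_ (wmean_mono (f := fun a => M.Qstar h s a ^ 2) (stdSimplex.zero_le _) ?_)
    · rw [← wmean_const (stdSimplex.sum_eq_one (π h s)) (M.Vstar h s ^ 2)]
      refine wmean_mono (stdSimplex.zero_le _) fun a ha => ?_
      rw [hπ.Vstar_eq hh (mul_pos hs ha)]
    · intro a _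
      linarith [M.stepVar_le h hh s a]
  · intro s; simp [M.Vstar_of_le]

/-- Every location charged by an optimal policy is reachable, so its occupancy under $\mu$ is at
least $d_m$ and $\sqrt{n d_m}$ factors out of the sum. -/
lemma MDP.intrinsicBound_le (M : MDP S A H) (μ πs : Policy S A) {n : ℕ} (hn : 0 < n)
    (hd : 0 < M.dm μ) (hπ : M.IsOptimal πs) :
    M.intrinsicBound μ πs n ≤ √((H : ℝ) ^ 3 / (n * M.dm μ)) := by
  have := M.nonempty_action μ
  have hn' : (0 : ℝ) < n := by exact_mod_cast hn
  have h1 : M.intrinsicBound μ πs n ≤ ∑ h ∈ Finset.range H, ∑ s, ∑ a,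
      M.occ πs h s a * √(M.stepVar h s a) * (√(n * M.dm μ))⁻¹ := by
    refine Finset.sum_le_sum fun h hh => Finset.sum_le_sum fun s _ => Finset.sum_le_sum fun a _ => ?_
    have h0 : 0 ≤ M.occ πs h s a * √(M.stepVar h s a) * (√(n * M.dm μ))⁻¹ :=
      mul_nonneg (mul_nonneg (M.occ_nonneg _ _ _ _) (Real.sqrt_nonneg _))
        (inv_nonneg.mpr (Real.sqrt_nonneg _))
    split_ifs with hμ
    · rcases (M.occ_nonneg πs h s a).eq_or_lt with h2 | h2
      · simp [← h2]
      · have hs : 0 < M.stateOcc πs h s := by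
          by_contra hc
          have := le_antisymm (not_lt.mp hc) (M.stateOcc_nonneg _ _ _)
          simp [MDP.occ, this] at h2
        have hle := M.dm_le μ (Finset.mem_range.mp hh) ⟨πs, hs⟩ a
        rw [mul_assoc, Real.sqrt_div (M.stepVar_nonneg _ _ _), div_eq_mul_inv]
        gcongr
    · exact h0
  refine h1.trans ?_
  simp only [← Finset.sum_mul]
  have h2 := M.sum_occ_sqrt_le πs M.stepVar M.stepVar_nonneg hπ.sum_occ_stepVar_le
  rw [Real.sqrt_div (by positivity), div_eq_mul_inv]
  refine mul_le_mul_of_nonneg_right (h2.trans_eq ?_) (by positivity)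
  congr 1; ring

end intrinsic

/-! ### From one-step Bellman errors to suboptimality. -/

section planning

variable {S A : Type*} [Fintype S] [Fintype A] {H : ℕ}

lemma wmean_vertex [DecidableEq A] (a : A) (f : A → ℝ) :
    wmean (stdSimplex.vertex (S := ℝ) a) f = f a := by
  simp [wmean, Pi.single_apply]

/-- Total variance of an approximate solution of the Bellman equation for `π`. -/
lemma MDP.sum_occ_sqrt_wvar_le (M : MDP S A H) (π : Policy S A) (U : ℕ → S → ℝ) (hH : 0 < H)
    (hU0 : ∀ h s, 0 ≤ U h s) (hU1 : ∀ h s, U h s ≤ H) (hUH : ∀ s, U H s = 0)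
    (hU : ∀ h s, h < H → 0 < M.stateOcc π h s →
      U h s ≤ wmean (π h s) (fun a => wmean (M.P h s a) (U (h + 1)) + 2)) :
    ∑ h ∈ Finset.range H, ∑ s, ∑ a, M.occ π h s a * √(wvar (M.P h s a) (U (h + 1)))
      ≤ 3 * √((H : ℝ) ^ 3) := by
  have hH1 : (1 : ℝ) ≤ H := by exact_mod_cast hH
  -- With $0\le PU\le H$, $(PU+2)^2\le PU^2-\mathrm{Var}_P(U)+4H+4$. Over $H$ steps the constants
  -- add up to $4H^2+4H\le8H^2$, and $\sqrt8\le3$.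
  have key := M.telescope π (fun h s => U h s ^ 2)
    (fun h s a => (4 * H + 4) - wvar (M.P h s a) (U (h + 1))) ?_ ?_
  · have h0 : 0 ≤ wmean M.init (fun s => U 0 s ^ 2) :=
      wmean_nonneg (stdSimplex.zero_le _) fun _ => sq_nonneg _
    have h1 := h0.trans key
    simp only [mul_sub, Finset.sum_sub_distrib] at h1
    simp only [← Finset.sum_mul, M.sum_sum_occ, one_mul, Finset.sum_const, Finset.card_range,
      nsmul_eq_mul] at h1
    refine (M.sum_occ_sqrt_le π (fun h s a => wvar (M.P h s a) (U (h + 1)))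
      (fun h s a => wvar_nonneg (stdSimplex.zero_le _) _) (B := 8 * (H : ℝ) ^ 2) ?_).trans ?_
    · nlinarith
    · rw [show (3 : ℝ) = √9 by rw [show (9 : ℝ) = 3 ^ 2 by norm_num]; simp,
        ← Real.sqrt_mul (by norm_num)]
      refine Real.sqrt_le_sqrt ?_
      have : 0 ≤ (H : ℝ) ^ 3 := by positivity
      linarith
  · intro h s hh hs
    have hP0 : ∀ a, 0 ≤ wmean (M.P h s a) (U (h + 1)) := fun a =>
      wmean_nonneg (stdSimplex.zero_le _) (hU0 _)
    refine (pow_le_pow_left₀ (hU0 h s) (hU h s hh hs) 2).trans ?_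
    refine (wmean_sq_le (stdSimplex.zero_le _) (stdSimplex.sum_eq_one _) _).trans ?_
    refine wmean_mono (stdSimplex.zero_le _) fun a _ => ?_
    rw [wvar_eq (stdSimplex.sum_eq_one _)]
    have := wmean_le_of_le (stdSimplex.zero_le (M.P h s a)) (stdSimplex.sum_eq_one _)
      (hU1 (h + 1))
    nlinarith
  · intro s; simp [hUH]

lemma MDP.exists_greedy [Nonempty A] (M : MDP S A H) :
    ∃ π : Policy S A, ∀ h s, h < H →
      wmean (π h s) (M.Qstar h s) = M.Vstar h s := by
  classical
  have h1 : ∀ h s, ∃ a, ∀ b, M.Qstar h s b ≤ M.Qstar h s a := fun h s => Finite.exists_max _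
  choose g hg using h1
  refine ⟨fun h s => stdSimplex.vertex (g h s), fun h s hh => ?_⟩
  rw [wmean_vertex, M.Vstar_of_lt hh]
  exact le_antisymm (le_ciSup (Set.finite_range _).bddAbove _) (ciSup_le (hg h s))

/-- The behavior policy is itself the witness: as $d_m>0$, it visits $(s,a)$ with positive
probability. Estimates on reachable states can thus be propagated through transitions. -/
lemma MDP.Reachable.step {M : MDP S A H} {μ : Policy S A} (hd : 0 < M.dm μ) {h : ℕ} (hh : h < H)
    {s : S} (hs : M.Reachable h s) {a : A} {s' : S} (hP : 0 < M.P h s a s') :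
    M.Reachable (h + 1) s' := by
  refine ⟨μ, ?_⟩
  have h1 : 0 < M.occ μ h s a * M.P h s a s' := mul_pos (hd.trans_le (M.dm_le μ hh hs a)) hP
  refine h1.trans_le ?_
  have h0 : ∀ x b, 0 ≤ M.stateOcc μ h x * μ h x b * M.P h x b s' := fun x b =>
    mul_nonneg (M.occ_nonneg μ h x b) (stdSimplex.zero_le _ _)
  refine le_trans ?_ (Finset.single_le_sum (fun x _ => Finset.sum_nonneg fun b _ => h0 x b)
    (Finset.mem_univ s))
  exact Finset.single_le_sum (f := fun b => M.stateOcc μ h s * μ h s b * M.P h s b s')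
    (fun b _ => h0 s b) (Finset.mem_univ a)

lemma sqrt_wvar_le_of_mem {p f : S → ℝ} (hp : ∀ s, 0 ≤ p s) (hp1 : ∑ s, p s = 1) {c : ℝ}
    (h0 : ∀ s, 0 ≤ f s) (h1 : ∀ s, f s ≤ c) : √(wvar p f) ≤ c := by
  obtain ⟨s, -⟩ := exists_pos_of_stdSimplex ⟨p, hp, hp1⟩
  refine Real.sqrt_le_iff.mpr ⟨(h0 s).trans (h1 s), ?_⟩
  rw [wvar_eq hp1]
  have := wmean_le_of_le hp hp1 fun s => pow_le_pow_left₀ (h0 s) (h1 s) 2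
  nlinarith [sq_nonneg (wmean p f)]

/-- The value estimates are uniformly close to `V⋆` on the reachable states. -/
lemma MDP.abs_sub_Vstar_le [Nonempty A] (M : MDP S A H) (π μ : Policy S A) (W : ℕ → S → ℝ)
    (Q : ℕ → S → A → ℝ) {η : ℝ} (hd : 0 < M.dm μ) (hWH : ∀ s, W H s = 0)
    (hWQ : ∀ h s, h < H → W h s = wmean (π h s) (Q h s))
    (hmax : ∀ h s a, h < H → Q h s a ≤ W h s)
    (hE : ∀ h s a, h < H → M.Reachable h s →
      |Q h s a - (M.r h s a + wmean (M.P h s a) (W (h + 1)))| ≤ η) :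
    ∀ k ≤ H, ∀ s, M.Reachable (H - k) s → |W (H - k) s - M.Vstar (H - k) s| ≤ k * η := by
  intro k
  induction k with
  | zero => intro _ s _; simp [hWH, M.Vstar_of_le]
  | succ k ih =>
    intro hk s hs
    have hh : H - (k + 1) < H := by omega
    obtain ⟨h, hdef⟩ : ∃ h, H - (k + 1) = h := ⟨_, rfl⟩
    have h1 : H - k = h + 1 := by omega
    rw [hdef] at hs hh ⊢
    rw [h1] at ih
    have hP : ∀ a, |wmean (M.P h s a) (W (h + 1)) - wmean (M.P h s a) (M.Vstar (h + 1))|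
        ≤ k * η := by
      intro a
      have h2 : ∀ s', 0 < M.P h s a s' → |W (h + 1) s' - M.Vstar (h + 1) s'| ≤ k * η :=
        fun s' hs' => ih (by omega) s' (hs.step hd hh hs')
      have h3 := wmean_mono (stdSimplex.zero_le (M.P h s a)) fun s' hs' => (abs_le.mp (h2 s' hs')).1
      have h4 := wmean_mono (stdSimplex.zero_le (M.P h s a)) fun s' hs' => (abs_le.mp (h2 s' hs')).2
      rw [wmean_const (stdSimplex.sum_eq_one _), wmean_sub] at h3 h4
      exact abs_le.mpr ⟨h3, h4⟩
    push_cast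
    rw [abs_le]
    constructor
    · obtain ⟨a, ha⟩ := exists_eq_ciSup_of_finite (f := M.Qstar h s)
      have h2 := abs_le.mp (hE h s a hh hs)
      have h3 := abs_le.mp (hP a)
      have h4 := hmax h s a hh
      rw [M.Vstar_of_lt hh, ← ha, MDP.Qstar]
      linarith
    · have h5 : W h s ≤ M.Vstar h s + (k + 1) * η := by
        rw [hWQ h s hh]
        refine wmean_le_of_le (stdSimplex.zero_le _) (stdSimplex.sum_eq_one _) fun a => ?_
        have h2 := abs_le.mp (hE h s a hh hs)
        have h3 := abs_le.mp (hP a)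
        have h4 := M.Qstar_le_Vstar hh s a
        rw [MDP.Qstar] at h4
        linarith
      linarith

/-- Suboptimality of a policy that is greedy for an approximate solution of the optimality
equation, in terms of Bernstein-type one-step errors. -/
lemma MDP.vstar_sub_v_le [Nonempty A] (M : MDP S A H) (π μ : Policy S A) (W : ℕ → S → ℝ)
    (Q : ℕ → S → A → ℝ) {α β : ℝ} (hH : 0 < H) (hd : 0 < M.dm μ) (hα : 0 ≤ α) (hβ : 0 ≤ β)
    (hη : α * H + β ≤ 1)
    (hW0 : ∀ h s, 0 ≤ W h s) (hW1 : ∀ h s, W h s ≤ H) (hWH : ∀ s, W H s = 0)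
    (hWQ : ∀ h s, h < H → W h s = wmean (π h s) (Q h s))
    (hmax : ∀ h s a, h < H → Q h s a ≤ W h s)
    (hE : ∀ h s a, h < H → M.Reachable h s →
      |Q h s a - (M.r h s a + wmean (M.P h s a) (W (h + 1)))|
        ≤ α * √(wvar (M.P h s a) (W (h + 1))) + β) :
    M.vstar - M.v π ≤ 6 * α * √((H : ℝ) ^ 3) + α * (H : ℝ) ^ 2 * (α * H + β) + 2 * H * β := by
  obtain ⟨πs, hπs⟩ := M.exists_greedy
  have hE' : ∀ h s a, h < H → M.Reachable h s →
      |Q h s a - (M.r h s a + wmean (M.P h s a) (W (h + 1)))| ≤ α * H + β := by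
    intro h s a hh hs
    refine (hE h s a hh hs).trans ?_
    have := sqrt_wvar_le_of_mem (stdSimplex.zero_le (M.P h s a)) (stdSimplex.sum_eq_one _)
      (hW0 (h + 1)) (hW1 (h + 1))
    gcongr
  have hclose : ∀ h s, h ≤ H → M.Reachable h s → |W h s - M.Vstar h s| ≤ H * (α * H + β) := by
    intro h s hh hs
    have h1 := M.abs_sub_Vstar_le π μ W Q hd hWH hWQ hmax hE' (H - h) (Nat.sub_le _ _) s
    rw [Nat.sub_sub_self hh] at h1
    refine (h1 hs).trans ?_
    have : ((H - h : ℕ) : ℝ) ≤ H := by exact_mod_cast Nat.sub_le _ _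
    gcongr
  -- The slack 2 in the approximate Bellman inequality pays for a reward of at most 1 and a one-step
  -- error of at most 1, by `hη`.
  have hπW := M.sum_occ_sqrt_wvar_le π W hH hW0 hW1 hWH (fun h s hh hs => by
    rw [hWQ h s hh]
    refine wmean_mono (stdSimplex.zero_le _) fun a _ => ?_
    have h2 := abs_le.mp (hE' h s a hh ⟨π, hs⟩)
    linarith [M.r_le_one h s a])
  have hsV := M.sum_occ_sqrt_wvar_le πs M.Vstar hH M.Vstar_nonneg M.Vstar_le
    (fun s => M.Vstar_of_le le_rfl s) (fun h s hh hs => by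
      rw [← hπs h s hh]
      refine wmean_mono (stdSimplex.zero_le _) fun a _ => ?_
      rw [MDP.Qstar]
      linarith [M.r_le_one h s a])
  have hsum : ∀ (ρ : Policy S A) (f : ℕ → S → A → ℝ) (c d : ℝ),
      ∑ h ∈ Finset.range H, ∑ s, ∑ a, M.occ ρ h s a * (c * f h s a + d)
      = c * ∑ h ∈ Finset.range H, ∑ s, ∑ a, M.occ ρ h s a * f h s a + H * d := by
    intro ρ f c d
    have h1 : ∑ h ∈ Finset.range H, ∑ s, ∑ a, M.occ ρ h s a * d = H * d := by
      simp [← Finset.sum_mul, M.sum_sum_occ]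
    rw [← h1]
    simp only [Finset.mul_sum, ← Finset.sum_add_distrib]
    refine Finset.sum_congr rfl fun _ _ => Finset.sum_congr rfl fun _ _ =>
      Finset.sum_congr rfl fun _ _ => by ring
  have e1 : wmean M.init (W 0) - M.v π ≤ α * (3 * √((H : ℝ) ^ 3)) + H * β := by
    have key := M.telescope π (fun h s => W h s - M.V π h s)
      (fun h s a => α * √(wvar (M.P h s a) (W (h + 1))) + β) ?_ ?_
    · rw [wmean_sub, hsum] at key
      refine key.trans ?_
      gcongr
    · intro h s hh hs
      rw [hWQ h s hh, M.V_of_lt π hh, ← wmean_sub]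
      refine wmean_mono (stdSimplex.zero_le _) fun a _ => ?_
      have h2 := abs_le.mp (hE h s a hh ⟨π, hs⟩)
      rw [wmean_sub]
      linarith
    · intro s; simp [hWH, M.V_of_le]
  -- Along an optimal policy total variance is applied to $V^\star$, not to $W$, as greediness gives
  -- no upper bound on $W$ by its backup under that policy. The exchange costs the uniform distance
  -- `hclose` per step, multiplied by the small factor `α`.
  have e2 : M.vstar - wmean M.init (W 0) ≤
      α * (3 * √((H : ℝ) ^ 3)) + H * (α * (H * (α * H + β)) + β) := by
    have key := M.telescope πs (fun h s => M.Vstar h s - W h s)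
      (fun h s a => α * √(wvar (M.P h s a) (W (h + 1))) + β) ?_ ?_
    · rw [wmean_sub] at key
      refine key.trans (le_trans (b := ∑ h ∈ Finset.range H, ∑ s, ∑ a, M.occ πs h s a *
        (α * √(wvar (M.P h s a) (M.Vstar (h + 1))) + (α * (H * (α * H + β)) + β))) ?_ ?_)
      · refine Finset.sum_le_sum fun h hh => Finset.sum_le_sum fun s _ =>
          Finset.sum_le_sum fun a _ => ?_
        have hh' := Finset.mem_range.mp hh
        rcases (M.stateOcc_nonneg πs h s).eq_or_lt with h0 | h0
        · simp [MDP.occ, ← h0]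
        · refine mul_le_mul_of_nonneg_left ?_ (M.occ_nonneg _ _ _ _)
          rw [← add_assoc, ← mul_add]
          gcongr
          refine sqrt_wvar_le (stdSimplex.zero_le _) (stdSimplex.sum_eq_one _) (by positivity) ?_
          intro s' hs'
          exact hclose (h + 1) s' hh' (MDP.Reachable.step hd hh' ⟨πs, h0⟩ hs')
      · rw [hsum]
        gcongr
    · intro h s hh hs
      have h3 : W h s = wmean (πs h s) (fun _ => W h s) :=
        (wmean_const (stdSimplex.sum_eq_one _) _).symm
      rw [← hπs h s hh, h3, ← wmean_sub]
      refine wmean_mono (stdSimplex.zero_le _) fun a _ => ?_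
      have h2 := abs_le.mp (hE h s a hh ⟨πs, hs⟩)
      have h4 := hmax h s a hh
      rw [wmean_sub, MDP.Qstar]
      linarith
    · intro s; simp [hWH, M.Vstar_of_le]
  linarith

end planning

/-! ### Path sums of a controlled Markov chain and time reversal. -/

section paths

variable {S A R : Type*} [Fintype S] [Fintype A] [CommSemiring R]

/-- The weight of a path of a controlled Markov chain, with values in a semiring. -/
def pathWeight (P : ℕ → S → A → S → R) (π : ℕ → S → A → R) (p : S → R) {l : ℕ}
    (s : Fin (l + 1) → S) (a : Fin l → A) : R :=
  p (s 0) * ∏ i : Fin l, (π i (s i.castSucc) (a i) * P i (s i.castSucc) (a i) (s i.succ))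

/-- The weighted sum of a function over all paths. -/
def pathSum (P : ℕ → S → A → S → R) (π : ℕ → S → A → R) (p : S → R) (l : ℕ)
    (Φ : (Fin (l + 1) → S) → (Fin l → A) → R) : R :=
  ∑ s, ∑ a, pathWeight P π p s a * Φ s a

/-- The weight of all paths that are in a given state at step `h`. -/
def forward (P : ℕ → S → A → S → R) (π : ℕ → S → A → R) (p : S → R) : ℕ → S → R
  | 0 => p
  | h + 1 => fun z => ∑ x, ∑ y, forward P π p h x * π h x y * P h x y z

lemma forward_shift (P : ℕ → S → A → S → R) (π : ℕ → S → A → R) (p : S → R) (h : ℕ) :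
    forward (fun k => P (k + 1)) (fun k => π (k + 1)) (forward P π p 1) h
      = forward P π p (h + 1) := by
  induction h with
  | zero => rfl
  | succ h ih => rw [forward, ih]; rfl

lemma pathWeight_cons (P : ℕ → S → A → S → R) (π : ℕ → S → A → R) (p : S → R) {l : ℕ} (x : S)
    (s : Fin (l + 1) → S) (y : A) (a : Fin l → A) :
    pathWeight P π p (Fin.cons x s : Fin (l + 2) → S) (Fin.cons y a : Fin (l + 1) → A)
      = p x * π 0 x y *
        pathWeight (fun k => P (k + 1)) (fun k => π (k + 1)) (P 0 x y) s a := by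
  simp only [pathWeight, Fin.prod_univ_succ, Fin.cons_zero, Fin.castSucc_zero, Fin.cons_succ,
    Fin.castSucc_succ, Fin.val_zero, Fin.val_succ]
  ring

/-- First-step decomposition: the inductions on the length of the path peel off the first transition
and shift time by one. -/
lemma pathSum_succ (P : ℕ → S → A → S → R) (π : ℕ → S → A → R) (p : S → R) (l : ℕ)
    (Φ : (Fin (l + 2) → S) → (Fin (l + 1) → A) → R) :
    pathSum P π p (l + 1) Φ = ∑ x, ∑ y, p x * π 0 x y *
      pathSum (fun k => P (k + 1)) (fun k => π (k + 1)) (P 0 x y) l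
        (fun s a => Φ (Fin.cons x s) (Fin.cons y a)) := by
  rw [pathSum, ← (Fin.consEquiv (fun _ => S)).sum_comp, Fintype.sum_prod_type]
  refine Finset.sum_congr rfl fun x _ => ?_
  simp_rw [← (Fin.consEquiv (fun _ => A)).sum_comp, Fintype.sum_prod_type]
  rw [Finset.sum_comm]
  refine Finset.sum_congr rfl fun y _ => ?_
  simp only [pathSum, Finset.mul_sum]
  refine Finset.sum_congr rfl fun s _ => Finset.sum_congr rfl fun a _ => ?_
  change pathWeight P π p (Fin.cons x s : Fin (l + 2) → S) (Fin.cons y a : Fin (l + 1) → A)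
    * _ = _
  rw [pathWeight_cons, mul_assoc]
  rfl

lemma pathSum_sum_init {ι : Type*} (t : Finset ι) (P : ℕ → S → A → S → R) (π : ℕ → S → A → R)
    (c : ι → R) (q : ι → S → R) (l : ℕ) (Φ : (Fin (l + 1) → S) → (Fin l → A) → R) :
    ∑ j ∈ t, c j * pathSum P π (q j) l Φ = pathSum P π (fun z => ∑ j ∈ t, c j * q j z) l Φ := by
  simp only [pathSum, pathWeight, Finset.mul_sum, Finset.sum_mul]
  rw [Finset.sum_comm]
  refine Finset.sum_congr rfl fun s _ => ?_
  rw [Finset.sum_comm]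
  refine Finset.sum_congr rfl fun a _ => Finset.sum_congr rfl fun j _ => ?_
  ring

/-- A functional of the path after the first step sees the first step through `forward` only. -/
lemma pathSum_succ_of_tail (P : ℕ → S → A → S → R) (π : ℕ → S → A → R) (p : S → R) (l : ℕ)
    (Φ : (Fin (l + 2) → S) → (Fin (l + 1) → A) → R)
    (Ψ : (Fin (l + 1) → S) → (Fin l → A) → R)
    (h : ∀ x y s a, Φ (Fin.cons x s) (Fin.cons y a) = Ψ s a) :
    pathSum P π p (l + 1) Φ
      = pathSum (fun k => P (k + 1)) (fun k => π (k + 1)) (forward P π p 1) l Ψ := by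
  rw [pathSum_succ]
  simp only [h]
  have e : forward P π p 1 = fun z => ∑ j : S × A, (p j.1 * π 0 j.1 j.2) * P 0 j.1 j.2 z := by
    funext z
    rw [Fintype.sum_prod_type]; rfl
  rw [e, ← pathSum_sum_init, Fintype.sum_prod_type]

lemma pathSum_mul_init (P : ℕ → S → A → S → R) (π : ℕ → S → A → R) (q B : S → R) (l : ℕ)
    (Φ : (Fin (l + 1) → S) → (Fin l → A) → R) :
    pathSum P π q l (fun s a => B (s 0) * Φ s a) = pathSum P π (fun z => q z * B z) l Φ := by
  simp only [pathSum, pathWeight]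
  refine Finset.sum_congr rfl fun s _ => Finset.sum_congr rfl fun a _ => ?_
  ring

lemma pathSum_init (P : ℕ → S → A → S → R) (π : ℕ → S → A → R) (hP : ∀ h x y, ∑ z, P h x y z = 1)
    (hπ : ∀ h x, ∑ y, π h x y = 1) (q : S → R) (l : ℕ) (f : S → R) :
    pathSum P π q l (fun s _ => f (s 0)) = ∑ z, q z * f z := by
  induction l generalizing P π q f with
  | zero =>
    simp only [pathSum, pathWeight, Finset.univ_eq_empty, Finset.prod_empty, mul_one]
    simp only [Finset.sum_const, Finset.card_univ, Fintype.card_unique, one_smul]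
    rw [← (Equiv.funUnique (Fin 1) S).symm.sum_comp]
    rfl
  | succ l ih =>
    rw [pathSum_succ]
    refine Finset.sum_congr rfl fun x _ => ?_
    simp only [Fin.cons_zero]
    have h1 : ∀ y, pathSum (fun k => P (k + 1)) (fun k => π (k + 1)) (P 0 x y) l
        (fun _ _ => f x) = f x := by
      intro y
      rw [ih _ _ (fun h => hP (h + 1)) (fun h => hπ (h + 1)) _ (fun _ => f x), ← Finset.sum_mul,
        hP, one_mul]
    simp only [h1, ← Finset.sum_mul, ← Finset.mul_sum, hπ, mul_one]

/-- The marginal of the path at step `h`. -/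
lemma pathSum_step (P : ℕ → S → A → S → R) (π : ℕ → S → A → R) (hP : ∀ h x y, ∑ z, P h x y z = 1)
    (hπ : ∀ h x, ∑ y, π h x y = 1) (q : S → R) (l : ℕ) (h : Fin l) (φ : S → A → S → R) :
    pathSum P π q l (fun s a => φ (s h.castSucc) (a h) (s h.succ))
      = ∑ x, ∑ y, ∑ z, forward P π q h x * π h x y * P h x y z * φ x y z := by
  induction l generalizing P π q with
  | zero => exact h.elim0
  | succ l ih =>
    refine Fin.cases ?_ (fun i => ?_) h
    · rw [pathSum_succ]
      refine Finset.sum_congr rfl fun x _ => Finset.sum_congr rfl fun y _ => ?_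
      simp only [Fin.castSucc_zero, Fin.cons_zero, Fin.cons_succ]
      rw [pathSum_init _ _ (fun h => hP (h + 1)) (fun h => hπ (h + 1)) _ _ (fun z => φ x y z),
        Finset.mul_sum]
      refine Finset.sum_congr rfl fun z _ => ?_
      simp [forward, mul_assoc]
    · rw [pathSum_succ_of_tail P π q l _ (fun s a => φ (s i.castSucc) (a i) (s i.succ)) ?_,
        ih _ _ (fun h => hP (h + 1)) (fun h => hπ (h + 1)), forward_shift]
      · simp only [Fin.val_succ]
      · intro x y s a
        simp only [Fin.castSucc_succ, Fin.cons_succ]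

/-- Backward Markov property: given the path after step `h`, the location at step `h` is
distributed according to Bayes' rule. -/
lemma pathSum_backward [DecidableEq S] [DecidableEq A]
    (P : ℕ → S → A → S → R) (π : ℕ → S → A → R) (q : S → R) (l : ℕ) (h : Fin l) (x : S) (y : A)
    (B : S → R) (hB : ∀ z, forward P π q (h + 1) z * B z = forward P π q h x * π h x y * P h x y z)
    (g : (Fin (l + 1) → S) → (Fin l → A) → R)
    (hg : ∀ s s' a a', (∀ i, h.castSucc < i → s i = s' i) → (∀ i, h < i → a i = a' i) →
      g s a = g s' a') :
    pathSum P π q l (fun s a => if s h.castSucc = x ∧ a h = y then g s a else 0)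
      = pathSum P π q l (fun s a => B (s h.succ) * g s a) := by
  induction l generalizing P π q with
  | zero => exact h.elim0
  | succ l ih =>
    revert hB hg
    refine Fin.cases (fun hB hg => ?_) (fun i hB hg => ?_) h
    -- As $g$ only looks past step `h`, the first state and action in its argument may be replaced
    -- by the fixed `x` and `y`.
    · have hγ : ∀ x' y' s a, g (Fin.cons x' s) (Fin.cons y' a) = g (Fin.cons x s) (Fin.cons y a) := by
        intro x' y' s a
        refine hg _ _ _ _ (fun i => ?_) (fun i => ?_)
        · refine Fin.cases (fun h => absurd h (lt_irrefl _)) (fun j _ => ?_) i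
          simp only [Fin.cons_succ]
        · refine Fin.cases (fun h => absurd h (lt_irrefl _)) (fun j _ => ?_) i
          simp only [Fin.cons_succ]
      rw [pathSum_succ_of_tail P π q l (fun s a => B (s (Fin.succ 0)) * g s a)
        (fun s a => B (s 0) * g (Fin.cons x s) (Fin.cons y a)), pathSum_mul_init, pathSum_succ,
        Finset.sum_eq_single x, Finset.sum_eq_single y]
      · simp only [Fin.castSucc_zero, Fin.cons_zero, and_self, if_true]
        have h1 := pathSum_sum_init {()} (fun k => P (k + 1)) (fun k => π (k + 1))
          (fun _ => q x * π 0 x y) (fun _ => P 0 x y) l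
          (fun s a => g (Fin.cons x s) (Fin.cons y a))
        simp only [Finset.sum_singleton] at h1
        rw [h1]
        congr 1
        funext z
        exact (hB z).symm
      · intro y' _ hy
        simp [Fin.cons_zero, hy, pathSum]
      · simp
      · intro x' _ hx
        simp [Fin.cons_zero, hx, pathSum]
      · simp
      · intro x' y' s a
        simp only [Fin.cons_succ, hγ x' y']
    · have hγ : ∀ x' y' s a, g (Fin.cons x' s) (Fin.cons y' a) = g (Fin.cons x s) (Fin.cons y a) := by
        intro x' y' s a
        refine hg _ _ _ _ (fun j => ?_) (fun j => ?_)
        · refine Fin.cases (fun h => ?_) (fun j _ => ?_) j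
          · simp at h
          · simp only [Fin.cons_succ]
        · refine Fin.cases (fun h => ?_) (fun j _ => ?_) j
          · simp at h
          · simp only [Fin.cons_succ]
      rw [pathSum_succ_of_tail P π q l _ (fun s a => if s i.castSucc = x ∧ a i = y then
          g (Fin.cons x s) (Fin.cons y a) else 0), pathSum_succ_of_tail P π q l
          (fun s a => B (s i.succ.succ) * g s a)
          (fun s a => B (s i.succ) * g (Fin.cons x s) (Fin.cons y a))]
      · refine ih _ _ _ i ?_ _ ?_
        · intro z
          rw [forward_shift, forward_shift]
          exact hB z
        · intro s s' a a' h1 h2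
          refine hg _ _ _ _ (fun j => ?_) (fun j => ?_)
          · refine Fin.cases (fun _ => rfl) (fun j hj => ?_) j
            simp only [Fin.cons_succ]
            exact h1 j (Fin.succ_lt_succ_iff.mp hj)
          · refine Fin.cases (fun _ => rfl) (fun j hj => ?_) j
            simp only [Fin.cons_succ]
            exact h2 j (Fin.succ_lt_succ_iff.mp hj)
      · intro x' y' s a
        simp only [Fin.cons_succ, hγ x' y']
      · intro x' y' s a
        simp only [Fin.castSucc_succ, Fin.cons_succ, hγ x' y']

end paths

/-! ### Bernstein's inequality with data-dependent coefficients. -/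

section concentration

variable {E : Type*} [MeasurableSpace E]

/-- The compensated exponential `exp (x (y - b) - x² q)`. -/
noncomputable def compExp (x y b q : ℝ) : ENNReal :=
  ENNReal.ofReal (Real.exp (x * (y - b) - x ^ 2 * q))

/-- `Y` is conditionally sub-Poissonian given `m`, with conditional mean `B ∘ m` and conditional
variance proxy `Q ∘ m`. -/
def SubBernstein (P : Measure E) (m : E → E) (Y B Q : E → ℝ) : Prop :=
  ∀ φ : E → ENNReal, Measurable φ → ∀ x : E → ℝ, Measurable x → (∀ e, |x e| ≤ 1) →
    ∫⁻ e, compExp (x (m e)) (Y e) (B (m e)) (Q (m e)) * φ (m e) ∂P ≤ ∫⁻ e, φ (m e) ∂P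

lemma measurable_compExp {α : Type*} [MeasurableSpace α] {x y b q : α → ℝ} (hx : Measurable x)
    (hy : Measurable y) (hb : Measurable b) (hq : Measurable q) :
    Measurable fun t => compExp (x t) (y t) (b t) (q t) :=
  ENNReal.measurable_ofReal.comp (Real.measurable_exp.comp
    ((hx.mul (hy.sub hb)).sub ((hx.pow_const 2).mul hq)))

variable {P : Measure E} [IsProbabilityMeasure P] {m : E → E} {Y B Q : E → ℝ} {n : ℕ}

/-- Exponential moments of a sum over independent copies, where the coefficients may depend on the
information `m` from all copies. -/
lemma SubBernstein.lintegral_prod_le (hS : SubBernstein P m Y B Q) (hm : Measurable m)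
    (hY : Measurable Y) (hB : Measurable B) (hQ : Measurable Q)
    (x : Fin n → (Fin n → E) → ℝ) (hx : ∀ i, Measurable (x i)) (hx1 : ∀ i F, |x i F| ≤ 1)
    (T : Finset (Fin n)) :
    ∫⁻ D : Fin n → E, ∏ i ∈ T, compExp (x i fun j => m (D j)) (Y (D i)) (B (m (D i))) (Q (m (D i)))
      ∂(Measure.pi fun _ => P) ≤ 1 := by
  have hmD : Measurable fun D : Fin n → E => fun j => m (D j) :=
    measurable_pi_lambda _ fun j => hm.comp (measurable_pi_apply j)
  have hmeas : ∀ T : Finset (Fin n), Measurable fun D : Fin n → E =>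
      ∏ i ∈ T, compExp (x i fun j => m (D j)) (Y (D i)) (B (m (D i))) (Q (m (D i))) := by
    intro T
    refine Finset.measurable_prod _ fun i _ => measurable_compExp ((hx i).comp hmD)
      (hY.comp (measurable_pi_apply i)) (hB.comp (hm.comp (measurable_pi_apply i)))
      (hQ.comp (hm.comp (measurable_pi_apply i)))
  induction T using Finset.induction_on with
  | empty => simp
  | insert k T hk ih =>
    refine (lintegral_le_of_lmarginal_le {k} (hmeas _) (hmeas _) ?_).trans ih
    intro D
    rw [lmarginal_singleton, lmarginal_singleton]
    have e1 : ∀ e : E, (fun j => m (Function.update D k e j))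
        = Function.update (fun j => m (D j)) k (m e) := by
      intro e; funext j
      by_cases hj : j = k
      · subst hj; simp
      · simp [hj]
    have e2 : ∀ e : E, ∏ i ∈ T, compExp (x i fun j => m (Function.update D k e j))
          (Y (Function.update D k e i)) (B (m (Function.update D k e i)))
          (Q (m (Function.update D k e i)))
        = ∏ i ∈ T, compExp (x i (Function.update (fun j => m (D j)) k (m e))) (Y (D i))
          (B (m (D i))) (Q (m (D i))) := by
      intro e
      refine Finset.prod_congr rfl fun i hi => ?_
      have : i ≠ k := fun h => hk (h ▸ hi)
      rw [e1, Function.update_of_ne this]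
    simp only [Finset.prod_insert hk, e2]
    simp only [Function.update_self, e1]
    -- With the other copies fixed, their factors depend on copy `k` only through `m`. They form a
    -- test function `φ`, and the remaining factor is integrated out by the defining inequality.
    refine hS (fun f => ∏ i ∈ T, compExp (x i (Function.update (fun j => m (D j)) k f)) (Y (D i))
          (B (m (D i))) (Q (m (D i)))) ?_ (fun f => x k (Function.update (fun j => m (D j)) k f)) ?_
          (fun e => hx1 _ _)
    · refine Finset.measurable_prod _ fun i _ => measurable_compExp ((hx i).comp
        (measurable_update _)) measurable_const measurable_const measurable_const
    · exact (hx k).comp (measurable_update _)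

/-- One-sided Bernstein inequality with data-dependent coefficients. -/
lemma SubBernstein.measure_lt_le (hS : SubBernstein P m Y B Q) (hm : Measurable m)
    (hY : Measurable Y) (hB : Measurable B) (hQ : Measurable Q)
    (c : Fin n → (Fin n → E) → ℝ) (hc : ∀ i, Measurable (c i)) {b l : ℝ} (hb : 0 < b) (hl : 0 < l)
    (hcb : ∀ i F, |c i F| ≤ b) :
    (Measure.pi fun _ : Fin n => P) {D | 2 * √(l * ∑ i, Q (m (D i)) * c i (fun j => m (D j)) ^ 2)
        + 2 * b * l < ∑ i, (Y (D i) - B (m (D i))) * c i (fun j => m (D j))}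
      ≤ ENNReal.ofReal (Real.exp (-l)) := by
  have hmD : Measurable fun D : Fin n → E => fun j => m (D j) :=
    measurable_pi_lambda _ fun j => hm.comp (measurable_pi_apply j)
  let v : (Fin n → E) → ℝ := fun F => ∑ i, Q (F i) * c i F ^ 2
  have hv : Measurable v := Finset.measurable_sum _ fun i _ =>
    (hQ.comp (measurable_pi_apply i)).mul ((hc i).pow_const 2)
  -- The optimal Chernoff parameter $\min(1/b,\sqrt{l/v})$. It may depend on the random variance `v`
  -- because `v` is a function of the conditioning information.
  let lam : (Fin n → E) → ℝ := fun F => if v F ≤ b ^ 2 * l then 1 / b else √(l / v F)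
  have hlam : Measurable lam := Measurable.ite (measurableSet_le hv measurable_const)
    measurable_const (Real.continuous_sqrt.measurable.comp (measurable_const.div hv))
  have hlam0 : ∀ F, 0 ≤ lam F := fun F => by
    simp only [lam]; split_ifs <;> positivity
  have hlam1 : ∀ F, lam F * b ≤ 1 := fun F => by
    simp only [lam]; split_ifs with h
    · rw [one_div, inv_mul_cancel₀ hb.ne']
    · push Not at h
      have hv0 : 0 < v F := lt_trans (by positivity) h
      have : √(l / v F) ≤ 1 / b := by
        refine Real.sqrt_le_iff.mpr ⟨by positivity, ?_⟩
        rw [div_pow, one_pow, div_le_div_iff₀ hv0 (by positivity)]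
        linarith
      calc √(l / v F) * b ≤ 1 / b * b := by gcongr
        _ = 1 := by rw [one_div, inv_mul_cancel₀ hb.ne']
  have key := hS.lintegral_prod_le hm hY hB hQ (fun i F => lam F * c i F)
    (fun i => hlam.mul (hc i)) (fun i F => by
      rw [abs_mul, abs_of_nonneg (hlam0 F)]
      exact (mul_le_mul_of_nonneg_left (hcb i F) (hlam0 F)).trans (hlam1 F)) Finset.univ
  have hmeas : Measurable fun D : Fin n → E => ∏ i, compExp (lam (fun j => m (D j)) *
      c i fun j => m (D j)) (Y (D i)) (B (m (D i))) (Q (m (D i))) := by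
    refine Finset.measurable_prod _ fun i _ => measurable_compExp
      ((hlam.mul (hc i)).comp hmD)
      (hY.comp (measurable_pi_apply i)) (hB.comp (hm.comp (measurable_pi_apply i)))
      (hQ.comp (hm.comp (measurable_pi_apply i)))
  have hmarkov := mul_meas_ge_le_lintegral (μ := Measure.pi fun _ : Fin n => P) hmeas
    (ENNReal.ofReal (Real.exp l))
  have hsub : {D : Fin n → E | 2 * √(l * ∑ i, Q (m (D i)) * c i (fun j => m (D j)) ^ 2)
        + 2 * b * l < ∑ i, (Y (D i) - B (m (D i))) * c i (fun j => m (D j))}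
      ⊆ {D | ENNReal.ofReal (Real.exp l) ≤ ∏ i, compExp (lam (fun j => m (D j)) *
      c i fun j => m (D j)) (Y (D i)) (B (m (D i))) (Q (m (D i)))} := by
    intro D hD
    simp only [Set.mem_ofPred_eq] at hD ⊢
    simp only [compExp]
    rw [← ENNReal.ofReal_prod_of_nonneg fun i _ => (Real.exp_pos _).le, ← Real.exp_sum]
    refine ENNReal.ofReal_le_ofReal (Real.exp_le_exp.mpr ?_)
    set F : Fin n → E := fun j => m (D j) with hF
    have e : ∑ i, (lam F * c i F * (Y (D i) - B (m (D i))) - (lam F * c i F) ^ 2 * Q (m (D i)))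
        = lam F * ∑ i, (Y (D i) - B (m (D i))) * c i F - lam F ^ 2 * v F := by
      simp only [v, Finset.mul_sum, ← Finset.sum_sub_distrib]
      exact Finset.sum_congr rfl fun i _ => by simp only [hF]; ring
    rw [e]
    have hD' : 2 * √(l * v F) + 2 * b * l < ∑ i, (Y (D i) - B (m (D i))) * c i F := hD
    have h1 := mul_le_mul_of_nonneg_left hD'.le (hlam0 F)
    refine le_trans ?_ (sub_le_sub_right h1 _)
    simp only [lam]
    split_ifs with h
    · have h2 : 1 / b * (2 * b * l) = 2 * l := by field_simp
      have h3 : (1 / b) ^ 2 * v F ≤ l := by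
        rw [div_pow, one_pow, div_mul_eq_mul_div, div_le_iff₀ (by positivity)]
        linarith
      have h4 : 0 ≤ 1 / b * (2 * √(l * v F)) := by positivity
      rw [mul_add, h2]
      linarith
    · push Not at h
      have hv0 : 0 < v F := lt_trans (by positivity) h
      have h2 : √(l / v F) * √(l * v F) = l := by
        rw [← Real.sqrt_mul (by positivity), show l / v F * (l * v F) = l ^ 2 by field_simp,
          Real.sqrt_sq hl.le]
      have h3 : √(l / v F) ^ 2 * v F = l := by
        rw [Real.sq_sqrt (by positivity)]; field_simp
      have h4 : 0 ≤ √(l / v F) * (2 * b * l) := by positivity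
      rw [mul_add, h3]
      linarith
  refine (measure_mono hsub).trans ?_
  rw [Real.exp_neg, ENNReal.ofReal_inv_of_pos (Real.exp_pos _)]
  rw [ENNReal.le_inv_iff_mul_le, mul_comm]
  exact hmarkov.trans key

/-- Two-sided Bernstein inequality with data-dependent coefficients. -/
lemma SubBernstein.measure_abs_lt_le (hS : SubBernstein P m Y B Q) (hm : Measurable m)
    (hY : Measurable Y) (hB : Measurable B) (hQ : Measurable Q)
    (c : Fin n → (Fin n → E) → ℝ) (hc : ∀ i, Measurable (c i)) {b l : ℝ} (hb : 0 < b) (hl : 0 < l)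
    (hcb : ∀ i F, |c i F| ≤ b) :
    (Measure.pi fun _ : Fin n => P) {D | 2 * √(l * ∑ i, Q (m (D i)) * c i (fun j => m (D j)) ^ 2)
        + 2 * b * l < |∑ i, (Y (D i) - B (m (D i))) * c i (fun j => m (D j))|}
      ≤ ENNReal.ofReal (2 * Real.exp (-l)) := by
  have h1 := hS.measure_lt_le hm hY hB hQ c hc hb hl hcb
  have h2 := hS.measure_lt_le hm hY hB hQ (fun i F => -c i F) (fun i => (hc i).neg) hb hl
    (fun i F => by simpa using hcb i F)
  simp only [neg_sq, mul_neg, Finset.sum_neg_distrib] at h2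
  rw [two_mul (Real.exp _), ENNReal.ofReal_add (Real.exp_pos _).le (Real.exp_pos _).le]
  refine le_trans (measure_mono ?_) ((measure_union_le _ _).trans (add_le_add h1 h2))
  intro D hD
  rw [Set.mem_ofPred_eq] at hD
  exact lt_abs.mp hD

lemma exp_le_one_add_add_sq {x : ℝ} (hx : |x| ≤ 1) : Real.exp x ≤ 1 + x + x ^ 2 := by
  have := (abs_le.mp (Real.abs_exp_sub_one_sub_id_le hx)).2
  linarith

/-- Unconditional version: bounded random variables. -/
lemma subBernstein_of_bounded (e₀ : E) {b q : ℝ} (hY : Measurable Y) (hY1 : ∀ᵐ e ∂P, |Y e| ≤ 1)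
    (hb : ∫ e, Y e ∂P = b) (hq : ∫ e, Y e ^ 2 ∂P ≤ q) :
    SubBernstein P (fun _ => e₀) Y (fun _ => b) (fun _ => q) := by
  intro φ _ x _ hx1
  have hx := hx1 e₀
  set t := x e₀
  rw [lintegral_mul_const _ (measurable_compExp measurable_const hY measurable_const
    measurable_const), lintegral_const, measure_univ, mul_one]
  refine mul_le_of_le_one_left zero_le ?_
  have hi1 : Integrable Y P := Integrable.of_bound hY.aestronglyMeasurable 1 hY1
  have hi2 : Integrable (fun e => Y e ^ 2) P := by
    refine Integrable.of_bound (hY.pow_const 2).aestronglyMeasurable 1 ?_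
    filter_upwards [hY1] with e he
    rw [Real.norm_eq_abs, abs_pow]
    exact pow_le_one₀ (abs_nonneg _) he
  have h1 : ∀ᵐ e ∂P, compExp t (Y e) b q ≤
      ENNReal.ofReal (Real.exp (-(t * b) - t ^ 2 * q) * (1 + t * Y e + t ^ 2 * Y e ^ 2)) := by
    filter_upwards [hY1] with e he
    refine ENNReal.ofReal_le_ofReal ?_
    rw [show t * (Y e - b) - t ^ 2 * q = (-(t * b) - t ^ 2 * q) + t * Y e by ring, Real.exp_add]
    refine mul_le_mul_of_nonneg_left ?_ (Real.exp_pos _).le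
    rw [← mul_pow]
    refine exp_le_one_add_add_sq ?_
    rw [abs_mul]
    exact mul_le_one₀ hx (abs_nonneg _) he
  refine (lintegral_mono_ae h1).trans ?_
  have hi : Integrable (fun e => Real.exp (-(t * b) - t ^ 2 * q) *
      (1 + t * Y e + t ^ 2 * Y e ^ 2)) P :=
    (((integrable_const _).add (hi1.const_mul _)).add (hi2.const_mul _)).const_mul _
  rw [← ofReal_integral_eq_lintegral_ofReal hi]
  · rw [integral_const_mul, integral_add, integral_add, integral_const_mul, integral_const_mul, hb]
    · refine ENNReal.ofReal_le_one.mpr ?_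
      simp only [integral_const, probReal_univ, smul_eq_mul, mul_one]
      have h3 : 1 + t * b + t ^ 2 * ∫ e, Y e ^ 2 ∂P ≤ Real.exp (t * b + t ^ 2 * q) := by
        have := Real.add_one_le_exp (t * b + t ^ 2 * q)
        have := mul_le_mul_of_nonneg_left hq (sq_nonneg t)
        linarith
      calc _ ≤ Real.exp (-(t * b) - t ^ 2 * q) * Real.exp (t * b + t ^ 2 * q) := by gcongr
        _ = 1 := by rw [← Real.exp_add]; simp
    · exact integrable_const _
    · exact hi1.const_mul _
    · exact (integrable_const _).add (hi1.const_mul _)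
    · exact hi2.const_mul _
  · refine Filter.Eventually.of_forall fun e => ?_
    refine mul_nonneg (Real.exp_pos _).le ?_
    nlinarith [sq_nonneg (t * Y e + 1), sq_nonneg (t * Y e)]

end concentration

/-! ### The law of an episode conditioned on its future. -/

section law

variable {S A : Type*} [Fintype S] [Fintype A] {H : ℕ}

/-- Transition probabilities as extended nonnegative reals. -/
noncomputable def MDP.eP (M : MDP S A H) (h : ℕ) (s : S) (a : A) (s' : S) : ENNReal :=
  ENNReal.ofReal (M.P h s a s')

/-- Action probabilities as extended nonnegative reals. -/
noncomputable def Policy.e (π : Policy S A) (h : ℕ) (s : S) (a : A) : ENNReal :=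
  ENNReal.ofReal (π h s a)

/-- Initial probabilities as extended nonnegative reals. -/
noncomputable def MDP.eInit (M : MDP S A H) (s : S) : ENNReal := ENNReal.ofReal (M.init s)

lemma sum_ofReal_stdSimplex {X : Type*} [Fintype X] (p : stdSimplex ℝ X) :
    ∑ x, ENNReal.ofReal (p x) = 1 := by
  rw [← ENNReal.ofReal_sum_of_nonneg fun x _ => stdSimplex.zero_le p x, stdSimplex.sum_eq_one,
    ENNReal.ofReal_one]

lemma MDP.forward_eq (M : MDP S A H) (π : Policy S A) (h : ℕ) (s : S) :
    forward M.eP (Policy.e π) M.eInit h s = ENNReal.ofReal (M.stateOcc π h s) := by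
  induction h generalizing s with
  | zero => rfl
  | succ h ih =>
    have h0 : ∀ x b, 0 ≤ M.stateOcc π h x * π h x b * M.P h x b s := fun x b =>
      mul_nonneg (M.occ_nonneg π h x b) (stdSimplex.zero_le _ _)
    rw [forward, MDP.stateOcc, ENNReal.ofReal_sum_of_nonneg fun x _ =>
      Finset.sum_nonneg fun b _ => h0 x b]
    refine Finset.sum_congr rfl fun x _ => ?_
    rw [ENNReal.ofReal_sum_of_nonneg fun b _ => h0 x b]
    refine Finset.sum_congr rfl fun b _ => ?_
    rw [ih, ENNReal.ofReal_mul (mul_nonneg (M.stateOcc_nonneg π h x)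
      (stdSimplex.zero_le _ _)), ENNReal.ofReal_mul (M.stateOcc_nonneg _ _ _)]
    rfl

variable [MeasurableSpace S] [MeasurableSpace A]

/-- The conditional law of the rewards given the states and the actions. -/
noncomputable def MDP.rewardLaw (M : MDP S A H) (s : Fin (H + 1) → S) (a : Fin H → A) :
    Measure (Fin H → ℝ) :=
  Measure.pi fun h : Fin H => (M.R h (s h.castSucc) (a h) : Measure ℝ)

instance (M : MDP S A H) (s : Fin (H + 1) → S) (a : Fin H → A) :
    IsProbabilityMeasure (M.rewardLaw s a) := by
  unfold MDP.rewardLaw; infer_instance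

lemma MDP.lintegral_episodeLaw (M : MDP S A H) (μ : Policy S A) {F : Episode S A H → ENNReal}
    (hF : Measurable F) :
    ∫⁻ e, F e ∂(M.episodeLaw μ) = pathSum M.eP (Policy.e μ) M.eInit H
      (fun s a => ∫⁻ r, F (s, a, r) ∂(M.rewardLaw s a)) := by
  rw [MDP.episodeLaw, lintegral_finsetSum_measure, pathSum]
  refine Finset.sum_congr rfl fun s _ => ?_
  rw [lintegral_finsetSum_measure]
  refine Finset.sum_congr rfl fun a _ => ?_
  rw [lintegral_smul_measure, lintegral_map hF (by fun_prop), smul_eq_mul]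
  congr 1
  rw [pathWeight, ENNReal.ofReal_mul (stdSimplex.zero_le _ _), ENNReal.ofReal_prod_of_nonneg
    fun i _ => mul_nonneg (stdSimplex.zero_le _ _) (stdSimplex.zero_le _ _)]
  congr 1
  refine Finset.prod_congr rfl fun i _ => ?_
  rw [ENNReal.ofReal_mul (stdSimplex.zero_le _ _)]
  rfl

lemma MDP.sum_eP (M : MDP S A H) (h : ℕ) (s : S) (a : A) : ∑ z, M.eP h s a z = 1 :=
  sum_ofReal_stdSimplex _

lemma Policy.sum_e (π : Policy S A) (h : ℕ) (s : S) : ∑ a, Policy.e π h s a = 1 :=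
  sum_ofReal_stdSimplex _

instance (M : MDP S A H) (μ : Policy S A) : IsProbabilityMeasure (M.episodeLaw μ) := by
  constructor
  rw [← lintegral_one, M.lintegral_episodeLaw μ measurable_const]
  simp only [lintegral_one, measure_univ]
  rw [pathSum_init _ _ M.sum_eP (Policy.sum_e μ) _ _ fun _ => 1]
  simp only [mul_one]
  exact sum_ofReal_stdSimplex _

variable [MeasurableSingletonClass S] [MeasurableSingletonClass A]

lemma measurableSet_at (h : Fin H) (s : S) (a : A) :
    MeasurableSet {e : Episode S A H | e.1 h.castSucc = s ∧ e.2.1 h = a} := by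
  refine MeasurableSet.inter (s₁ := {e : Episode S A H | e.1 h.castSucc = s})
    (s₂ := {e : Episode S A H | e.2.1 h = a}) ?_ ?_
  · exact measurableSet_eq_fun (by fun_prop) measurable_const
  · exact measurableSet_eq_fun (by fun_prop) measurable_const

/-- Expectation of a function of the reward on the event of visiting `(s, a)` at step `h`. -/
lemma MDP.lintegral_at [DecidableEq S] [DecidableEq A] (M : MDP S A H) (μ : Policy S A) (h : Fin H)
    (s : S) (a : A) {f : ℝ → ENNReal} (hf : Measurable f) :
    ∫⁻ e, (if e.1 h.castSucc = s ∧ e.2.1 h = a then f (e.2.2 h) else 0) ∂(M.episodeLaw μ)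
      = ENNReal.ofReal (M.occ μ h s a) * ∫⁻ x, f x ∂(M.R h s a : Measure ℝ) := by
  rw [M.lintegral_episodeLaw]
  · have h1 : ∀ (p : Fin (H + 1) → S) (b : Fin H → A),
        ∫⁻ r, (if p h.castSucc = s ∧ b h = a then f (r h) else 0) ∂(M.rewardLaw p b)
        = if p h.castSucc = s ∧ b h = a then ∫⁻ x, f x ∂(M.R h s a : Measure ℝ) else 0 := by
      intro p b
      split_ifs with hpb
      · have := (measurePreserving_eval (fun i : Fin H =>
          (M.R i (p i.castSucc) (b i) : Measure ℝ)) h).lintegral_comp hf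
        rw [hpb.1, hpb.2] at this
        exact this
      · simp
    simp only [h1]
    rw [pathSum_step _ _ M.sum_eP (Policy.sum_e μ) _ _ _ fun x y _ =>
      if x = s ∧ y = a then ∫⁻ x, f x ∂(M.R h s a : Measure ℝ) else 0]
    rw [Finset.sum_eq_single s, Finset.sum_eq_single a]
    · simp only [and_self, if_true, ← Finset.sum_mul, ← Finset.mul_sum, M.sum_eP, mul_one]
      rw [M.forward_eq, Policy.e, ← ENNReal.ofReal_mul (M.stateOcc_nonneg _ _ _)]
      rfl
    · intro b _ hb; simp [hb]
    · simp
    · intro b _ hb; simp [hb]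
    · simp
  · exact Measurable.ite (measurableSet_at h s a) (by fun_prop) measurable_const

/-- Forget everything up to the actions and rewards of step `h`. -/
noncomputable def futureOf (h : Fin H) (x : S) (y : A) (e : Episode S A H) : Episode S A H :=
  (fun i => if h.castSucc < i then e.1 i else x, fun i => if h < i then e.2.1 i else y,
    fun i => if h < i then e.2.2 i else 0)

lemma measurable_futureOf (h : Fin H) (x : S) (y : A) : Measurable (futureOf h x y) := by
  refine Measurable.prodMk (measurable_pi_lambda _ fun i => ?_)
    (Measurable.prodMk (measurable_pi_lambda _ fun i => ?_) (measurable_pi_lambda _ fun i => ?_))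
  all_goals
    split_ifs
    · fun_prop
    · exact measurable_const

lemma futureOf_succ (h : Fin H) (x : S) (y : A) (e : Episode S A H) :
    (futureOf h x y e).1 h.succ = e.1 h.succ := by
  simp [futureOf]

/-- The law of the rewards after step `h` depends only on the path after step `h`. -/
lemma MDP.lintegral_rewardLaw_futureOf (M : MDP S A H) (h : Fin H) (x : S) (y : A)
    {φ : Episode S A H → ENNReal} (hφ : Measurable φ) (s s' : Fin (H + 1) → S) (a a' : Fin H → A)
    (hs : ∀ i, h.castSucc < i → s i = s' i) (ha : ∀ i, h < i → a i = a' i) :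
    ∫⁻ r, φ (futureOf h x y (s, a, r)) ∂(M.rewardLaw s a)
      = ∫⁻ r, φ (futureOf h x y (s', a', r)) ∂(M.rewardLaw s' a') := by
  let t : Fin H → ℝ → ℝ := fun i z => if h < i then z else 0
  have ht : ∀ i, Measurable (t i) := fun i => by
    by_cases hi : h < i
    · simp only [t, hi, if_true]; exact measurable_id
    · simp only [t, hi, if_false]; exact measurable_const
  let ψ : (Fin H → ℝ) → ENNReal := fun r => φ (fun i => if h.castSucc < i then s i else x,
    fun i => if h < i then a i else y, r)
  have hψ : Measurable ψ := hφ.comp (by fun_prop)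
  have e1 : ∀ r, φ (futureOf h x y (s, a, r)) = ψ (fun i => t i (r i)) := fun r => rfl
  have e2 : ∀ r, φ (futureOf h x y (s', a', r)) = ψ (fun i => t i (r i)) := by
    intro r
    simp only [ψ, futureOf]
    congr 2
    · funext i
      split_ifs with hi
      · exact (hs i hi).symm
      · rfl
    · congr 1
      funext i
      split_ifs with hi
      · exact (ha i hi).symm
      · rfl
  have ht' : Measurable fun (r : Fin H → ℝ) i => t i (r i) :=
    measurable_pi_lambda _ fun i => (ht i).comp (measurable_pi_apply i)
  simp only [e1, e2]
  rw [← lintegral_map hψ ht', ← lintegral_map hψ ht', MDP.rewardLaw, MDP.rewardLaw]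
  have : ∀ (p : Fin (H + 1) → S) (b : Fin H → A) (i : Fin H), SigmaFinite
      (Measure.map (t i) (M.R i (p i.castSucc) (b i) : Measure ℝ)) := fun p b i =>
    have := Measure.isProbabilityMeasure_map (μ := (M.R i (p i.castSucc) (b i) : Measure ℝ))
      (ht i).aemeasurable
    inferInstance
  rw [Measure.pi_map_pi fun i => (ht i).aemeasurable, Measure.pi_map_pi fun i => (ht i).aemeasurable]
  congr 2
  funext i
  -- Past `h` the two reward laws agree because the paths do. Up to `h` the rewards are sent to 0,
  -- so any two probability laws have the same image.
  by_cases hi : h < i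
  · rw [hs i.castSucc (Fin.castSucc_lt_castSucc_iff.mpr hi), ha i hi]
  · have : t i = fun _ => 0 := by funext z; simp [t, hi]
    rw [this, Measure.map_const, Measure.map_const, measure_univ, measure_univ]

/-- The conditional probability of `(s_h, a_h) = (x, y)` given `s_{h+1} = z`. -/
noncomputable def MDP.backward (M : MDP S A H) (μ : Policy S A) (h : ℕ) (x : S) (y : A) (z : S) :
    ℝ :=
  M.occ μ h x y * M.P h x y z / M.stateOcc μ (h + 1) z

lemma MDP.backward_nonneg (M : MDP S A H) (μ : Policy S A) (h : ℕ) (x : S) (y : A) (z : S) :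
    0 ≤ M.backward μ h x y z :=
  div_nonneg (mul_nonneg (M.occ_nonneg _ _ _ _) (stdSimplex.zero_le _ _)) (M.stateOcc_nonneg _ _ _)

lemma MDP.occ_mul_P_le (M : MDP S A H) (μ : Policy S A) (h : ℕ) (x : S) (y : A) (z : S) :
    M.occ μ h x y * M.P h x y z ≤ M.stateOcc μ (h + 1) z := by
  have h0 : ∀ x b, 0 ≤ M.stateOcc μ h x * μ h x b * M.P h x b z := fun x b =>
    mul_nonneg (M.occ_nonneg μ h x b) (stdSimplex.zero_le _ _)
  refine le_trans ?_ (Finset.single_le_sum (fun x _ => Finset.sum_nonneg fun b _ => h0 x b)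
    (Finset.mem_univ x))
  exact Finset.single_le_sum (f := fun b => M.stateOcc μ h x * μ h x b * M.P h x b z)
    (fun b _ => h0 x b) (Finset.mem_univ y)

/-- Bayes' rule without division. It survives the convention $0/0=0$: a state of zero occupancy
receives no mass from any location. -/
lemma MDP.stateOcc_mul_backward (M : MDP S A H) (μ : Policy S A) (h : ℕ) (x : S) (y : A) (z : S) :
    M.stateOcc μ (h + 1) z * M.backward μ h x y z = M.occ μ h x y * M.P h x y z := by
  rcases (M.stateOcc_nonneg μ (h + 1) z).eq_or_lt with h0 | h0
  · have h1 := M.occ_mul_P_le μ h x y z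
    have h2 := mul_nonneg (M.occ_nonneg μ h x y) (stdSimplex.zero_le (M.P h x y) z)
    rw [← h0] at h1 ⊢
    linarith
  · rw [MDP.backward, mul_div_cancel₀ _ h0.ne']

/-- Only an inequality, since at states of zero occupancy all backward probabilities are zero. -/
lemma MDP.sum_backward_le (M : MDP S A H) (μ : Policy S A) (h : ℕ) (z : S) :
    ∑ x, ∑ y, M.backward μ h x y z ≤ 1 := by
  simp only [MDP.backward, ← Finset.sum_div]
  exact div_le_one_of_le₀ le_rfl (M.stateOcc_nonneg _ _ _)

/-- Backward Markov property of the law of an episode. -/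
lemma MDP.lintegral_backward (M : MDP S A H) (μ : Policy S A) (h : Fin H) (x₀ : S) (y₀ : A)
    {u : S → A → Episode S A H → ENNReal} (hu : ∀ x y, Measurable (u x y)) :
    ∫⁻ e, u (e.1 h.castSucc) (e.2.1 h) (futureOf h x₀ y₀ e) ∂(M.episodeLaw μ)
      = ∫⁻ e, ∑ x, ∑ y, ENNReal.ofReal (M.backward μ h x y (e.1 h.succ)) *
        u x y (futureOf h x₀ y₀ e) ∂(M.episodeLaw μ) := by
  classical
  have hB : ∀ x y, Measurable fun z => ENNReal.ofReal (M.backward μ h x y z) :=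
    fun x y => measurable_of_finite _
  have hm := measurable_futureOf (S := S) (A := A) h x₀ y₀
  have e1 : ∀ e : Episode S A H, u (e.1 h.castSucc) (e.2.1 h) (futureOf h x₀ y₀ e)
      = ∑ x, ∑ y, if e.1 h.castSucc = x ∧ e.2.1 h = y then u x y (futureOf h x₀ y₀ e) else 0 := by
    intro e
    rw [Finset.sum_eq_single (e.1 h.castSucc), Finset.sum_eq_single (e.2.1 h)]
    · simp
    · intro y _ hy; simp [hy.symm]
    · simp
    · intro x _ hx; simp [hx.symm]
    · simp
  have hm1 : ∀ x y, Measurable fun e : Episode S A H =>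
      if e.1 h.castSucc = x ∧ e.2.1 h = y then u x y (futureOf h x₀ y₀ e) else 0 := fun x y =>
    Measurable.ite (measurableSet_at h x y) ((hu x y).comp hm) measurable_const
  have hm2 : ∀ x y, Measurable fun e : Episode S A H =>
      ENNReal.ofReal (M.backward μ h x y (e.1 h.succ)) * u x y (futureOf h x₀ y₀ e) := fun x y =>
    ((hB x y).comp ((measurable_pi_apply h.succ).comp measurable_fst)).mul ((hu x y).comp hm)
  simp only [e1]
  rw [lintegral_finsetSum _ fun x _ => Finset.measurable_sum _ fun y _ => hm1 x y,
    lintegral_finsetSum _ fun x _ => Finset.measurable_sum _ fun y _ => hm2 x y]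
  refine Finset.sum_congr rfl fun x _ => ?_
  rw [lintegral_finsetSum _ fun y _ => hm1 x y, lintegral_finsetSum _ fun y _ => hm2 x y]
  refine Finset.sum_congr rfl fun y _ => ?_
  rw [M.lintegral_episodeLaw μ (hm1 x y), M.lintegral_episodeLaw μ (hm2 x y)]
  have key := pathSum_backward M.eP (Policy.e μ) M.eInit H h x y
    (fun z => ENNReal.ofReal (M.backward μ h x y z)) (fun z => by
      rw [M.forward_eq, M.forward_eq, Policy.e, MDP.eP,
        ← ENNReal.ofReal_mul (M.stateOcc_nonneg _ _ _),
        ← ENNReal.ofReal_mul (M.stateOcc_nonneg _ _ _),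
        ← ENNReal.ofReal_mul (mul_nonneg (M.stateOcc_nonneg _ _ _) (stdSimplex.zero_le _ _)),
        M.stateOcc_mul_backward]
      rfl)
    (fun s a => ∫⁻ r, u x y (futureOf h x₀ y₀ (s, a, r)) ∂(M.rewardLaw s a))
    (fun s s' a a' hs ha => M.lintegral_rewardLaw_futureOf h x₀ y₀ (hu x y) s s' a a' hs ha)
  convert key using 1
  · congr 1
    funext s a
    split_ifs
    · rfl
    · simp
  · congr 1
    funext s a
    have hr : Measurable fun r : Fin H → ℝ => u x y (futureOf h x₀ y₀ (s, a, r)) :=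
      ((hu x y).comp hm).comp (by fun_prop)
    exact lintegral_const_mul (ENNReal.ofReal (M.backward μ h x y (s h.succ))) hr

/-- The indicator of visiting `(x, y)` at step `h`. -/
noncomputable def visit [DecidableEq S] [DecidableEq A] (h : Fin H) (x : S) (y : A)
    (e : Episode S A H) : ℝ :=
  if e.1 h.castSucc = x ∧ e.2.1 h = y then 1 else 0

lemma measurable_visit [DecidableEq S] [DecidableEq A] (h : Fin H) (x : S) (y : A) :
    Measurable (visit h x y) :=
  Measurable.ite (measurableSet_at h x y) measurable_const measurable_const

/-- Given the future, a visit is a Bernoulli variable. -/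
lemma MDP.subBernstein_visit [DecidableEq S] [DecidableEq A] (M : MDP S A H) (μ : Policy S A)
    (h : Fin H) (x : S) (y : A) :
    SubBernstein (M.episodeLaw μ) (futureOf h x y) (visit h x y)
      (fun e => M.backward μ h x y (e.1 h.succ)) (fun e => M.backward μ h x y (e.1 h.succ)) := by
  intro φ hφ t ht ht1
  set B : Episode S A H → ℝ := fun e => M.backward μ h x y (e.1 h.succ) with hBdef
  have hB : Measurable B :=
    (measurable_of_finite (M.backward μ h x y)).comp
      ((measurable_pi_apply h.succ).comp measurable_fst)
  let u : S → A → Episode S A H → ENNReal := fun x' y' f =>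
    compExp (t f) (if x' = x ∧ y' = y then 1 else 0) (B f) (B f) * φ f
  have hu : ∀ x' y', Measurable (u x' y') := fun x' y' =>
    (measurable_compExp ht measurable_const hB hB).mul hφ
  refine (M.lintegral_backward μ h x y hu).trans_le ?_
  refine lintegral_mono fun e => ?_
  simp only [← futureOf_succ h x y e]
  set f := futureOf h x y e
  set z := f.1 h.succ with hz
  have hBf : B f = M.backward μ h x y z := rfl
  simp only [u, ← mul_assoc, ← Finset.sum_mul]
  -- The test function depends on the future only and factors out. What is left is the exponential
  -- moment of a centred Bernoulli variable, bounded by $e^w\le1+w+w^2$ and $1+y\le e^y$.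
  refine mul_le_of_le_one_left zero_le ?_
  have h1 : ∀ x' y', ENNReal.ofReal (M.backward μ h x' y' z) *
      compExp (t f) (if x' = x ∧ y' = y then 1 else 0) (B f) (B f) =
      ENNReal.ofReal (M.backward μ h x' y' z *
        Real.exp (t f * ((if x' = x ∧ y' = y then 1 else 0) - B f) - t f ^ 2 * B f)) := by
    intro x' y'
    rw [compExp, ← ENNReal.ofReal_mul (M.backward_nonneg _ _ _ _ _)]
  have hn : ∀ x' y', 0 ≤ M.backward μ h x' y' z *
        Real.exp (t f * ((if x' = x ∧ y' = y then 1 else 0) - B f) - t f ^ 2 * B f) :=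
    fun x' y' => mul_nonneg (M.backward_nonneg _ _ _ _ _) (Real.exp_pos _).le
  simp only [h1]
  simp only [← ENNReal.ofReal_sum_of_nonneg fun y' _ => hn _ y']
  rw [← ENNReal.ofReal_sum_of_nonneg fun x' _ => Finset.sum_nonneg fun y' _ => hn x' y']
  refine ENNReal.ofReal_le_one.mpr ?_
  set w := t f
  have h2 : ∀ x' y', M.backward μ h x' y' z *
        Real.exp (w * ((if x' = x ∧ y' = y then 1 else 0) - B f) - w ^ 2 * B f)
      = Real.exp (-(w * B f + w ^ 2 * B f)) * (M.backward μ h x' y' z +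
        if x' = x ∧ y' = y then M.backward μ h x' y' z * (Real.exp w - 1) else 0) := by
    intro x' y'
    split_ifs
    · rw [show w * (1 - B f) - w ^ 2 * B f = -(w * B f + w ^ 2 * B f) + w by ring, Real.exp_add]
      ring
    · rw [show w * (0 - B f) - w ^ 2 * B f = -(w * B f + w ^ 2 * B f) by ring]
      ring
  simp only [h2, ← Finset.mul_sum, Finset.sum_add_distrib]
  have h3 : ∑ x', ∑ y', (if x' = x ∧ y' = y then M.backward μ h x' y' z * (Real.exp w - 1) else 0)
      = B f * (Real.exp w - 1) := by
    rw [Finset.sum_eq_single x, Finset.sum_eq_single y]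
    · simp [hBf]
    · intro b _ hb; simp [hb]
    · simp
    · intro b _ hb; simp [hb]
    · simp
  rw [h3, Real.exp_neg, inv_mul_le_iff₀ (Real.exp_pos _), mul_one]
  have h4 := exp_le_one_add_add_sq (ht1 f)
  have h5 := Real.add_one_le_exp (w * B f + w ^ 2 * B f)
  have h6 := M.sum_backward_le μ h z
  have h7 : 0 ≤ B f := M.backward_nonneg _ _ _ _ _
  nlinarith

end law

/-! ### Measurability of the value estimates and their dependence on the future only. -/

section estimates

variable {S A : Type*} [Fintype S] [Fintype A] [DecidableEq S] [DecidableEq A] {H n : ℕ}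

/-- The value estimates of APVI, computed without reference to the maximizing policy. -/
noncomputable def Vopt (δ K : ℝ) (D : Dataset S A H n) (h : ℕ) (s : S) : ℝ :=
  if hh : h < H then
    ⨆ a, Qbar δ K D ⟨h, hh⟩ (fun s' => Vopt δ K D (h + 1) s') s a
  else 0
termination_by H - h

lemma Vopt_of_lt (δ K : ℝ) (D : Dataset S A H n) (h : Fin H) (s : S) :
    Vopt δ K D h s = ⨆ a, Qbar δ K D h (Vopt δ K D (h + 1)) s a := by
  rw [Vopt, dif_pos h.2]

lemma Vopt_of_le (δ K : ℝ) (D : Dataset S A H n) {h : ℕ} (hh : H ≤ h) (s : S) :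
    Vopt δ K D h s = 0 := by
  rw [Vopt, dif_neg hh.not_gt]

lemma IsAPVIOutput.wmean_eq {δ K : ℝ} {D : Dataset S A H n} {π : Policy S A}
    (hπ : IsAPVIOutput δ K D π) (h : Fin H) (s : S) :
    wmean (π h s) (Qbar δ K D h (Vhat δ K D π (h + 1)) s)
      = ⨆ a, Qbar δ K D h (Vhat δ K D π (h + 1)) s a := by
  have hb : BddAbove (Set.range (Qbar δ K D h (Vhat δ K D π (h + 1)) s)) :=
    (Set.finite_range _).bddAbove
  obtain ⟨a, -⟩ := exists_pos_of_stdSimplex (π h s)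
  have : Nonempty A := ⟨a⟩
  refine le_antisymm ?_ (ciSup_le fun a => ?_)
  · exact wmean_le_of_le (stdSimplex.zero_le _) (stdSimplex.sum_eq_one _) fun a => le_ciSup hb a
  · have := hπ h s (stdSimplex.vertex a)
    rwa [wmean_vertex] at this

/-- Ties affect the policy but not the value of the maximum. One good event, defined through `Vopt`
without mention of a policy, thus serves all outputs at once. -/
lemma IsAPVIOutput.Vhat_eq {δ K : ℝ} {D : Dataset S A H n} {π : Policy S A}
    (hπ : IsAPVIOutput δ K D π) :
    ∀ (k h : ℕ), H - h = k → Vhat δ K D π h = Vopt δ K D h := by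
  intro k
  induction k with
  | zero =>
    intro h hk
    funext s
    rw [Vopt_of_le δ K D (by omega), Vhat, dif_neg (by omega)]
  | succ k ih =>
    intro h hk
    have hh : h < H := by omega
    funext s
    have h1 := hπ.wmean_eq ⟨h, hh⟩ s
    rw [Vopt_of_lt δ K D ⟨h, hh⟩, Vhat, dif_pos hh, ← ih (h + 1) (by omega), ← h1]
    rfl

lemma Qbar_nonneg (δ K : ℝ) (D : Dataset S A H n) (h : Fin H) (V : S → ℝ) (s : S) (a : A) :
    0 ≤ Qbar δ K D h V s a := le_max_right _ _

lemma Vopt_nonneg [Nonempty A] (δ K : ℝ) (D : Dataset S A H n) (h : ℕ) (s : S) :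
    0 ≤ Vopt δ K D h s := by
  by_cases hh : h < H
  · rw [Vopt_of_lt δ K D ⟨h, hh⟩]
    exact (Qbar_nonneg _ _ _ _ _ _ _).trans (le_ciSup (Set.finite_range _).bddAbove
      (Classical.arbitrary A))
  · rw [Vopt_of_le δ K D (by omega)]

lemma Vopt_le_sub [Nonempty A] (δ K : ℝ) (D : Dataset S A H n) (h : ℕ) (s : S) :
    Vopt δ K D h s ≤ ((H - h : ℕ) : ℝ) := by
  by_cases hh : h < H
  · rw [Vopt_of_lt δ K D ⟨h, hh⟩, Nat.cast_sub hh.le]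
    refine ciSup_le fun a => ?_
    have h1 : (h : ℝ) ≤ H := by exact_mod_cast hh.le
    exact max_le (min_le_right _ _) (by linarith)
  · rw [Vopt_of_le δ K D (by omega)]; positivity

lemma Vopt_le [Nonempty A] (δ K : ℝ) (D : Dataset S A H n) (h : ℕ) (s : S) :
    Vopt δ K D h s ≤ H :=
  (Vopt_le_sub δ K D h s).trans (by exact_mod_cast Nat.sub_le _ _)

/-- The data of two data sets agree at step `h`. -/
def AgreeAt (D D' : Dataset S A H n) (h : Fin H) : Prop :=
  ∀ τ, (D τ).1 h.castSucc = (D' τ).1 h.castSucc ∧ (D τ).1 h.succ = (D' τ).1 h.succ ∧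
    (D τ).2.1 h = (D' τ).2.1 h ∧ (D τ).2.2 h = (D' τ).2.2 h

lemma AgreeAt.Qbar_eq {D D' : Dataset S A H n} {h : Fin H} (hD : AgreeAt D D' h) (δ K : ℝ) :
    Qbar δ K D h = Qbar δ K D' h := by
  have hc : count D h = count D' h := by
    funext s a
    simp only [count, (hD _).1, (hD _).2.2.1]
  have hP : Phat D h = Phat D' h := by
    funext s a s'
    simp only [Phat, hc, (hD _).1, (hD _).2.1, (hD _).2.2.1]
  have hr : rhat D h = rhat D' h := by
    funext s a
    simp only [rhat, hc, (hD _).1, (hD _).2.2.1, (hD _).2.2.2]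
  funext V s a
  simp only [Qbar, penalty, hc, hP, hr]

lemma Vopt_congr (δ K : ℝ) {D D' : Dataset S A H n} {k : ℕ}
    (hD : ∀ h : Fin H, k ≤ h → AgreeAt D D' h) :
    ∀ (j h : ℕ), H - h = j → k ≤ h → Vopt δ K D h = Vopt δ K D' h := by
  intro j
  induction j with
  | zero =>
    intro h hj _
    funext s
    rw [Vopt_of_le δ K D (by omega), Vopt_of_le δ K D' (by omega)]
  | succ j ih =>
    intro h hj hk
    have hh : h < H := by omega
    funext s
    rw [Vopt_of_lt δ K D ⟨h, hh⟩, Vopt_of_lt δ K D' ⟨h, hh⟩, (hD ⟨h, hh⟩ hk).Qbar_eq,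
      ih (h + 1) (by omega) (by omega)]

/-- The backward recursion down to step $h+1$ never reads the data of step $h$ or before, apart from
the state $s_{h+1}$, which `futureOf` keeps. -/
lemma Vopt_futureOf (δ K : ℝ) (D : Dataset S A H n) (h : Fin H) (x : S) (y : A) :
    Vopt δ K (fun τ => futureOf h x y (D τ)) (h + 1) = Vopt δ K D (h + 1) := by
  refine Vopt_congr δ K (k := h + 1) (fun i hi τ => ?_) _ (h + 1) rfl le_rfl
  have hi' : h < i := by
    rw [Fin.lt_def]; omega
  have h1 : h.castSucc < i.castSucc := hi'
  have h2 : h.castSucc < i.succ := h1.trans Fin.castSucc_lt_succ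
  simp only [futureOf, h1, h2, hi', if_true, and_self]

variable [MeasurableSpace S] [MeasurableSpace A] [MeasurableSingletonClass S]
  [MeasurableSingletonClass A]

lemma count_eq_sum (D : Dataset S A H n) (h : Fin H) (s : S) (a : A) :
    (count D h s a : ℝ) = ∑ τ, visit h s a (D τ) := by
  simp only [count, visit, Finset.sum_boole]

lemma measurable_count (h : Fin H) (s : S) (a : A) :
    Measurable fun D : Dataset S A H n => (count D h s a : ℝ) := by
  simp only [count_eq_sum]
  exact Finset.measurable_sum _ fun τ _ => (measurable_visit h s a).comp (measurable_pi_apply τ)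

lemma measurable_ite_count {f g : Dataset S A H n → ℝ} (h : Fin H) (s : S) (a : A)
    (hf : Measurable f) (hg : Measurable g) :
    Measurable fun D => if count D h s a = 0 then f D else g D := by
  refine Measurable.ite ?_ hf hg
  have : {D : Dataset S A H n | count D h s a = 0} = {D | (count D h s a : ℝ) = 0} := by
    ext D; simp
  rw [this]
  exact measurableSet_eq_fun (measurable_count h s a) measurable_const

lemma measurable_Phat (h : Fin H) (s : S) (a : A) (s' : S) :
    Measurable fun D : Dataset S A H n => Phat D h s a s' := by
  refine measurable_ite_count h s a measurable_const (Measurable.div ?_ (measurable_count h s a))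
  have e : ∀ D : Dataset S A H n, ((Finset.univ.filter fun τ => (D τ).1 h.castSucc = s ∧
      (D τ).2.1 h = a ∧ (D τ).1 h.succ = s').card : ℝ)
      = ∑ τ, if (D τ).1 h.castSucc = s ∧ (D τ).2.1 h = a ∧ (D τ).1 h.succ = s' then 1 else 0 :=
    fun D => by rw [Finset.sum_boole]
  simp only [e]
  refine Finset.measurable_sum _ fun τ _ => Measurable.ite ?_ measurable_const measurable_const
  refine MeasurableSet.inter (s₁ := {D : Dataset S A H n | (D τ).1 h.castSucc = s})
    (measurableSet_eq_fun (by fun_prop) measurable_const) (MeasurableSet.inter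
      (s₁ := {D : Dataset S A H n | (D τ).2.1 h = a})
      (measurableSet_eq_fun (by fun_prop) measurable_const)
      (s₂ := {D : Dataset S A H n | (D τ).1 h.succ = s'})
      (measurableSet_eq_fun (by fun_prop) measurable_const))

lemma measurable_rhat (h : Fin H) (s : S) (a : A) :
    Measurable fun D : Dataset S A H n => rhat D h s a := by
  refine measurable_ite_count h s a measurable_const (Measurable.div ?_ (measurable_count h s a))
  refine Finset.measurable_sum _ fun τ _ => Measurable.ite ?_ (by fun_prop) measurable_const
  have hτ : Measurable fun D : Dataset S A H n => D τ := measurable_pi_apply τ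
  exact hτ (measurableSet_at h s a)

lemma measurable_wmean {p V : Dataset S A H n → S → ℝ} (hp : ∀ s', Measurable fun D => p D s')
    (hV : ∀ s', Measurable fun D => V D s') : Measurable fun D => wmean (p D) (V D) :=
  Finset.measurable_sum _ fun s' _ => (hp s').mul (hV s')

lemma measurable_Qbar (δ K : ℝ) (h : Fin H) (s : S) (a : A) {V : Dataset S A H n → S → ℝ}
    (hV : ∀ s', Measurable fun D => V D s') :
    Measurable fun D : Dataset S A H n => Qbar δ K D h (V D) s a := by
  have hm := measurable_wmean (measurable_Phat (n := n) h s a) hV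
  have hr := measurable_rhat (n := n) h s a
  have hc := measurable_count (n := n) h s a
  refine Measurable.max (Measurable.min (Measurable.sub (hr.add hm) ?_) measurable_const)
    measurable_const
  refine measurable_ite_count h s a measurable_const (Measurable.add (Measurable.const_mul
    (Real.continuous_sqrt.measurable.comp (Measurable.div (Measurable.mul_const ?_ _) hc)) _)
    (measurable_const.div hc))
  refine Finset.measurable_sum _ fun s' _ => (measurable_Phat h s a s').mul
    (Measurable.pow_const (Measurable.sub (hr.add (hV s')) ?_) 2)
  exact measurable_wmean (measurable_Phat (n := n) h s a) fun s' => hr.add (hV s')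

lemma measurable_Vopt (δ K : ℝ) :
    ∀ (k h : ℕ), H - h = k → ∀ s, Measurable fun D : Dataset S A H n => Vopt δ K D h s := by
  intro k
  induction k with
  | zero =>
    intro h hk s
    simp only [Vopt_of_le δ K _ (show H ≤ h by omega)]
    exact measurable_const
  | succ k ih =>
    intro h hk s
    have hh : h < H := by omega
    have e := fun D : Dataset S A H n => Vopt_of_lt δ K D ⟨h, hh⟩ s
    simp only at e
    simp only [e]
    exact Measurable.iSup fun a => measurable_Qbar δ K _ s a (ih (h + 1) (by omega))

end estimates

/-! ### The good event and its probability. -/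

section events

variable {S A : Type*} [Fintype S] [Fintype A] [DecidableEq S] [DecidableEq A] {H n : ℕ}

/-- The centred value estimate at the next step. -/
noncomputable def MDP.centred (M : MDP S A H) (δ K : ℝ) (D : Dataset S A H n) (h : ℕ) (s : S)
    (a : A) (z : S) : ℝ :=
  Vopt δ K D (h + 1) z - wmean (M.P h s a) (Vopt δ K D (h + 1))

/-- The estimates at `(h, s, a)` concentrate. -/
structure MDP.GoodAt (M : MDP S A H) (μ : Policy S A) (δ K l : ℝ) (D : Dataset S A H n)
    (h : Fin H) (s : S) (a : A) : Prop where
  visits : |∑ τ, (visit h s a (D τ) - M.occ μ h s a)| ≤ 2 * √(l * ∑ _τ : Fin n, M.occ μ h s a) + 2 * l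
  states : |∑ τ, ((if (D τ).1 h.castSucc = s then 1 else 0) - M.stateOcc μ h s)|
    ≤ 2 * √(l * ∑ _τ : Fin n, M.stateOcc μ h s) + 2 * l
  rewards : |∑ τ, visit h s a (D τ) * ((D τ).2.2 h - M.r h s a)|
    ≤ 2 * √(l * ∑ _τ : Fin n, M.occ μ h s a) + 2 * l
  -- Visits are centred at their conditional probability given the future, so that the
  -- data-dependent function `MDP.centred` is a legitimate coefficient.
  values : |∑ τ, (visit h s a (D τ) - M.backward μ h s a ((D τ).1 h.succ)) *
      M.centred δ K D h s a ((D τ).1 h.succ)|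
    ≤ 2 * √(l * ∑ τ, M.backward μ h s a ((D τ).1 h.succ) *
        M.centred δ K D h s a ((D τ).1 h.succ) ^ 2) + 2 * H * l
  variances : |∑ τ, (visit h s a (D τ) - M.backward μ h s a ((D τ).1 h.succ)) *
      M.centred δ K D h s a ((D τ).1 h.succ) ^ 2|
    ≤ 2 * √(l * ∑ τ, M.backward μ h s a ((D τ).1 h.succ) *
        (M.centred δ K D h s a ((D τ).1 h.succ) ^ 2) ^ 2) + 2 * (H : ℝ) ^ 2 * l

variable [MeasurableSpace S] [MeasurableSpace A] [MeasurableSingletonClass S]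
  [MeasurableSingletonClass A]

lemma MDP.abs_centred_le [Nonempty A] (M : MDP S A H) (δ K : ℝ) (D : Dataset S A H n) (h : ℕ)
    (s : S) (a : A) (z : S) : |M.centred δ K D h s a z| ≤ H := by
  have h1 := wmean_le_of_le (stdSimplex.zero_le (M.P h s a)) (stdSimplex.sum_eq_one _)
    (Vopt_le δ K D (h + 1))
  have h2 := wmean_nonneg (stdSimplex.zero_le (M.P h s a)) (Vopt_nonneg δ K D (h + 1))
  have h3 := Vopt_le δ K D (h + 1) z
  have h4 := Vopt_nonneg δ K D (h + 1) z
  rw [abs_le, MDP.centred]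
  constructor <;> linarith

lemma MDP.measurable_centred (M : MDP S A H) (δ K : ℝ) (h : ℕ) (s : S) (a : A) (z : S) :
    Measurable fun D : Dataset S A H n => M.centred δ K D h s a z :=
  (measurable_Vopt δ K _ (h + 1) rfl z).sub (measurable_wmean (fun _ => measurable_const)
    fun s' => measurable_Vopt δ K _ (h + 1) rfl s')

lemma MDP.integral_at (M : MDP S A H) (μ : Policy S A) (h : Fin H) (s : S) (a : A) {f : ℝ → ℝ}
    (hf : Continuous f) (hf0 : ∀ x, 0 ≤ f x) :
    ∫ e, visit h s a e * f (e.2.2 h) ∂(M.episodeLaw μ)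
      = M.occ μ h s a * ∫ x, f x ∂(M.R h s a : Measure ℝ) := by
  have hm : Measurable fun e : Episode S A H => visit h s a e * f (e.2.2 h) :=
    (measurable_visit h s a).mul (hf.measurable.comp (by fun_prop))
  have hv : ∀ e : Episode S A H, 0 ≤ visit h s a e := fun e => by
    rw [visit]; split_ifs <;> simp
  rw [integral_eq_lintegral_of_nonneg_ae (Filter.Eventually.of_forall fun e =>
    mul_nonneg (hv e) (hf0 _)) hm.aestronglyMeasurable, integral_eq_lintegral_of_nonneg_ae
    (Filter.Eventually.of_forall hf0) hf.aestronglyMeasurable]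
  have e1 : ∀ e : Episode S A H, ENNReal.ofReal (visit h s a e * f (e.2.2 h))
      = if e.1 h.castSucc = s ∧ e.2.1 h = a then ENNReal.ofReal (f (e.2.2 h)) else 0 := by
    intro e
    rw [visit]; split_ifs <;> simp
  simp only [e1]
  rw [M.lintegral_at μ h s a (f := fun x => ENNReal.ofReal (f x))
    (ENNReal.measurable_ofReal.comp hf.measurable), ENNReal.toReal_mul,
    ENNReal.toReal_ofReal (M.occ_nonneg _ _ _ _)]

lemma MDP.integral_visit (M : MDP S A H) (μ : Policy S A) (h : Fin H) (s : S) (a : A) :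
    ∫ e, visit h s a e ∂(M.episodeLaw μ) = M.occ μ h s a := by
  have := M.integral_at μ h s a (f := fun _ => 1) continuous_const (fun _ => zero_le_one)
  simpa using this

lemma visit_sq (h : Fin H) (s : S) (a : A) (e : Episode S A H) :
    visit h s a e ^ 2 = visit h s a e := by
  rw [visit]; split_ifs <;> simp

lemma abs_visit_le (h : Fin H) (s : S) (a : A) (e : Episode S A H) : |visit h s a e| ≤ 1 := by
  rw [visit]; split_ifs <;> simp

/-- The reward law is only almost surely supported on $[0,1]$, so boundedness has to be transferred
to the law of the episode. -/
lemma MDP.ae_reward_mem (M : MDP S A H) (μ : Policy S A) (h : Fin H) (s : S) (a : A) :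
    ∀ᵐ e ∂(M.episodeLaw μ), visit h s a e ≠ 0 → e.2.2 h ∈ Set.Icc (0 : ℝ) 1 := by
  have hm : Measurable fun x : ℝ => if x ∈ Set.Icc (0 : ℝ) 1 then (0 : ENNReal) else 1 :=
    Measurable.ite measurableSet_Icc measurable_const measurable_const
  have h1 := M.lintegral_at μ h s a hm
  have h2 : ∫⁻ x, (if x ∈ Set.Icc (0 : ℝ) 1 then (0 : ENNReal) else 1)
      ∂(M.R h s a : Measure ℝ) = 0 := by
    rw [lintegral_eq_zero_iff hm]
    filter_upwards [M.R_mem h s a] with x hx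
    simp [hx]
  rw [h2, mul_zero, lintegral_eq_zero_iff] at h1
  · filter_upwards [h1] with e he hv
    have hv' : e.1 h.castSucc = s ∧ e.2.1 h = a := by
      by_contra hc
      exact hv (if_neg hc)
    simpa [hv'] using he
  · exact Measurable.ite (measurableSet_at h s a) (hm.comp (by fun_prop)) measurable_const

lemma MDP.subBernstein_occ (M : MDP S A H) (μ : Policy S A) (e₀ : Episode S A H) (h : Fin H)
    (s : S) (a : A) :
    SubBernstein (M.episodeLaw μ) (fun _ => e₀) (visit h s a) (fun _ => M.occ μ h s a)
      (fun _ => M.occ μ h s a) := by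
  refine subBernstein_of_bounded e₀ (measurable_visit h s a)
    (Filter.Eventually.of_forall (abs_visit_le h s a)) (M.integral_visit μ h s a) ?_
  simp only [visit_sq, M.integral_visit, le_refl]

lemma MDP.subBernstein_stateOcc (M : MDP S A H) (μ : Policy S A) (e₀ : Episode S A H) (h : Fin H)
    (s : S) :
    SubBernstein (M.episodeLaw μ) (fun _ => e₀) (fun e => if e.1 h.castSucc = s then 1 else 0)
      (fun _ => M.stateOcc μ h s) (fun _ => M.stateOcc μ h s) := by
  have hi : ∫ e : Episode S A H, (if e.1 h.castSucc = s then (1 : ℝ) else 0) ∂(M.episodeLaw μ)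
      = M.stateOcc μ h s := by
    have e1 : ∀ e : Episode S A H, (if e.1 h.castSucc = s then (1 : ℝ) else 0)
        = ∑ a, visit h s a e := by
      intro e
      simp only [visit]
      rw [Finset.sum_eq_single (e.2.1 h)]
      · simp
      · intro b _ hb; simp [hb.symm]
      · simp
    simp only [e1]
    rw [integral_finsetSum _ fun a _ => Integrable.of_bound
      (measurable_visit h s a).aestronglyMeasurable 1
      (Filter.Eventually.of_forall (abs_visit_le h s a))]
    simp only [M.integral_visit, M.sum_occ]
  have hm : Measurable fun e : Episode S A H => if e.1 h.castSucc = s then (1 : ℝ) else 0 :=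
    Measurable.ite (measurableSet_eq_fun (by fun_prop) measurable_const) measurable_const
      measurable_const
  refine subBernstein_of_bounded e₀ hm (Filter.Eventually.of_forall fun e => ?_) hi ?_
  · split_ifs <;> simp
  · have e2 : ∀ e : Episode S A H, (if e.1 h.castSucc = s then (1 : ℝ) else 0) ^ 2
        = if e.1 h.castSucc = s then (1 : ℝ) else 0 := fun e => by split_ifs <;> simp
    simp only [e2, hi, le_refl]

lemma MDP.subBernstein_reward (M : MDP S A H) (μ : Policy S A) (e₀ : Episode S A H) (h : Fin H)
    (s : S) (a : A) :
    SubBernstein (M.episodeLaw μ) (fun _ => e₀)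
      (fun e => visit h s a e * (e.2.2 h - M.r h s a)) (fun _ => 0) (fun _ => M.occ μ h s a) := by
  have hm : Measurable fun e : Episode S A H => visit h s a e * (e.2.2 h - M.r h s a) :=
    (measurable_visit h s a).mul (by fun_prop)
  have hb : ∀ᵐ e ∂(M.episodeLaw μ), |visit h s a e * (e.2.2 h - M.r h s a)| ≤ 1 := by
    filter_upwards [M.ae_reward_mem μ h s a] with e he
    by_cases hv : visit h s a e = 0
    · simp [hv]
    · rw [abs_mul]
      refine mul_le_one₀ (abs_visit_le h s a e) (abs_nonneg _) ?_
      have h1 := he hv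
      have h2 := M.r_nonneg h s a
      have h3 := M.r_le_one h s a
      rw [abs_le]
      constructor <;> linarith [h1.1, h1.2]
  refine subBernstein_of_bounded e₀ hm hb ?_ ?_
  -- The positive part agrees with the reward almost surely and meets the nonnegativity requirement
  -- of `integral_at`.
  · have h1 := M.integral_at μ h s a (f := fun x => max x 0) (by fun_prop) (fun x => le_max_right _ _)
    have h2 : ∫ x, max x 0 ∂(M.R h s a : Measure ℝ) = M.r h s a := by
      refine integral_congr_ae ?_
      filter_upwards [M.R_mem h s a] with x hx using max_eq_left hx.1
    rw [h2] at h1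
    have h3 : ∫ e, visit h s a e * (e.2.2 h - M.r h s a) ∂(M.episodeLaw μ)
        = ∫ e, (visit h s a e * max (e.2.2 h) 0 - visit h s a e * M.r h s a)
          ∂(M.episodeLaw μ) := by
      refine integral_congr_ae ?_
      filter_upwards [M.ae_reward_mem μ h s a] with e he
      by_cases hv : visit h s a e = 0
      · simp [hv]
      · rw [max_eq_left (he hv).1]; ring
    rw [h3, integral_sub, h1, integral_mul_const, M.integral_visit]
    · ring
    · refine Integrable.of_bound ((measurable_visit h s a).mul
        (by fun_prop)).aestronglyMeasurable 1 ?_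
      filter_upwards [M.ae_reward_mem μ h s a] with e he
      by_cases hv : visit h s a e = 0
      · simp [hv]
      · rw [Real.norm_eq_abs, abs_mul, max_eq_left (he hv).1, abs_of_nonneg (he hv).1]
        exact mul_le_one₀ (abs_visit_le h s a e) (he hv).1 (he hv).2
    · refine Integrable.mul_const (Integrable.of_bound
        (measurable_visit h s a).aestronglyMeasurable 1
        (Filter.Eventually.of_forall (abs_visit_le h s a))) _
  · rw [← M.integral_visit μ h s a]
    refine integral_mono_ae ?_ (Integrable.of_bound
        (measurable_visit h s a).aestronglyMeasurable 1
        (Filter.Eventually.of_forall (abs_visit_le h s a))) ?_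
    · refine Integrable.of_bound (hm.pow_const 2).aestronglyMeasurable 1 ?_
      filter_upwards [hb] with e he
      rw [Real.norm_eq_abs, abs_pow]
      exact pow_le_one₀ (abs_nonneg _) he
    · filter_upwards [M.ae_reward_mem μ h s a] with e he
      rw [mul_pow, visit_sq]
      by_cases hv : visit h s a e = 0
      · simp [hv]
      · have h1 := he hv
        have h2 := M.r_nonneg h s a
        have h3 := M.r_le_one h s a
        have h4 : 0 ≤ visit h s a e := by rw [visit]; split_ifs <;> simp
        refine mul_le_of_le_one_right h4 ?_
        rw [sq_le_one_iff_abs_le_one, abs_le]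
        constructor <;> linarith [h1.1, h1.2]

/-- The first three events are unconditional, with trivial information and coefficient 1. The last
two condition each episode on its part after step `h`, with coefficients bounded by $H$ and $H^2$.
-/
lemma MDP.dataLaw_not_goodAt_le [Nonempty A] (M : MDP S A H) (μ : Policy S A) (δ K : ℝ) {l : ℝ}
    (hl : 0 < l) (h : Fin H) (s : S) (a : A) :
    M.dataLaw μ n {D | ¬ M.GoodAt μ δ K l D h s a} ≤ 5 * ENNReal.ofReal (2 * Real.exp (-l)) := by
  have hH : (0 : ℝ) < H := by
    have := h.pos
    exact_mod_cast this
  let e₀ : Episode S A H := (fun _ => s, fun _ => a, fun _ => 0)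
  have hone : ∀ (i : Fin n) (F : Fin n → Episode S A H), |(fun _ _ => (1 : ℝ) : Fin n →
      (Fin n → Episode S A H) → ℝ) i F| ≤ 1 := fun _ _ => by simp
  have hB : Measurable fun e : Episode S A H => M.backward μ h s a (e.1 h.succ) :=
    (measurable_of_finite (M.backward μ h s a)).comp
      ((measurable_pi_apply h.succ).comp measurable_fst)
  have hms : Measurable fun e : Episode S A H => if e.1 h.castSucc = s then (1 : ℝ) else 0 :=
    Measurable.ite (measurableSet_eq_fun (by fun_prop) measurable_const) measurable_const
      measurable_const
  have hmr : Measurable fun e : Episode S A H => visit h s a e * (e.2.2 h - M.r h s a) :=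
    (measurable_visit h s a).mul (by fun_prop)
  have b1 := (M.subBernstein_occ μ e₀ h s a).measure_abs_lt_le (n := n) measurable_const
    (measurable_visit h s a) measurable_const measurable_const (fun _ _ => 1)
    (fun _ => measurable_const) one_pos hl hone
  have b2 := (M.subBernstein_stateOcc μ e₀ h s).measure_abs_lt_le (n := n) measurable_const
    hms measurable_const measurable_const (fun _ _ => 1)
    (fun _ => measurable_const) one_pos hl hone
  have b3 := (M.subBernstein_reward μ e₀ h s a).measure_abs_lt_le (n := n) measurable_const
    hmr measurable_const measurable_const (fun _ _ => 1)
    (fun _ => measurable_const) one_pos hl hone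
  have hcm : ∀ i : Fin n, Measurable fun F : Dataset S A H n =>
      M.centred δ K F h s a ((F i).1 h.succ) := by
    intro i
    have e : ∀ F : Dataset S A H n, M.centred δ K F h s a ((F i).1 h.succ)
        = ∑ z, if (F i).1 h.succ = z then M.centred δ K F h s a z else 0 := fun F => by simp
    simp only [e]
    exact Finset.measurable_sum _ fun z _ => Measurable.ite
      (measurableSet_eq_fun (by fun_prop) measurable_const) (M.measurable_centred δ K h s a z)
      measurable_const
  have b4 := (M.subBernstein_visit μ h s a).measure_abs_lt_le (n := n) (measurable_futureOf h s a)
    (measurable_visit h s a) hB hB (fun i F => M.centred δ K F h s a ((F i).1 h.succ)) hcm hH hl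
    (fun i F => M.abs_centred_le δ K F h s a _)
  have b5 := (M.subBernstein_visit μ h s a).measure_abs_lt_le (n := n) (measurable_futureOf h s a)
    (measurable_visit h s a) hB hB (fun i F => M.centred δ K F h s a ((F i).1 h.succ) ^ 2)
    (fun i => (hcm i).pow_const 2) (pow_pos hH 2) hl
    (fun i F => by
      rw [abs_pow]
      exact pow_le_pow_left₀ (abs_nonneg _) (M.abs_centred_le δ K F h s a _) 2)
  simp only [one_pow, mul_one, sub_zero] at b1 b2 b3
  -- Coefficients must be computed from the futures of the episodes; for the value estimate this
  -- makes no difference.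
  have hc : ∀ D : Dataset S A H n, M.centred δ K (fun j => futureOf h s a (D j)) h s a
      = M.centred δ K D h s a := by
    intro D
    funext z
    simp only [MDP.centred, Vopt_futureOf]
  simp only [hc, futureOf_succ] at b4 b5
  rw [show (5 : ENNReal) * ENNReal.ofReal (2 * Real.exp (-l))
    = ENNReal.ofReal (2 * Real.exp (-l)) + ENNReal.ofReal (2 * Real.exp (-l))
      + ENNReal.ofReal (2 * Real.exp (-l)) + ENNReal.ofReal (2 * Real.exp (-l))
      + ENNReal.ofReal (2 * Real.exp (-l)) by ring]
  refine le_trans (measure_mono ?_) ((measure_union_le _ _).trans (add_le_add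
    ((measure_union_le _ _).trans (add_le_add ((measure_union_le _ _).trans (add_le_add
    ((measure_union_le _ _).trans (add_le_add b1 b2)) b3)) b4)) b5))
  intro D hD
  simp only [Set.mem_union, Set.mem_ofPred_eq] at hD ⊢
  by_contra hcon
  push Not at hcon
  obtain ⟨⟨⟨⟨c1, c2⟩, c3⟩, c4⟩, c5⟩ := hcon
  exact hD ⟨c1, c2, c3, c4, c5⟩

/-- All estimates concentrate simultaneously. -/
lemma MDP.dataLaw_not_good_le [Nonempty A] (M : MDP S A H) (μ : Policy S A) (δ K : ℝ) {l : ℝ}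
    (hl : 0 < l) :
    M.dataLaw μ n {D | ¬ ∀ h s a, M.GoodAt μ δ K l D h s a}
      ≤ ENNReal.ofReal (10 * (H * Fintype.card S * Fintype.card A) * Real.exp (-l)) := by
  have hsub : {D : Dataset S A H n | ¬ ∀ h s a, M.GoodAt μ δ K l D h s a}
      ⊆ ⋃ x : Fin H × S × A, {D | ¬ M.GoodAt μ δ K l D x.1 x.2.1 x.2.2} := by
    intro D hD
    simp only [Set.mem_ofPred_eq, not_forall, Set.mem_iUnion] at hD ⊢
    obtain ⟨h, s, a, hx⟩ := hD
    exact ⟨(h, s, a), hx⟩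
  refine (measure_mono hsub).trans ((measure_iUnion_fintype_le _ _).trans
    ((Finset.sum_le_sum fun x _ => M.dataLaw_not_goodAt_le μ δ K hl x.1 x.2.1 x.2.2).trans_eq ?_))
  have h5 : (5 : ENNReal) = ENNReal.ofReal 5 := by simp
  rw [Finset.sum_const, Finset.card_univ, Fintype.card_prod, Fintype.card_prod, Fintype.card_fin,
    nsmul_eq_mul, h5, ← ENNReal.ofReal_mul (by norm_num), ← ENNReal.ofReal_natCast,
    ← ENNReal.ofReal_mul (by positivity)]
  congr 1
  push_cast
  ring

end events

/-! ### One-step errors on the good event. -/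

section consequences

variable {S A : Type*} [Fintype S] [Fintype A] [DecidableEq S] [DecidableEq A] {H n : ℕ}
variable [MeasurableSpace S] [MeasurableSpace A] [MeasurableSingletonClass S]
  [MeasurableSingletonClass A]

/-- This turns deviations into relative errors: for an expected count $X\ge m=n d_m$ one has
$\sqrt{l/X}\le u$, so the same $u$ serves all covered locations. -/
lemma sqrt_mul_le_of_le {l m X u : ℝ} (hl : 0 < l) (hm : 0 < m) (hX : m ≤ X) (hu : u = √(l / m)) :
    √(l * X) ≤ X * u := by
  have hX0 : 0 < X := hm.trans_le hX
  have hu0 : 0 ≤ u := hu ▸ Real.sqrt_nonneg _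
  refine Real.sqrt_le_iff.mpr ⟨by positivity, ?_⟩
  rw [mul_pow, hu, Real.sq_sqrt (by positivity)]
  have : X ^ 2 * (l / m) = l * X * (X / m) := by field_simp
  rw [this]
  have h1 : 1 ≤ X / m := (one_le_div hm).mpr hX
  exact le_mul_of_one_le_right (by positivity) h1

lemma le_mul_sq_of_le {l m X u : ℝ} (hl : 0 < l) (hm : 0 < m) (hX : m ≤ X) (hu : u = √(l / m)) :
    l ≤ X * u ^ 2 := by
  rw [hu, Real.sq_sqrt (by positivity), mul_div_assoc', le_div_iff₀ hm, mul_comm]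
  exact mul_le_mul_of_nonneg_right hX hl.le

/-- Relative concentration of the number of visits, of the states, and of the rewards. -/
lemma two_sqrt_add_le {l m X u : ℝ} (hl : 0 < l) (hm : 0 < m) (hX : m ≤ X) (hu : u = √(l / m))
    (hu1 : u ≤ 1 / 8) : 2 * √(l * X) + 2 * l ≤ 3 * u * X := by
  have h1 := sqrt_mul_le_of_le hl hm hX hu
  have h2 := le_mul_sq_of_le hl hm hX hu
  have hu0 : 0 ≤ u := hu ▸ Real.sqrt_nonneg _
  have hX0 : 0 < X := hm.trans_le hX
  have h3 : u ^ 2 ≤ u * (1 / 8) := by rw [sq]; gcongr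
  have h4 : X * u ^ 2 ≤ X * (u * (1 / 8)) := by gcongr
  nlinarith [mul_nonneg hX0.le hu0]

lemma MDP.dm_le_stateOcc [Nonempty A] (M : MDP S A H) (μ : Policy S A) {h : ℕ} (hh : h < H) {s : S}
    (hs : M.Reachable h s) : M.dm μ ≤ M.stateOcc μ h s :=
  (M.dm_le μ hh hs (Classical.arbitrary A)).trans (mul_le_of_le_one_right (M.stateOcc_nonneg _ _ _)
    (stdSimplex.le_one _ _))

variable {M : MDP S A H} {μ : Policy S A} {δ K l u : ℝ} {D : Dataset S A H n} [Nonempty A]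

/-- Sums against the backward probabilities are close to the forward expectations. -/
lemma MDP.abs_sum_backward_sub_le (hl : 0 < l) (hm : 0 < n * M.dm μ) (hu : u = √(l / (n * M.dm μ)))
    (hu1 : u ≤ 1 / 8) (hD : ∀ h s a, M.GoodAt μ δ K l D h s a) (h : Fin H) (s : S) (a : A)
    (f : S → ℝ) (hf : (h : ℕ) + 1 = H → f = 0) :
    |∑ τ, M.backward μ h s a ((D τ).1 h.succ) * f ((D τ).1 h.succ)
        - n * M.occ μ h s a * wmean (M.P h s a) f|
      ≤ 3 * u * (n * M.occ μ h s a) * wmean (M.P h s a) (fun z => |f z|) := by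
  have hu0 : 0 ≤ u := hu ▸ Real.sqrt_nonneg _
  -- Coverage says nothing about the terminal state $s_H$, but there the value estimate is
  -- identically zero.
  by_cases hH : (h : ℕ) + 1 = H
  · rw [hf hH]; simp [wmean]
  have hh : (h : ℕ) + 1 < H := by have := h.2; omega
  have hN : ∀ z, |(∑ τ, if (D τ).1 h.succ = z then (1 : ℝ) else 0) * M.backward μ h s a z
      - n * M.occ μ h s a * M.P h s a z| ≤ 3 * u * (n * M.occ μ h s a) * M.P h s a z := by
    intro z
    set N := ∑ τ, if (D τ).1 h.succ = z then (1 : ℝ) else 0 with hNdef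
    -- By Bayes' rule the expectation $n\,d(s,a)P(z)$ carries the same backward factor as the
    -- observed count of `z`. The relative error of the state count at step $h+1$ is therefore
    -- inherited.
    have e1 : N * M.backward μ h s a z - n * M.occ μ h s a * M.P h s a z
        = (N - n * M.stateOcc μ (h + 1) z) * M.backward μ h s a z := by
      rw [sub_mul, mul_assoc (n : ℝ), mul_assoc (n : ℝ), M.stateOcc_mul_backward]
    have e2 : 3 * u * (n * M.occ μ h s a) * M.P h s a z
        = 3 * u * (n * M.stateOcc μ (h + 1) z) * M.backward μ h s a z := by
      have := M.stateOcc_mul_backward μ h s a z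
      linear_combination (-(3 * u * n)) * this
    rw [e1, e2, abs_mul, abs_of_nonneg (M.backward_nonneg μ h s a z)]
    rcases (M.stateOcc_nonneg μ (h + 1) z).eq_or_lt with h0 | h0
    · simp [MDP.backward, ← h0]
    · refine mul_le_mul_of_nonneg_right ?_ (M.backward_nonneg μ h s a z)
      have hq : n * M.dm μ ≤ n * M.stateOcc μ (h + 1) z :=
        mul_le_mul_of_nonneg_left (M.dm_le_stateOcc μ hh ⟨μ, h0⟩) (Nat.cast_nonneg _)
      refine le_trans ?_ (two_sqrt_add_le hl hm hq hu hu1)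
      have := (hD ⟨h + 1, hh⟩ z a).states
      simp only [Finset.sum_sub_distrib, Finset.sum_const, Finset.card_univ, Fintype.card_fin,
        nsmul_eq_mul] at this
      exact this
  have e3 : ∑ τ, M.backward μ h s a ((D τ).1 h.succ) * f ((D τ).1 h.succ)
      = ∑ z, (∑ τ, if (D τ).1 h.succ = z then (1 : ℝ) else 0) * M.backward μ h s a z * f z := by
    simp only [Finset.sum_mul]
    rw [Finset.sum_comm]
    refine Finset.sum_congr rfl fun τ _ => ?_
    simp only [ite_mul, one_mul, zero_mul, Finset.sum_ite_eq, Finset.mem_univ, if_true]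
  rw [e3, wmean, Finset.mul_sum, ← Finset.sum_sub_distrib, wmean, Finset.mul_sum]
  refine (Finset.abs_sum_le_sum_abs _ _).trans (Finset.sum_le_sum fun z _ => ?_)
  have e4 : (∑ τ, if (D τ).1 h.succ = z then (1 : ℝ) else 0) * M.backward μ h s a z * f z
      - n * M.occ μ h s a * (M.P h s a z * f z)
      = ((∑ τ, if (D τ).1 h.succ = z then (1 : ℝ) else 0) * M.backward μ h s a z
      - n * M.occ μ h s a * M.P h s a z) * f z := by ring
  rw [e4, abs_mul, ← mul_assoc]
  exact mul_le_mul_of_nonneg_right (hN z) (abs_nonneg _)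

lemma sum_visit_mul (D : Dataset S A H n) (h : Fin H) (s : S) (a : A) (hc : count D h s a ≠ 0)
    (f : S → ℝ) :
    ∑ τ, visit h s a (D τ) * f ((D τ).1 h.succ) = count D h s a * wmean (Phat D h s a) f := by
  have hc' : (count D h s a : ℝ) ≠ 0 := by exact_mod_cast hc
  simp only [wmean, Phat, if_neg hc, Finset.mul_sum]
  have e1 : ∀ z, (count D h s a : ℝ) * (((Finset.univ.filter fun τ => (D τ).1 h.castSucc = s ∧
      (D τ).2.1 h = a ∧ (D τ).1 h.succ = z).card : ℝ) / count D h s a * f z)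
      = ∑ τ, (if (D τ).1 h.castSucc = s ∧ (D τ).2.1 h = a ∧ (D τ).1 h.succ = z then 1 else 0)
        * f z := by
    intro z
    rw [← Finset.sum_mul, Finset.sum_boole]
    field_simp
  simp only [e1]
  rw [Finset.sum_comm]
  refine Finset.sum_congr rfl fun τ _ => ?_
  rw [Finset.sum_eq_single ((D τ).1 h.succ)]
  · simp [visit]
  · intro z _ hz
    rw [if_neg (fun hc => hz hc.2.2.symm), zero_mul]
  · simp

lemma sum_Phat (D : Dataset S A H n) (h : Fin H) (s : S) (a : A) (hc : count D h s a ≠ 0) :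
    ∑ z, Phat D h s a z = 1 := by
  have h1 := sum_visit_mul D h s a hc (fun _ => 1)
  have hc' : (count D h s a : ℝ) ≠ 0 := by exact_mod_cast hc
  simp only [mul_one, wmean, ← count_eq_sum] at h1
  exact mul_left_cancel₀ hc' (by rw [← h1, mul_one])

lemma rhat_sub (D : Dataset S A H n) (h : Fin H) (s : S) (a : A) (hc : count D h s a ≠ 0) (c : ℝ) :
    rhat D h s a - c = (∑ τ, visit h s a (D τ) * ((D τ).2.2 h - c)) / count D h s a := by
  have hc' : (count D h s a : ℝ) ≠ 0 := by exact_mod_cast hc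
  have e : ∀ τ, visit h s a (D τ) * ((D τ).2.2 h - c)
      = (if (D τ).1 h.castSucc = s ∧ (D τ).2.1 h = a then (D τ).2.2 h else 0)
        - visit h s a (D τ) * c := by
    intro τ
    simp only [visit]; split_ifs <;> ring
  simp only [e, Finset.sum_sub_distrib, ← Finset.sum_mul, ← count_eq_sum, rhat, if_neg hc]
  field_simp

/-- On the good event every location that can be visited has many visits. -/
lemma MDP.half_le_count (hl : 0 < l) (hm : 0 < n * M.dm μ) (hu : u = √(l / (n * M.dm μ)))
    (hu1 : u ≤ 1 / 8) (h : Fin H) (s : S) (a : A) (hD : M.GoodAt μ δ K l D h s a)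
    (hs : M.Reachable h s) : n * M.occ μ h s a / 2 ≤ count D h s a := by
  have hX : n * M.dm μ ≤ n * M.occ μ h s a :=
    mul_le_mul_of_nonneg_left (M.dm_le μ h.2 hs a) (Nat.cast_nonneg _)
  have h1 := hD.visits
  have h2 := two_sqrt_add_le hl hm hX hu hu1
  simp only [Finset.sum_sub_distrib, ← count_eq_sum, Finset.sum_const, Finset.card_univ,
    Fintype.card_fin, nsmul_eq_mul] at h1
  have h3 := (abs_le.mp (h1.trans h2)).1
  have hX0 : 0 < n * M.occ μ h s a := hm.trans_le hX
  nlinarith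

/-- On the good event the empirical transitions satisfy a Bernstein bound for the value estimate. -/
lemma MDP.abs_wmean_Phat_sub_le (hl : 0 < l) (hm : 0 < n * M.dm μ) (hu : u = √(l / (n * M.dm μ)))
    (hu1 : u ≤ 1 / 8)
    (hD : ∀ h s a, M.GoodAt μ δ K l D h s a) (h : Fin H) (s : S) (a : A) (hs : M.Reachable h s) :
    |wmean (Phat D h s a) (Vopt δ K D (h + 1)) - wmean (M.P h s a) (Vopt δ K D (h + 1))|
      ≤ 12 * u * √(wvar (M.P h s a) (Vopt δ K D (h + 1))) + 4 * H * u ^ 2 := by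
  have hu0 : 0 ≤ u := hu ▸ Real.sqrt_nonneg _
  set W := Vopt δ K D (h + 1) with hW
  set v := wvar (M.P h s a) W with hv
  set σ := √v with hσ
  have hv0 : 0 ≤ v := wvar_nonneg (stdSimplex.zero_le _) _
  have hσ0 : 0 ≤ σ := Real.sqrt_nonneg _
  have hσ2 : σ ^ 2 = v := Real.sq_sqrt hv0
  set X : ℝ := n * M.occ μ h s a with hXdef
  have hX : n * M.dm μ ≤ X :=
    mul_le_mul_of_nonneg_left (M.dm_le μ h.2 hs a) (Nat.cast_nonneg _)
  have hX0 : 0 < X := hm.trans_le hX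
  have hH0 : (0 : ℝ) ≤ H := Nat.cast_nonneg _
  have hG := hD h s a
  have hNX : X / 2 ≤ count D h s a := M.half_le_count hl hm hu hu1 h s a hG hs
  set N : ℝ := ((count D h s a : ℕ) : ℝ) with hN
  have hN0 : 0 < N := by linarith
  have hc : count D h s a ≠ 0 := fun hc => by
    rw [hN, hc, Nat.cast_zero] at hN0; exact lt_irrefl _ hN0
  have hsl := sqrt_mul_le_of_le hl hm hX hu
  have hlX := le_mul_sq_of_le hl hm hX hu
  set g : S → ℝ := M.centred δ K D h s a with hg
  have hgz : ∀ z, g z = W z - wmean (M.P h s a) W := fun z => rfl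
  have hg0 : (h : ℕ) + 1 = H → g = 0 := by
    intro hh
    have hW0 : W = fun _ => 0 := by
      funext z
      exact Vopt_of_le δ K D hh.ge z
    funext z
    rw [hgz, hW0]
    simp [wmean]
  have hPg : wmean (M.P h s a) g = 0 := by
    have : wmean (M.P h s a) g = wmean (M.P h s a) (fun z => W z - wmean (M.P h s a) W) := rfl
    rw [this, wmean_sub, wmean_const (stdSimplex.sum_eq_one _), sub_self]
  have hPg2 : wmean (M.P h s a) (fun z => g z ^ 2) = v := rfl
  have hPga : wmean (M.P h s a) (fun z => |g z|) ≤ σ :=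
    wmean_abs_le_sqrt (stdSimplex.zero_le _) (stdSimplex.sum_eq_one _) g
  set T := ∑ τ, M.backward μ h s a ((D τ).1 h.succ) * g ((D τ).1 h.succ) ^ 2 with hT
  have hT0 : 0 ≤ T := Finset.sum_nonneg fun τ _ =>
    mul_nonneg (M.backward_nonneg _ _ _ _ _) (sq_nonneg _)
  have hTX : T ≤ 2 * X * v := by
    have h1 := M.abs_sum_backward_sub_le hl hm hu hu1 hD h s a (fun z => g z ^ 2)
      (fun hh => by rw [hg0 hh]; funext; simp)
    simp only [abs_pow, sq_abs] at h1
    rw [hPg2] at h1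
    have h2 := (abs_le.mp h1).2
    have h3 : 3 * u * X * v ≤ X * v := by
      have : 3 * u * (X * v) ≤ 1 * (X * v) := by gcongr; linarith
      linarith
    linarith
  -- As `g` is centred under the true transition, the main term vanishes and only the relative error
  -- times $P|g|\le\sigma$ remains.
  have h1 := M.abs_sum_backward_sub_le hl hm hu hu1 hD h s a g hg0
  rw [hPg, mul_zero, sub_zero] at h1
  have h2 := hG.values
  have h3 : ∑ τ, (visit h s a (D τ) - M.backward μ h s a ((D τ).1 h.succ)) *
      g ((D τ).1 h.succ) = N * (wmean (Phat D h s a) W - wmean (M.P h s a) W)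
      - ∑ τ, M.backward μ h s a ((D τ).1 h.succ) * g ((D τ).1 h.succ) := by
    simp only [sub_mul, Finset.sum_sub_distrib]
    rw [sum_visit_mul D h s a hc g]
    have : wmean (Phat D h s a) g
        = wmean (Phat D h s a) (fun z => W z - wmean (M.P h s a) W) := rfl
    rw [this, wmean_sub, wmean_const (sum_Phat D h s a hc)]
  rw [← hg, h3] at h2
  have h4 : √(l * T) ≤ 3 / 2 * (X * u) * σ := by
    have e1 : √(l * T) ≤ √(l * X * (2 * v)) := Real.sqrt_le_sqrt (by nlinarith)
    have e2 : √(2 * v) ≤ 3 / 2 * σ := by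
      refine Real.sqrt_le_iff.mpr ⟨by positivity, ?_⟩
      rw [mul_pow, hσ2]; linarith
    rw [Real.sqrt_mul (by positivity) (2 * v)] at e1
    calc √(l * T) ≤ √(l * X) * √(2 * v) := e1
      _ ≤ (X * u) * (3 / 2 * σ) := by gcongr
      _ = _ := by ring
  have h5 : 3 * u * X * wmean (M.P h s a) (fun z => |g z|) ≤ 3 * u * X * σ := by gcongr
  have h6 : |N * (wmean (Phat D h s a) W - wmean (M.P h s a) W)|
      ≤ 6 * u * X * σ + 2 * H * (X * u ^ 2) := by
    have h7 := abs_sub_abs_le_abs_sub (N * (wmean (Phat D h s a) W - wmean (M.P h s a) W))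
      (∑ τ, M.backward μ h s a ((D τ).1 h.succ) * g ((D τ).1 h.succ))
    have h8 : 2 * (H : ℝ) * l ≤ 2 * H * (X * u ^ 2) := by gcongr
    linarith
  rw [abs_mul, abs_of_pos hN0] at h6
  have h9 : X / 2 * |wmean (Phat D h s a) W - wmean (M.P h s a) W|
      ≤ X / 2 * (12 * u * σ + 4 * H * u ^ 2) := by
    refine (mul_le_mul_of_nonneg_right hNX (abs_nonneg _)).trans (h6.trans_eq ?_)
    ring
  exact le_of_mul_le_mul_left h9 (by positivity)

/-- On the good event the empirical variances are controlled by the true ones. -/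
lemma MDP.wvar_Phat_le (hl : 0 < l) (hm : 0 < n * M.dm μ) (hu : u = √(l / (n * M.dm μ)))
    (hu1 : u ≤ 1 / 8)
    (hD : ∀ h s a, M.GoodAt μ δ K l D h s a) (h : Fin H) (s : S) (a : A) (hs : M.Reachable h s) :
    wvar (Phat D h s a) (fun z => rhat D h s a + Vopt δ K D (h + 1) z)
      ≤ 8 * wvar (M.P h s a) (Vopt δ K D (h + 1)) + 6 * H ^ 2 * u ^ 2 := by
  have hu0 : 0 ≤ u := hu ▸ Real.sqrt_nonneg _
  set W := Vopt δ K D (h + 1) with hW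
  set v := wvar (M.P h s a) W with hv
  set σ := √v with hσ
  have hv0 : 0 ≤ v := wvar_nonneg (stdSimplex.zero_le _) _
  have hσ0 : 0 ≤ σ := Real.sqrt_nonneg _
  have hσ2 : σ ^ 2 = v := Real.sq_sqrt hv0
  set X : ℝ := n * M.occ μ h s a with hXdef
  have hX : n * M.dm μ ≤ X :=
    mul_le_mul_of_nonneg_left (M.dm_le μ h.2 hs a) (Nat.cast_nonneg _)
  have hX0 : 0 < X := hm.trans_le hX
  have hH0 : (0 : ℝ) ≤ H := Nat.cast_nonneg _
  have hG := hD h s a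
  have hNX : X / 2 ≤ count D h s a := M.half_le_count hl hm hu hu1 h s a hG hs
  set N : ℝ := ((count D h s a : ℕ) : ℝ) with hN
  have hN0 : 0 < N := by linarith
  have hc : count D h s a ≠ 0 := fun hc => by
    rw [hN, hc, Nat.cast_zero] at hN0; exact lt_irrefl _ hN0
  have hsl := sqrt_mul_le_of_le hl hm hX hu
  have hlX := le_mul_sq_of_le hl hm hX hu
  set g : S → ℝ := M.centred δ K D h s a with hg
  have hgz : ∀ z, g z = W z - wmean (M.P h s a) W := fun z => rfl
  have hg0 : (h : ℕ) + 1 = H → g = 0 := by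
    intro hh
    have hW0 : W = fun _ => 0 := by
      funext z
      exact Vopt_of_le δ K D hh.ge z
    funext z
    rw [hgz, hW0]
    simp [wmean]
  have hPg : wmean (M.P h s a) g = 0 := by
    have : wmean (M.P h s a) g = wmean (M.P h s a) (fun z => W z - wmean (M.P h s a) W) := rfl
    rw [this, wmean_sub, wmean_const (stdSimplex.sum_eq_one _), sub_self]
  have hPg2 : wmean (M.P h s a) (fun z => g z ^ 2) = v := rfl
  have hPga : wmean (M.P h s a) (fun z => |g z|) ≤ σ :=
    wmean_abs_le_sqrt (stdSimplex.zero_le _) (stdSimplex.sum_eq_one _) g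
  set T := ∑ τ, M.backward μ h s a ((D τ).1 h.succ) * g ((D τ).1 h.succ) ^ 2 with hT
  have hT0 : 0 ≤ T := Finset.sum_nonneg fun τ _ =>
    mul_nonneg (M.backward_nonneg _ _ _ _ _) (sq_nonneg _)
  have hTX : T ≤ 2 * X * v := by
    have h1 := M.abs_sum_backward_sub_le hl hm hu hu1 hD h s a (fun z => g z ^ 2)
      (fun hh => by rw [hg0 hh]; funext; simp)
    simp only [abs_pow, sq_abs] at h1
    rw [hPg2] at h1
    have h2 := (abs_le.mp h1).2
    have h3 : 3 * u * X * v ≤ X * v := by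
      have : 3 * u * (X * v) ≤ 1 * (X * v) := by gcongr; linarith
      linarith
    linarith
  have h1 := hG.variances
  have h3 : ∑ τ, (visit h s a (D τ) - M.backward μ h s a ((D τ).1 h.succ)) *
      g ((D τ).1 h.succ) ^ 2 = N * wmean (Phat D h s a) (fun z => g z ^ 2) - T := by
    simp only [sub_mul, Finset.sum_sub_distrib]
    rw [sum_visit_mul D h s a hc (fun z => g z ^ 2)]
  rw [← hg, h3] at h1
  have h2 : ∑ τ, M.backward μ h s a ((D τ).1 h.succ) * (g ((D τ).1 h.succ) ^ 2) ^ 2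
      ≤ H ^ 2 * T := by
    rw [hT, Finset.mul_sum]
    refine Finset.sum_le_sum fun τ _ => ?_
    have e1 : g ((D τ).1 h.succ) ^ 2 ≤ (H : ℝ) ^ 2 := by
      rw [← sq_abs]
      exact pow_le_pow_left₀ (abs_nonneg _) (M.abs_centred_le δ K D h s a _) 2
    have e2 := M.backward_nonneg μ h s a ((D τ).1 h.succ)
    have e3 := mul_le_mul_of_nonneg_right e1 (sq_nonneg (g ((D τ).1 h.succ)))
    nlinarith
  -- From $g^4\le H^2g^2$ and the arithmetic–geometric mean inequality $2\sqrt{T\cdot H^2l}\le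
  -- T+H^2l$.
  have h4 : 2 * √(l * ∑ τ, M.backward μ h s a ((D τ).1 h.succ) *
      (g ((D τ).1 h.succ) ^ 2) ^ 2) ≤ T + H ^ 2 * l := by
    have e1 : √(l * ∑ τ, M.backward μ h s a ((D τ).1 h.succ) * (g ((D τ).1 h.succ) ^ 2) ^ 2)
        ≤ (T + H ^ 2 * l) / 2 := by
      refine Real.sqrt_le_iff.mpr ⟨by positivity, ?_⟩
      have := mul_le_mul_of_nonneg_left h2 hl.le
      nlinarith [sq_nonneg (T - H ^ 2 * l)]
    linarith
  have h5 := (abs_le.mp h1).2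
  have h6 : N * wmean (Phat D h s a) (fun z => g z ^ 2)
      ≤ 4 * X * v + 3 * H ^ 2 * (X * u ^ 2) := by
    have h8 : 3 * (H : ℝ) ^ 2 * l ≤ 3 * H ^ 2 * (X * u ^ 2) := by gcongr
    linarith
  have hP0 : ∀ z, 0 ≤ Phat D h s a z := fun z => by
    rw [Phat]; split_ifs <;> positivity
  have h7 : 0 ≤ wmean (Phat D h s a) (fun z => g z ^ 2) := wmean_nonneg hP0 fun _ => sq_nonneg _
  have h9 : X / 2 * wmean (Phat D h s a) (fun z => g z ^ 2)
      ≤ X / 2 * (8 * v + 6 * H ^ 2 * u ^ 2) := by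
    refine (mul_le_mul_of_nonneg_right hNX h7).trans (h6.trans_eq ?_)
    ring
  have h10 := le_of_mul_le_mul_left h9 (by positivity)
  rw [wvar_add_const (sum_Phat D h s a hc)]
  have h11 := wmean_sub_sq (sum_Phat D h s a hc) W (wmean (M.P h s a) W)
  have h12 : wmean (Phat D h s a) (fun z => g z ^ 2)
      = wmean (Phat D h s a) (fun z => (W z - wmean (M.P h s a) W) ^ 2) := rfl
  linarith [sq_nonneg (wmean (Phat D h s a) W - wmean (M.P h s a) W)]

/-- On the good event the one-step error is of Bernstein type. -/
lemma MDP.abs_Qbar_sub_le (hl : 0 < l) (hm : 0 < n * M.dm μ) (hu : u = √(l / (n * M.dm μ)))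
    (hu1 : u ≤ 1 / 8) (hι0 : 0 ≤ iota S A H δ) (hι : iota S A H δ ≤ l)
    (hD : ∀ h s a, M.GoodAt μ δ K l D h s a) (h : Fin H) (s : S) (a : A) (hs : M.Reachable h s) :
    |Qbar δ K D h (Vopt δ K D (h + 1)) s a
        - (M.r h s a + wmean (M.P h s a) (Vopt δ K D (h + 1)))|
      ≤ 20 * u * √(wvar (M.P h s a) (Vopt δ K D (h + 1))) + (8 * u + 40 * H * u ^ 2) := by
  have hu0 : 0 ≤ u := hu ▸ Real.sqrt_nonneg _
  set W := Vopt δ K D (h + 1) with hW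
  set v := wvar (M.P h s a) W with hv
  set σ := √v with hσ
  have hv0 : 0 ≤ v := wvar_nonneg (stdSimplex.zero_le _) _
  have hσ0 : 0 ≤ σ := Real.sqrt_nonneg _
  have hσ2 : σ ^ 2 = v := Real.sq_sqrt hv0
  set X : ℝ := n * M.occ μ h s a with hXdef
  have hX : n * M.dm μ ≤ X :=
    mul_le_mul_of_nonneg_left (M.dm_le μ h.2 hs a) (Nat.cast_nonneg _)
  have hX0 : 0 < X := hm.trans_le hX
  have hH0 : (0 : ℝ) ≤ H := Nat.cast_nonneg _
  have hG := hD h s a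
  have hNX : X / 2 ≤ count D h s a := M.half_le_count hl hm hu hu1 h s a hG hs
  set N : ℝ := ((count D h s a : ℕ) : ℝ) with hN
  have hN0 : 0 < N := by linarith
  have hc : count D h s a ≠ 0 := fun hc => by
    rw [hN, hc, Nat.cast_zero] at hN0; exact lt_irrefl _ hN0
  have hsl := sqrt_mul_le_of_le hl hm hX hu
  have hlX := le_mul_sq_of_le hl hm hX hu
  have hval := M.abs_wmean_Phat_sub_le hl hm hu hu1 hD h s a hs
  have hvar := M.wvar_Phat_le hl hm hu hu1 hD h s a hs
  rw [← hW, ← hv] at hvar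
  rw [← hW, ← hv, ← hσ] at hval
  have hιN : iota S A H δ / N ≤ 2 * u ^ 2 := by
    rw [div_le_iff₀ hN0]
    have := mul_le_mul_of_nonneg_left hNX (by positivity : 0 ≤ 2 * u ^ 2)
    nlinarith
  have hιN0 : 0 ≤ iota S A H δ / N := by positivity
  have hpen0 : 0 ≤ penalty δ K D h W s a := by
    rw [penalty, if_neg hc]; positivity
  -- Visited locations only: the good event makes `count` positive at every reachable location, so
  -- the value of `K` is immaterial. The empirical variance is replaced by the true one through
  -- `hvar`.
  have hpen : penalty δ K D h W s a ≤ 8 * u * σ + 36 * H * u ^ 2 := by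
    rw [penalty, if_neg hc]
    have h1 : √(wvar (Phat D h s a) (fun z => rhat D h s a + W z) * iota S A H δ / N)
        ≤ 4 * u * σ + 4 * H * u ^ 2 := by
      refine Real.sqrt_le_iff.mpr ⟨by positivity, ?_⟩
      rw [mul_div_assoc]
      refine (mul_le_mul hvar hιN hιN0 (by positivity)).trans ?_
      have h2 : 0 ≤ u * σ * (H * u ^ 2) := by positivity
      have h3 : 0 ≤ (H : ℝ) ^ 2 * u ^ 4 := by positivity
      nlinarith
    have h2 : 14 * H * iota S A H δ / N ≤ 28 * H * u ^ 2 := by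
      rw [mul_div_assoc]
      have := mul_le_mul_of_nonneg_left hιN (by positivity : 0 ≤ 14 * (H : ℝ))
      linarith
    linarith
  have hrew : |rhat D h s a - M.r h s a| ≤ 8 * u := by
    rw [rhat_sub D h s a hc, abs_div, abs_of_pos hN0, div_le_iff₀ hN0]
    have h1 := hG.rewards
    simp only [Finset.sum_const, Finset.card_univ, Fintype.card_fin, nsmul_eq_mul] at h1
    refine h1.trans ((two_sqrt_add_le hl hm hX hu hu1).trans ?_)
    have := mul_le_mul_of_nonneg_left hNX (by positivity : 0 ≤ 8 * u)
    nlinarith [mul_nonneg hu0 hX0.le]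
  -- The exact backup lies in the truncation interval $[0,H-h]$, so truncation can only bring the
  -- estimate closer to it.
  have hmem0 : 0 ≤ M.r h s a + wmean (M.P h s a) W :=
    add_nonneg (M.r_nonneg _ _ _) (wmean_nonneg (stdSimplex.zero_le _) (Vopt_nonneg δ K D _))
  have hmem1 : M.r h s a + wmean (M.P h s a) W ≤ (H : ℝ) - (h : ℕ) := by
    have h1 := wmean_le_of_le (stdSimplex.zero_le (M.P h s a)) (stdSimplex.sum_eq_one _)
      (Vopt_le_sub δ K D (h + 1))
    rw [Nat.cast_sub h.2] at h1
    push_cast at h1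
    have := M.r_le_one h s a
    linarith
  have hx := abs_le.mp hval
  have hr := abs_le.mp hrew
  rw [abs_le, Qbar]
  constructor
  · have : M.r h s a + wmean (M.P h s a) W - (20 * u * σ + (8 * u + 40 * H * u ^ 2))
        ≤ min (rhat D h s a + wmean (Phat D h s a) W - penalty δ K D h W s a)
          ((H : ℝ) - (h : ℕ)) := by
      refine le_min (by linarith) ?_
      have : 0 ≤ 20 * u * σ + (8 * u + 40 * H * u ^ 2) := by positivity
      linarith
    have := this.trans (le_max_left _ 0)
    linarith
  · have : max (min (rhat D h s a + wmean (Phat D h s a) W - penalty δ K D h W s a)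
          ((H : ℝ) - (h : ℕ))) 0
        ≤ M.r h s a + wmean (M.P h s a) W + (20 * u * σ + (8 * u + 40 * H * u ^ 2)) := by
      refine max_le ((min_le_left _ _).trans ?_) (by positivity)
      have : 0 ≤ H * u ^ 2 := by positivity
      have : 0 ≤ u * σ := by positivity
      linarith
    linarith

end consequences

/-! ### Sample complexity of APVI. -/

section upper

variable {S A : Type*} [Fintype S] [Fintype A] [DecidableEq S] [DecidableEq A] {H n : ℕ}
variable [MeasurableSpace S] [MeasurableSpace A] [MeasurableSingletonClass S]
  [MeasurableSingletonClass A]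

/-- On the good event every output of APVI is near optimal. -/
lemma MDP.vstar_sub_v_le_of_good [Nonempty A] {M : MDP S A H} {μ : Policy S A} {δ K l u : ℝ}
    {D : Dataset S A H n} {π : Policy S A} (hH : 0 < H) (hl : 0 < l) (hd : 0 < M.dm μ)
    (hm : 0 < n * M.dm μ) (hu : u = √(l / (n * M.dm μ))) (hu1 : u * H ≤ 1 / 100)
    (hι0 : 0 ≤ iota S A H δ) (hι : iota S A H δ ≤ l)
    (hD : ∀ h s a, M.GoodAt μ δ K l D h s a) (hπ : IsAPVIOutput δ K D π) :
    M.vstar - M.v π ≤ 136 * (u * √((H : ℝ) ^ 3)) + 648 * (u * √((H : ℝ) ^ 3)) ^ 2 := by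
  have hH1 : (1 : ℝ) ≤ H := by exact_mod_cast hH
  have hu0 : 0 ≤ u := hu ▸ Real.sqrt_nonneg _
  have hu2 : u ≤ 1 / 100 := (le_mul_of_one_le_right hu0 hH1).trans hu1
  have hu8 : u ≤ 1 / 8 := by linarith
  have hHu : H * u ^ 2 ≤ 1 / 10000 := by
    calc H * u ^ 2 = (u * H) * u := by ring
      _ ≤ (1 / 100) * (1 / 100) := by gcongr
      _ = _ := by norm_num
  have hV := fun h => hπ.Vhat_eq _ h rfl
  have key := M.vstar_sub_v_le π μ (Vopt δ K D)
    (fun h s a => if hh : h < H then Qbar δ K D ⟨h, hh⟩ (Vopt δ K D (h + 1)) s a else 0)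
    (α := 20 * u) (β := 8 * u + 40 * H * u ^ 2) hH hd (by positivity) (by positivity)
    (by nlinarith) (Vopt_nonneg δ K D) (Vopt_le δ K D) (Vopt_of_le δ K D le_rfl)
    (fun h s hh => by
      have := hπ.wmean_eq ⟨h, hh⟩ s
      simp only [hV] at this
      simp only [hh, dif_pos]
      rw [Vopt_of_lt δ K D ⟨h, hh⟩]
      exact this.symm)
    (fun h s a hh => by
      simp only [hh, dif_pos]
      rw [Vopt_of_lt δ K D ⟨h, hh⟩]
      exact le_ciSup (Set.finite_range (Qbar δ K D ⟨h, hh⟩ (Vopt δ K D (h + 1)) s)).bddAbove a)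
    (fun h s a hh hs => by
      simp only [hh, dif_pos]
      exact M.abs_Qbar_sub_le hl hm hu hu8 hι0 hι hD ⟨h, hh⟩ s a hs)
  refine key.trans ?_
  have h3 : √((H : ℝ) ^ 3) ^ 2 = H ^ 3 := Real.sq_sqrt (by positivity)
  have h4 : (H : ℝ) ≤ √((H : ℝ) ^ 3) := by
    exact Real.le_sqrt_of_sq_le (pow_le_pow_right₀ hH1 (by norm_num))
  rw [mul_pow, h3]
  have h5 : u * H ≤ u * √((H : ℝ) ^ 3) := by gcongr
  have h6 : u ^ 2 * (H : ℝ) ^ 2 ≤ u ^ 2 * H ^ 3 := by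
    have : (H : ℝ) ^ 2 ≤ (H : ℝ) ^ 3 := pow_le_pow_right₀ hH1 (by norm_num)
    gcongr
  have h7 : u ^ 3 * (H : ℝ) ^ 3 ≤ 1 / 100 * (u ^ 2 * H ^ 3) := by
    calc u ^ 3 * (H : ℝ) ^ 3 = u * (u ^ 2 * H ^ 3) := by ring
      _ ≤ _ := by gcongr
  linarith

lemma MDP.dm_le_one [Nonempty A] (M : MDP S A H) (μ : Policy S A) (hH : 0 < H) :
    M.dm μ ≤ 1 := by
  obtain ⟨s, hs⟩ := exists_pos_of_stdSimplex M.init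
  refine (M.dm_le_stateOcc μ hH ⟨μ, hs⟩).trans ?_
  rw [← M.sum_stateOcc μ 0]
  exact Finset.single_le_sum (fun s _ => M.stateOcc_nonneg μ 0 s) (Finset.mem_univ s)

/-- The sample complexity of APVI under uniform coverage. -/
lemma MDP.dataLaw_not_near_optimal_le (M : MDP S A H) (μ : Policy S A) {δ ε : ℝ} (K : ℝ)
    (hH : 0 < H) (hd : 0 < M.dm μ) (hδ : 0 < δ) (hδ1 : δ < 1) (hε : 0 < ε)
    (hn : 4000000 * Real.log (3 * H * Fintype.card S * Fintype.card A / (δ * M.dm μ) *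
      (1 + 1 / ε)) ^ 1 * ((H : ℝ) ^ 3 / (M.dm μ * ε ^ 2) + (H : ℝ) ^ 3 / (M.dm μ * ε)) ≤ n) :
    M.dataLaw μ n {D | ¬ ∀ π : Policy S A, IsAPVIOutput δ K D π →
      0 ≤ M.vstar - M.v π ∧ M.vstar - M.v π ≤ ε} ≤ ENNReal.ofReal δ := by
  have := M.nonempty_action μ
  have : Nonempty S := ⟨(exists_pos_of_stdSimplex M.init).choose⟩
  have hH1 : (1 : ℝ) ≤ H := by exact_mod_cast hH
  -- For $\epsilon\ge H$ nothing is to be proved, as $v^\star\le H$. Otherwise $\epsilon<H$ is what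
  -- makes $uH$ small in `huH` below.
  rcases le_or_gt (H : ℝ) ε with hεH | hεH
  · have : {D : Dataset S A H n | ¬ ∀ π : Policy S A, IsAPVIOutput δ K D π →
      0 ≤ M.vstar - M.v π ∧ M.vstar - M.v π ≤ ε} = ∅ := by
      ext D
      simp only [Set.mem_ofPred_eq, Set.mem_empty_iff_false, iff_false, not_not]
      intro π _
      have h1 := M.v_le_vstar π
      have h2 := M.v_nonneg π
      have h3 := M.vstar_le
      constructor <;> linarith
    rw [this]; simp
  have hS : (1 : ℝ) ≤ Fintype.card S := by exact_mod_cast Fintype.card_pos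
  have hA : (1 : ℝ) ≤ Fintype.card A := by exact_mod_cast Fintype.card_pos
  set c : ℝ := (H : ℝ) * Fintype.card S * Fintype.card A with hc
  have hc1 : 1 ≤ c := by
    have : (1 : ℝ) ≤ H * Fintype.card S := one_le_mul_of_one_le_of_one_le hH1 hS
    exact one_le_mul_of_one_le_of_one_le this hA
  set X := 3 * H * Fintype.card S * Fintype.card A / (δ * M.dm μ) * (1 + 1 / ε) with hX
  have hd1 := M.dm_le_one μ hH
  have hYX : 3 * (c / δ) ≤ X := by
    have h1 : 3 * (c / δ) ≤ 3 * (c / (δ * M.dm μ)) := by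
      gcongr
      exact mul_le_of_le_one_right hδ.le hd1
    have h2 : 3 * (c / (δ * M.dm μ)) * 1 ≤ 3 * (c / (δ * M.dm μ)) * (1 + 1 / ε) := by
      have : 0 ≤ 1 / ε := by positivity
      gcongr
      linarith
    refine h1.trans ((mul_one _).symm.le.trans (h2.trans_eq ?_))
    rw [hX, hc]; ring
  have hcδ : 1 ≤ c / δ := by rw [one_le_div hδ]; linarith
  have hX0 : 0 < X := by linarith
  set L := Real.log X with hL
  have hL1 : 1 ≤ L := by
    rw [hL, Real.le_log_iff_exp_le hX0]
    have := Real.exp_one_lt_d9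
    linarith
  -- Then $e^{-l}=X^{-4}$, and $X\ge3HSA/\delta$ makes the union bound $10\,HSA\,e^{-l}$ at most
  -- $\delta$.
  set l := 4 * L with hl
  have hl0 : 0 < l := by linarith
  have hι0 : 0 ≤ iota S A H δ := Real.log_nonneg hcδ
  have hι : iota S A H δ ≤ l := by
    have : iota S A H δ ≤ L := Real.log_le_log (by linarith) (by linarith)
    linarith
  have hn' : 1000000 * l * (H : ℝ) ^ 3 * (1 + ε) ≤ n * M.dm μ * ε ^ 2 := by
    have h1 := mul_le_mul_of_nonneg_right hn (by positivity : 0 ≤ M.dm μ * ε ^ 2)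
    have h2 : 4000000 * L ^ 1 * ((H : ℝ) ^ 3 / (M.dm μ * ε ^ 2) + (H : ℝ) ^ 3 / (M.dm μ * ε))
        * (M.dm μ * ε ^ 2) = 1000000 * l * (H : ℝ) ^ 3 * (1 + ε) := by
      rw [hl]; field_simp; ring
    rw [h2] at h1
    linarith
  have hm : 0 < n * M.dm μ := by
    by_contra hcon
    have h1 : n * M.dm μ * ε ^ 2 ≤ 0 := mul_nonpos_of_nonpos_of_nonneg (not_lt.mp hcon) (by positivity)
    have h2 : 0 < 1000000 * l * (H : ℝ) ^ 3 * (1 + ε) := by positivity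
    linarith
  obtain ⟨u, hu⟩ : ∃ u, u = √(l / (n * M.dm μ)) := ⟨_, rfl⟩
  have hu0 : 0 ≤ u := hu ▸ Real.sqrt_nonneg _
  have hw2 : 1000000 * (u * √((H : ℝ) ^ 3)) ^ 2 * (1 + ε) ≤ ε ^ 2 := by
    rw [mul_pow, hu, Real.sq_sqrt (by positivity), Real.sq_sqrt (by positivity)]
    have : 1000000 * (l / (n * M.dm μ) * (H : ℝ) ^ 3) * (1 + ε)
        = 1000000 * l * (H : ℝ) ^ 3 * (1 + ε) / (n * M.dm μ) := by ring
    rw [this, div_le_iff₀ hm]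
    linarith
  set w := u * √((H : ℝ) ^ 3) with hw
  have hw0 : 0 ≤ w := by positivity
  have hw3 : 1000000 * w ^ 2 ≤ ε := by
    have : 1000000 * w ^ 2 * ε ≤ ε * ε := by nlinarith [sq_nonneg w]
    exact le_of_mul_le_mul_right this hε
  have hw4 : 1000 * w ≤ ε := by
    refine le_of_sq_le_sq ?_ hε.le
    nlinarith [mul_nonneg (sq_nonneg w) hε.le]
  -- Since $w^2=(uH)^2H$, the bound $10^6w^2\le\epsilon<H$ gives $10^6(uH)^2\le1$.
  have huH : u * H ≤ 1 / 100 := by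
    have h1 : w ^ 2 = (u * H) ^ 2 * H := by
      rw [hw, mul_pow, Real.sq_sqrt (by positivity)]; ring
    have h2 : 1000000 * (u * H) ^ 2 * H ≤ 1 * H := by rw [h1] at hw3; linarith
    have h3 := le_of_mul_le_mul_right h2 (by linarith)
    refine le_of_sq_le_sq ?_ (by norm_num)
    linarith
  have hgood := M.dataLaw_not_good_le (n := n) μ δ K hl0
  refine (measure_mono ?_).trans (hgood.trans (ENNReal.ofReal_le_ofReal ?_))
  · intro D hD
    simp only [Set.mem_ofPred_eq] at hD ⊢
    intro hG
    refine hD fun π hπ => ⟨sub_nonneg.mpr (M.v_le_vstar π), ?_⟩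
    have := M.vstar_sub_v_le_of_good hH hl0 hd hm hu huH hι0 hι hG hπ
    rw [← hw] at this
    linarith
  · have h1 : Real.exp (-l) = (X ^ 4)⁻¹ := by
      rw [Real.exp_neg, hl, hL, show (4 : ℝ) * Real.log X = Real.log X * (4 : ℕ) by
        push_cast; ring, Real.exp_mul, Real.exp_log hX0, Real.rpow_natCast]
    rw [h1, ← hc, ← div_eq_mul_inv, div_le_iff₀ (by positivity)]
    have h2 : (3 * (c / δ)) ^ 4 ≤ X ^ 4 := by gcongr
    have h3 : 10 * c ≤ δ * (3 * (c / δ)) ^ 4 := by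
      have h4 : 1 ≤ (c / δ) ^ 3 := one_le_pow₀ hcδ
      have h5 : δ * (3 * (c / δ)) ^ 4 = 81 * c * (c / δ) ^ 3 := by
        field_simp; ring
      rw [h5]
      nlinarith
    exact h3.trans (mul_le_mul_of_nonneg_left h2 hδ.le)

end upper

/-! ### The hard instances, their regret and their coverage. -/

section hard

variable {S A : Type*} [Fintype S] [Fintype A] [DecidableEq S] [DecidableEq A]

/-- The distribution with weights `α`, `β`, `γ` at three points. -/
def threePoint (s₀ g b : S) (α β γ : ℝ) (hα : 0 ≤ α) (hβ : 0 ≤ β) (hγ : 0 ≤ γ)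
    (h : α + β + γ = 1) : stdSimplex ℝ S :=
  ⟨fun z => (if z = s₀ then α else 0) + (if z = g then β else 0) + (if z = b then γ else 0),
    fun z => by
      refine add_nonneg (add_nonneg ?_ ?_) ?_ <;> split_ifs <;> simp [*],
    by simp [Finset.sum_add_distrib, h]⟩

lemma threePoint_apply (s₀ g b : S) (α β γ : ℝ) (hα : 0 ≤ α) (hβ : 0 ≤ β) (hγ : 0 ≤ γ)
    (h : α + β + γ = 1) (z : S) : threePoint s₀ g b α β γ hα hβ hγ h z
      = (if z = s₀ then α else 0) + (if z = g then β else 0) + (if z = b then γ else 0) := rfl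

lemma wmean_threePoint (s₀ g b : S) (α β γ : ℝ) (hα : 0 ≤ α) (hβ : 0 ≤ β) (hγ : 0 ≤ γ)
    (h : α + β + γ = 1) (f : S → ℝ) :
    wmean (threePoint s₀ g b α β γ hα hβ hγ h) f = α * f s₀ + β * f g + γ * f b := by
  simp [wmean, threePoint_apply, add_mul, Finset.sum_add_distrib]

/-- The uniform distribution on three points. -/
noncomputable def uniformThree (s₀ g b : S) : stdSimplex ℝ S :=
  threePoint s₀ g b (1 / 3) (1 / 3) (1 / 3) (by norm_num) (by norm_num) (by norm_num)
    (by norm_num)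

/-- The probability of leaving the waiting state. -/
noncomputable def leave (H : ℕ) : ℝ := 1 / (2 * H)

lemma leave_nonneg (H : ℕ) : 0 ≤ leave H := by unfold leave; positivity

lemma leave_le (H : ℕ) : leave H ≤ 1 / 2 := by
  unfold leave
  rcases H.eq_zero_or_pos with h | h
  · simp [h]
  · have : (1 : ℝ) ≤ H := by exact_mod_cast h
    gcongr
    linarith

/-- The hard instance: in the waiting state `s₀` one leaves with a small probability, either to the
absorbing state `g` of reward one or to the absorbing state `b` of reward zero; the action `a₁`
changes the odds by `x h`. -/
noncomputable def hardMDP (H : ℕ) (s₀ g b : S) (a₁ : A) (x : ℕ → Set.Icc (-(1 / 2) : ℝ) (1 / 2)) :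
    MDP S A H where
  init := uniformThree s₀ g b
  P h s a := if s = s₀ then
      threePoint s₀ g b (1 - leave H) (leave H * (1 / 2 + if a = a₁ then (x h : ℝ) else 0))
        (leave H * (1 / 2 - if a = a₁ then (x h : ℝ) else 0)) (by linarith [leave_le H])
        (mul_nonneg (leave_nonneg H) (by split_ifs <;> linarith [(x h).2.1]))
        (mul_nonneg (leave_nonneg H) (by split_ifs <;> linarith [(x h).2.2])) (by ring)
    else stdSimplex.vertex s
  R _ s _ := ⟨Measure.dirac (if s = g then 1 else 0), inferInstance⟩
  R_mem h s a := by
    change ∀ᵐ y ∂(Measure.dirac (if s = g then (1 : ℝ) else 0)), y ∈ Set.Icc (0 : ℝ) 1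
    refine (ae_dirac_iff (p := fun y => y ∈ Set.Icc (0 : ℝ) 1) measurableSet_Icc).mpr ?_
    split_ifs <;> simp

variable {H : ℕ} {s₀ g b : S} {a₁ : A} {x : ℕ → Set.Icc (-(1 / 2) : ℝ) (1 / 2)}

lemma hardMDP_r (h : ℕ) (s : S) (a : A) :
    (hardMDP H s₀ g b a₁ x).r h s a = if s = g then 1 else 0 := by
  change ∫ y, y ∂(Measure.dirac (if s = g then (1 : ℝ) else 0)) = _
  rw [integral_dirac]

lemma hardMDP_P_wait (h : ℕ) (a : A) (z : S) :
    (hardMDP H s₀ g b a₁ x).P h s₀ a z = (if z = s₀ then 1 - leave H else 0)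
      + (if z = g then leave H * (1 / 2 + if a = a₁ then (x h : ℝ) else 0) else 0)
      + (if z = b then leave H * (1 / 2 - if a = a₁ then (x h : ℝ) else 0) else 0) := by
  simp only [hardMDP, if_true, threePoint_apply]

lemma wmean_hardMDP_wait (h : ℕ) (a : A) (f : S → ℝ) :
    wmean ((hardMDP H s₀ g b a₁ x).P h s₀ a) f = (1 - leave H) * f s₀
      + leave H * (1 / 2 + if a = a₁ then (x h : ℝ) else 0) * f g
      + leave H * (1 / 2 - if a = a₁ then (x h : ℝ) else 0) * f b := by
  simp only [hardMDP, if_true, wmean_threePoint]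

lemma hardMDP_P_of_ne (h : ℕ) {s : S} (hs : s ≠ s₀) (a : A) :
    (hardMDP H s₀ g b a₁ x).P h s a = stdSimplex.vertex s := by
  simp only [hardMDP, if_neg hs]

lemma hardMDP_P_apply_of_ne (h : ℕ) {s : S} (hs : s ≠ s₀) (a : A) (z : S) :
    (hardMDP H s₀ g b a₁ x).P h s a z = if z = s then 1 else 0 := by
  rw [hardMDP_P_of_ne h hs]
  simp [Pi.single_apply]

lemma hardMDP_V_of_ne (π : Policy S A) {s : S} (hs : s ≠ s₀) :
    ∀ (k h : ℕ), H - h = k →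
      (hardMDP H s₀ g b a₁ x).V π h s = if s = g then (k : ℝ) else 0 := by
  intro k
  induction k with
  | zero => intro h hk; rw [MDP.V_of_le _ _ (by omega)]; simp
  | succ k ih =>
    intro h hk
    rw [MDP.V_of_lt _ _ (by omega)]
    simp only [hardMDP_P_of_ne h hs, wmean_vertex, ih (h + 1) (by omega), hardMDP_r]
    rw [wmean_const (stdSimplex.sum_eq_one _)]
    split_ifs
    · push_cast; ring
    · ring

lemma hardMDP_V_wait (hg : g ≠ s₀) (hb : b ≠ s₀) (hgb : g ≠ b) (π : Policy S A) {h : ℕ}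
    (hh : h < H) :
    (hardMDP H s₀ g b a₁ x).V π h s₀ = (1 - leave H) * (hardMDP H s₀ g b a₁ x).V π (h + 1) s₀
      + leave H * ((H : ℝ) - h - 1) * (1 / 2 + x h * π h s₀ a₁) := by
  rw [MDP.V_of_lt _ _ hh]
  have e1 : ((H - (h + 1) : ℕ) : ℝ) = (H : ℝ) - h - 1 := by
    rw [Nat.cast_sub (by omega)]; push_cast; ring
  simp only [wmean_hardMDP_wait, hardMDP_V_of_ne π hg _ (h + 1) rfl,
    hardMDP_V_of_ne π hb _ (h + 1) rfl, hardMDP_r, hg.symm, hgb.symm, if_false, if_true, e1]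
  have e2 : ∀ a, (0 : ℝ) + ((1 - leave H) * (hardMDP H s₀ g b a₁ x).V π (h + 1) s₀
      + leave H * (1 / 2 + if a = a₁ then (x h : ℝ) else 0) * ((H : ℝ) - h - 1)
      + leave H * (1 / 2 - if a = a₁ then (x h : ℝ) else 0) * 0)
      = ((1 - leave H) * (hardMDP H s₀ g b a₁ x).V π (h + 1) s₀
      + leave H * ((H : ℝ) - h - 1) * (1 / 2))
      + if a = a₁ then leave H * ((H : ℝ) - h - 1) * x h else 0 := by
    intro a; split_ifs <;> ring
  simp only [e2]
  rw [wmean_add, wmean_const (stdSimplex.sum_eq_one _)]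
  have e3 : wmean (π h s₀) (fun a => if a = a₁ then leave H * ((H : ℝ) - h - 1) * x h else 0)
      = π h s₀ a₁ * (leave H * ((H : ℝ) - h - 1) * x h) := by
    simp [wmean]
  rw [e3]; ring

/-- The weight of the decision at step `k`. -/
noncomputable def decisionWeight (H k : ℕ) : ℝ :=
  1 / 3 * ((1 - leave H) ^ k * (leave H * ((H : ℝ) - k - 1)))

/-- The waiting time does not depend on the policy, so the value is affine in the decisions: the one
at step `k` matters only if the state is left right then, with $H-k-1$ steps of reward at stake. -/
lemma hardMDP_v_sub_v (hg : g ≠ s₀) (hb : b ≠ s₀) (hgb : g ≠ b) (π π' : Policy S A) :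
    (hardMDP H s₀ g b a₁ x).v π' - (hardMDP H s₀ g b a₁ x).v π
      = ∑ k ∈ Finset.range H, decisionWeight H k * (x k * (π' k s₀ a₁ - π k s₀ a₁)) := by
  set M := hardMDP H s₀ g b a₁ x with hM
  have key : ∀ j ≤ H, M.V π' 0 s₀ - M.V π 0 s₀
      = ∑ k ∈ Finset.range j, (1 - leave H) ^ k * (leave H * ((H : ℝ) - k - 1)) *
          (x k * (π' k s₀ a₁ - π k s₀ a₁))
        + (1 - leave H) ^ j * (M.V π' j s₀ - M.V π j s₀) := by
    intro j hj
    induction j with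
    | zero => simp
    | succ j ih =>
      rw [ih (by omega), Finset.sum_range_succ, hM, hardMDP_V_wait hg hb hgb π (by omega),
        hardMDP_V_wait hg hb hgb π' (by omega)]
      ring
  have h1 := key H le_rfl
  rw [M.V_of_le π le_rfl, M.V_of_le π' le_rfl, sub_zero, mul_zero, add_zero] at h1
  have e : ∀ ρ : Policy S A, M.v ρ = 1 / 3 * M.V ρ 0 s₀ + 1 / 3 * M.V ρ 0 g + 1 / 3 * M.V ρ 0 b :=
    fun ρ => by
      change wmean (uniformThree s₀ g b) _ = _
      rw [uniformThree, wmean_threePoint]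
  rw [e, e, hM, hardMDP_V_of_ne π hg _ 0 rfl, hardMDP_V_of_ne π hb _ 0 rfl,
    hardMDP_V_of_ne π' hg _ 0 rfl, hardMDP_V_of_ne π' hb _ 0 rfl, ← hM]
  simp only [decisionWeight, mul_assoc] at h1 ⊢
  rw [← Finset.mul_sum, ← h1]
  ring

/-- The regret of a policy on the hard instance, for an action `a₂` different from `a₁`. -/
lemma hardMDP_regret_ge (hg : g ≠ s₀) (hb : b ≠ s₀) (hgb : g ≠ b) {a₂ : A} (ha : a₂ ≠ a₁)
    (π : Policy S A) :
    ∑ k ∈ Finset.range H, decisionWeight H k *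
        (if 0 < (x k : ℝ) then x k * (1 - π k s₀ a₁) else -x k * π k s₀ a₁)
      ≤ (hardMDP H s₀ g b a₁ x).vstar - (hardMDP H s₀ g b a₁ x).v π := by
  -- The comparison policy knows the signs: `a₁` where it raises the odds of the good state, `a₂`
  -- elsewhere.
  let π' : Policy S A := fun k _ => if 0 < (x k : ℝ) then stdSimplex.vertex a₁
    else stdSimplex.vertex a₂
  have h1 := (hardMDP H s₀ g b a₁ x).v_le_vstar π'
  have h2 := hardMDP_v_sub_v (x := x) (H := H) (a₁ := a₁) hg hb hgb π π'
  have h3 : ∑ k ∈ Finset.range H, decisionWeight H k * (x k * (π' k s₀ a₁ - π k s₀ a₁))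
      = ∑ k ∈ Finset.range H, decisionWeight H k *
        (if 0 < (x k : ℝ) then x k * (1 - π k s₀ a₁) else -x k * π k s₀ a₁) := by
    refine Finset.sum_congr rfl fun k _ => ?_
    congr 1
    by_cases hk : 0 < (x k : ℝ)
    · have : π' k s₀ a₁ = 1 := by simp [π', hk]
      rw [if_pos hk, this]
    · have : π' k s₀ a₁ = 0 := by simp [π', hk, ha.symm]
      rw [if_neg hk, this]; ring
  rw [← h3, ← h2]
  linarith

/-- The occupancy depends neither on the policy nor on the perturbation. One behavior policy can
therefore give `a₁` the exact occupancy $d$ at all steps and for all instances. -/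
lemma hardMDP_stateOcc_wait (hg : g ≠ s₀) (hb : b ≠ s₀) (π : Policy S A) (h : ℕ) :
    (hardMDP H s₀ g b a₁ x).stateOcc π h s₀ = 1 / 3 * (1 - leave H) ^ h := by
  induction h with
  | zero =>
    change uniformThree s₀ g b s₀ = _
    rw [uniformThree, threePoint_apply]; simp [hg.symm, hb.symm]
  | succ h ih =>
    rw [MDP.stateOcc, Finset.sum_eq_single s₀]
    · simp only [hardMDP_P_wait, hg.symm, hb.symm, if_true, if_false, add_zero, ih]
      rw [← Finset.sum_mul, ← Finset.mul_sum, stdSimplex.sum_eq_one]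
      ring
    · intro s _ hs
      simp [hardMDP_P_apply_of_ne h hs, hs.symm]
    · simp

/-- The initial mass $1/3$ never leaves an absorbing state. This is why the initial law is uniform
on the three states: the coverage is then decided by `a₁` in the waiting state. -/
lemma hardMDP_stateOcc_absorbing_ge {s : S} (hs : s ≠ s₀) (hs' : s = g ∨ s = b) (π : Policy S A)
    (h : ℕ) : 1 / 3 ≤ (hardMDP H s₀ g b a₁ x).stateOcc π h s := by
  induction h with
  | zero =>
    change _ ≤ uniformThree s₀ g b s
    rw [uniformThree, threePoint_apply]
    rcases hs' with rfl | rfl <;> split_ifs <;> norm_num at *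
  | succ h ih =>
    refine ih.trans ?_
    have h0 : ∀ y c, 0 ≤ (hardMDP H s₀ g b a₁ x).stateOcc π h y * π h y c *
        (hardMDP H s₀ g b a₁ x).P h y c s := fun y c =>
      mul_nonneg ((hardMDP H s₀ g b a₁ x).occ_nonneg π h y c) (stdSimplex.zero_le _ _)
    rw [MDP.stateOcc]
    refine le_trans ?_ (Finset.single_le_sum (fun y _ => Finset.sum_nonneg fun c _ => h0 y c)
      (Finset.mem_univ s))
    simp only [hardMDP_P_apply_of_ne h hs, if_true, mul_one]
    rw [← Finset.mul_sum, stdSimplex.sum_eq_one, mul_one]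

lemma hardMDP_stateOcc_eq_zero {s : S} (hs : s ≠ s₀) (hsg : s ≠ g) (hsb : s ≠ b) (π : Policy S A)
    (h : ℕ) : (hardMDP H s₀ g b a₁ x).stateOcc π h s = 0 := by
  induction h with
  | zero =>
    change uniformThree s₀ g b s = _
    rw [uniformThree, threePoint_apply]; simp [hs, hsg, hsb]
  | succ h ih =>
    rw [MDP.stateOcc]
    refine Finset.sum_eq_zero fun y _ => Finset.sum_eq_zero fun c _ => ?_
    by_cases hy : y = s₀
    · subst hy
      simp [hardMDP_P_wait, hs, hsg, hsb]
    · rw [hardMDP_P_apply_of_ne h hy]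
      by_cases hys : s = y
      · rw [← hys, ih]; simp
      · simp [hys]

/-- The probability with which the behavior policy plays `a₁` in the waiting state. -/
noncomputable def exploreProb (H : ℕ) (d : ℝ) (h : ℕ) : ℝ := 3 * d / (1 - leave H) ^ h

/-- The distribution with weight `q` at `a₁` and uniform on the other points. -/
noncomputable def spike (a₁ : A) (q : ℝ) (hq0 : 0 ≤ q) (hq1 : q ≤ 1)
    (hA : 2 ≤ Fintype.card A) : stdSimplex ℝ A :=
  ⟨fun a => if a = a₁ then q else (1 - q) / (Fintype.card A - 1), fun a => by
    have : (2 : ℝ) ≤ Fintype.card A := by exact_mod_cast hA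
    change 0 ≤ if a = a₁ then q else (1 - q) / (Fintype.card A - 1)
    split_ifs
    · exact hq0
    · exact div_nonneg (by linarith) (by linarith), by
    have h2 : (2 : ℝ) ≤ Fintype.card A := by exact_mod_cast hA
    have h3 : (Fintype.card A : ℝ) - 1 ≠ 0 := by linarith
    rw [← Finset.add_sum_erase _ _ (Finset.mem_univ a₁), if_pos rfl,
      Finset.sum_congr rfl (g := fun _ => (1 - q) / (Fintype.card A - 1)) (fun a ha =>
        if_neg (Finset.ne_of_mem_erase ha)), Finset.sum_const,
      Finset.card_erase_of_mem (Finset.mem_univ _), Finset.card_univ, nsmul_eq_mul,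
      Nat.cast_sub (by omega), Nat.cast_one, mul_div_cancel₀ _ h3]
    ring⟩

lemma half_le_pow_leave {h : ℕ} (hh : h ≤ H) : 1 / 2 ≤ (1 - leave H) ^ h := by
  have h1 := one_add_mul_le_pow (a := -leave H) (by linarith [leave_le H]) h
  have h2 : h * leave H ≤ 1 / 2 := by
    unfold leave
    rcases H.eq_zero_or_pos with h0 | h0
    · simp [h0]
    · have h3 : (0 : ℝ) < H := by exact_mod_cast h0
      have h4 : (h : ℝ) ≤ H := by exact_mod_cast hh
      rw [mul_one_div, div_le_div_iff₀ (by positivity) (by norm_num)]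
      linarith
  have h3 : (1 + -leave H) = 1 - leave H := by ring
  rw [h3] at h1
  linarith

lemma exploreProb_nonneg {d : ℝ} (hd : 0 ≤ d) (h : ℕ) : 0 ≤ exploreProb H d h :=
  div_nonneg (by linarith) (pow_nonneg (by linarith [leave_le H]) _)

lemma exploreProb_le {d : ℝ} (hd1 : d ≤ 1 / 12) {h : ℕ} (hh : h ≤ H) :
    exploreProb H d h ≤ 1 / 2 := by
  have h1 := half_le_pow_leave hh
  rw [exploreProb, div_le_iff₀ (by linarith)]
  linarith

/-- There is a behavior policy for which the coverage of every hard instance is exactly `d`. -/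
lemma exists_behavior (hH : 0 < H) (hg : g ≠ s₀) (hb : b ≠ s₀) (hA : 2 ≤ Fintype.card A) {d : ℝ}
    (hd : 0 < d) (hdA : d ≤ 1 / 12 / Fintype.card A) (a₁ : A) :
    ∃ μ : Policy S A, ∀ x : ℕ → Set.Icc (-(1 / 2) : ℝ) (1 / 2),
      (hardMDP H s₀ g b a₁ x).dm μ = d ∧
      ∀ h < H, (hardMDP H s₀ g b a₁ x).occ μ h s₀ a₁ = d := by
  have hA2 : (2 : ℝ) ≤ Fintype.card A := by exact_mod_cast hA
  have : Nonempty A := ⟨a₁⟩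
  have hdA' : d * Fintype.card A ≤ 1 / 12 := by
    rwa [le_div_iff₀ (by linarith)] at hdA
  have hd1 : d ≤ 1 / 12 := by nlinarith
  -- The weight of `a₁` grows with `h` to offset the decay of the waiting probability; the other
  -- actions share the rest equally.
  let μ : Policy S A := fun h s => if hh : h ≤ H ∧ s = s₀ then
      spike a₁ (exploreProb H d h) (exploreProb_nonneg hd.le h)
        ((exploreProb_le hd1 hh.1).trans (by norm_num)) hA
    else stdSimplex.barycenter
  have hμ : ∀ h ≤ H, ∀ a, μ h s₀ a = if a = a₁ then exploreProb H d h
      else (1 - exploreProb H d h) / (Fintype.card A - 1) := by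
    intro h hh a
    simp only [μ, hh, and_self, dif_pos]
    rfl
  refine ⟨μ, fun x => ?_⟩
  have hocc : ∀ h < H, (hardMDP H s₀ g b a₁ x).occ μ h s₀ a₁ = d := by
    intro h hh
    rw [MDP.occ, hardMDP_stateOcc_wait hg hb, hμ h hh.le, if_pos rfl, exploreProb]
    have := half_le_pow_leave hh.le
    have h3 : (1 - leave H) ^ h ≠ 0 := by linarith
    field_simp
  refine ⟨le_antisymm ?_ ?_, hocc⟩
  · have h1 := (hardMDP H s₀ g b a₁ x).dm_le μ hH (s := s₀) ⟨μ, by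
      rw [hardMDP_stateOcc_wait hg hb]; norm_num⟩ a₁
    rwa [hocc 0 hH] at h1
  · refine le_csInf ⟨_, 0, s₀, a₁, hH, ⟨μ, by
      rw [hardMDP_stateOcc_wait hg hb]; norm_num⟩, rfl⟩ ?_
    rintro _ ⟨h, s, a, hh, ⟨π, hs⟩, rfl⟩
    by_cases hs0 : s = s₀
    · subst hs0
      by_cases haa : a = a₁
      · subst haa; exact (hocc h hh).ge
      · rw [MDP.occ, hardMDP_stateOcc_wait hg hb, hμ h hh.le, if_neg haa]
        have h1 := half_le_pow_leave hh.le
        have h2 := exploreProb_le hd1 hh.le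
        have h3 : d ≤ 1 / 3 * (1 / 2) * (1 / 2 / (Fintype.card A - 1)) := by
          have h4 : 1 / 3 * (1 / 2) * (1 / 2 / ((Fintype.card A : ℝ) - 1))
            = 1 / 12 / (Fintype.card A - 1) := by
            have : (Fintype.card A : ℝ) - 1 ≠ 0 := by linarith
            field_simp; norm_num
          rw [h4, le_div_iff₀ (by linarith)]
          nlinarith
        refine h3.trans ?_
        have h5 : (0 : ℝ) < Fintype.card A - 1 := by linarith
        gcongr
        linarith
    · have hμs : μ h s a = 1 / Fintype.card A := by
        simp only [μ, hs0, and_false, dif_neg, not_false_eq_true]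
        change (stdSimplex.barycenter : stdSimplex ℝ A).1 a = _
        rw [stdSimplex.barycenter_apply]; simp
      by_cases hgs : s = g ∨ s = b
      · have h1 := hardMDP_stateOcc_absorbing_ge (H := H) (a₁ := a₁) (x := x) hs0 hgs μ h
        rw [MDP.occ, hμs, mul_one_div, le_div_iff₀ (by linarith)]
        linarith
      · push Not at hgs
        rw [hardMDP_stateOcc_eq_zero hs0 hgs.1 hgs.2] at hs
        exact absurd hs (lt_irrefl _)

end hard

/-! ### Two-point testing, discrete product laws, reverse Markov. -/

section testing

/-- Le Cam's two-point bound in terms of the Hellinger affinity. -/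
lemma half_sq_affinity_le {Z : Type*} [Fintype Z] {W W' f : Z → ℝ} (hW : ∀ z, 0 ≤ W z)
    (hW' : ∀ z, 0 ≤ W' z) (h1 : ∑ z, W z = 1) (h1' : ∑ z, W' z = 1) (hf0 : ∀ z, 0 ≤ f z)
    (hf1 : ∀ z, f z ≤ 1) :
    1 / 2 * (∑ z, √(W z * W' z)) ^ 2 ≤ ∑ z, W z * (1 - f z) + ∑ z, W' z * f z := by
  have hmin : ∑ z, min (W z) (W' z) ≤ ∑ z, W z * (1 - f z) + ∑ z, W' z * f z := by
    rw [← Finset.sum_add_distrib]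
    refine Finset.sum_le_sum fun z _ => ?_
    have h2 := mul_le_mul_of_nonneg_right (min_le_left (W z) (W' z)) (sub_nonneg.mpr (hf1 z))
    have h3 := mul_le_mul_of_nonneg_right (min_le_right (W z) (W' z)) (hf0 z)
    linarith
  have hmax : ∑ z, max (W z) (W' z) ≤ 2 := by
    have : ∑ z, max (W z) (W' z) ≤ ∑ z, (W z + W' z) :=
      Finset.sum_le_sum fun z _ => max_le (by linarith [hW' z]) (by linarith [hW z])
    rw [Finset.sum_add_distrib, h1, h1'] at this
    linarith
  -- Since $WW'=\min\cdot\max$, Cauchy–Schwarz bounds the squared affinity by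
  -- $\sum\min\cdot\sum\max\le2\sum\min$.
  have cs := Finset.sum_mul_sq_le_sq_mul_sq Finset.univ (fun z => √(min (W z) (W' z)))
    (fun z => √(max (W z) (W' z)))
  have hm0 : ∀ z, 0 ≤ min (W z) (W' z) := fun z => le_min (hW z) (hW' z)
  have hM0 : ∀ z, 0 ≤ max (W z) (W' z) := fun z => le_max_of_le_left (hW z)
  simp only [Real.sq_sqrt (hm0 _), Real.sq_sqrt (hM0 _), ← Real.sqrt_mul (hm0 _), min_mul_max] at cs
  have h2 : 0 ≤ ∑ z, min (W z) (W' z) := Finset.sum_nonneg fun z _ => hm0 z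
  have h3 := mul_le_mul_of_nonneg_left hmax h2
  linarith

/-- The affinity of product distributions. -/
lemma sum_sqrt_prod_mul_prod {Q : Type*} [Fintype Q] (w w' : Q → ℝ) (hw : ∀ q, 0 ≤ w q)
    (hw' : ∀ q, 0 ≤ w' q) (n : ℕ) :
    ∑ z : Fin n → Q, √((∏ i, w (z i)) * ∏ i, w' (z i)) = (∑ q, √(w q * w' q)) ^ n := by
  rw [Fintype.sum_pow]
  refine Finset.sum_congr rfl fun z _ => ?_
  rw [← Finset.prod_mul_distrib, Real.sqrt_prod _ fun i _ => mul_nonneg (hw _) (hw' _)]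

/-- The law of independent copies of a discrete random variable. -/
lemma pi_sum_dirac {Q E : Type*} [Fintype Q] [MeasurableSpace E] (c : Q → ENNReal) (e : Q → E)
    (n : ℕ) [IsFiniteMeasure (∑ q, c q • Measure.dirac (e q))] :
    Measure.pi (fun _ : Fin n => ∑ q, c q • Measure.dirac (e q))
      = ∑ z : Fin n → Q, (∏ i, c (z i)) • Measure.dirac (fun i => e (z i)) := by
  classical
  refine Measure.pi_eq fun s hs => ?_
  simp only [Measure.finsetSum_apply, Measure.smul_apply, smul_eq_mul]
  rw [Finset.prod_univ_sum, Fintype.piFinset_univ]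
  refine Finset.sum_congr rfl fun z _ => ?_
  rw [Finset.prod_mul_distrib]
  congr 1
  rw [Measure.dirac_apply' _ (MeasurableSet.univ_pi hs)]
  simp only [Measure.dirac_apply' _ (hs _), Set.indicator_apply, Set.mem_univ_pi, Pi.one_apply]
  rw [Finset.prod_ite_zero]
  simp

lemma pi_dirac {ι E : Type*} [Fintype ι] [MeasurableSpace E] (r : ι → E) :
    Measure.pi (fun i => Measure.dirac (r i)) = Measure.dirac r := by
  classical
  refine Measure.pi_eq fun s hs => ?_
  rw [Measure.dirac_apply' _ (MeasurableSet.univ_pi hs)]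
  simp only [Measure.dirac_apply' _ (hs _), Set.indicator_apply, Set.mem_univ_pi, Pi.one_apply]
  rw [Finset.prod_ite_zero]
  simp

/-- A reverse Markov inequality. -/
lemma le_measure_of_le_integral {α : Type*} [MeasurableSpace α] (P : Measure α)
    [IsProbabilityMeasure P] {X : α → ℝ} (hX : Measurable X) {T : ℝ} (hT : 0 < T)
    (h0 : ∀ a, 0 ≤ X a) (h1 : ∀ a, X a ≤ T) (hI : T / 8 ≤ ∫ a, X a ∂P) :
    ENNReal.ofReal (1 / 16) ≤ P {a | T / 16 < X a} := by
  have hB : MeasurableSet {a | T / 16 < X a} := measurableSet_lt measurable_const hX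
  have h2 : ∫ a, X a ∂P
      ≤ ∫ a, (Set.indicator {a | T / 16 < X a} (fun _ => T) a + T / 16) ∂P := by
    refine integral_mono (Integrable.of_bound hX.aestronglyMeasurable T
      (Filter.Eventually.of_forall fun a => ?_))
      (((integrable_const T).indicator hB).add (integrable_const _)) fun a => ?_
    · rw [Real.norm_eq_abs, abs_of_nonneg (h0 a)]; exact h1 a
    · by_cases ha : T / 16 < X a
      · have : a ∈ {a | T / 16 < X a} := ha
        simp only [Set.indicator_of_mem this]
        linarith [h1 a]
      · have : a ∉ {a | T / 16 < X a} := ha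
        simp only [Set.indicator_of_notMem this]
        linarith
  rw [integral_add ((integrable_const T).indicator hB) (integrable_const _),
    integral_indicator_const _ hB, integral_const] at h2
  simp only [smul_eq_mul, probReal_univ, one_mul] at h2
  rw [← ofReal_measureReal]
  refine ENNReal.ofReal_le_ofReal ?_
  have h3 : 1 / 16 * T ≤ P.real {a | T / 16 < X a} * T := by linarith
  exact le_of_mul_le_mul_right h3 hT

end testing

/-! ### Path probabilities as real numbers. -/

section paths

variable {S A : Type*} [Fintype S] [Fintype A] {H : ℕ}

/-- The states and actions of an episode. -/
abbrev Path (S A : Type*) (H : ℕ) : Type _ := (Fin (H + 1) → S) × (Fin H → A)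

/-- The probability of a path. -/
noncomputable def MDP.pathProb (M : MDP S A H) (μ : Policy S A) (q : Path S A H) : ℝ :=
  pathWeight (fun h s a z => M.P h s a z) (fun h s a => μ h s a) M.init q.1 q.2

lemma MDP.pathProb_nonneg (M : MDP S A H) (μ : Policy S A) (q : Path S A H) :
    0 ≤ M.pathProb μ q :=
  mul_nonneg (stdSimplex.zero_le _ _) (Finset.prod_nonneg fun _ _ =>
    mul_nonneg (stdSimplex.zero_le _ _) (stdSimplex.zero_le _ _))

lemma MDP.forward_eq_stateOcc (M : MDP S A H) (μ : Policy S A) (h : ℕ) :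
    forward (fun h s a z => M.P h s a z) (fun h s a => μ h s a) M.init h = M.stateOcc μ h := by
  induction h with
  | zero => rfl
  | succ h ih => funext z; rw [forward, ih]; rfl

lemma MDP.sum_pathProb (M : MDP S A H) (μ : Policy S A) : ∑ q, M.pathProb μ q = 1 := by
  have := pathSum_init (fun h s a z => M.P h s a z) (fun h s a => μ h s a)
    (fun _ _ _ => stdSimplex.sum_eq_one _) (fun _ _ => stdSimplex.sum_eq_one _) M.init H
    (fun _ => 1)
  simp only [pathSum, mul_one, stdSimplex.sum_eq_one] at this
  rw [Fintype.sum_prod_type]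
  exact this

lemma MDP.sum_pathProb_step (M : MDP S A H) (μ : Policy S A) (h : Fin H) (φ : S → A → S → ℝ) :
    ∑ q : Path S A H, M.pathProb μ q * φ (q.1 h.castSucc) (q.2 h) (q.1 h.succ)
      = ∑ x, ∑ y, M.occ μ h x y * wmean (M.P h x y) (φ x y) := by
  have := pathSum_step (fun h s a z => M.P h s a z) (fun h s a => μ h s a)
    (fun _ _ _ => stdSimplex.sum_eq_one _) (fun _ _ => stdSimplex.sum_eq_one _) M.init H h φ
  rw [M.forward_eq_stateOcc] at this
  rw [Fintype.sum_prod_type]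
  refine this.trans ?_
  simp only [wmean, Finset.mul_sum, MDP.occ, mul_assoc]

end paths

/-! ### Hellinger affinity of two hard instances. -/

section affinity

variable {S A : Type*} [Fintype S] [Fintype A] [DecidableEq S] [DecidableEq A]
  {H : ℕ} {s₀ g b : S} {a₁ : A}

/-- The episode of the hard instance with given states and actions. -/
def hardEpisode (g : S) (q : Path S A H) : Episode S A H :=
  (q.1, q.2, fun h => if q.1 h.castSucc = g then 1 else 0)

lemma hardMDP_P_congr {x x' : ℕ → Set.Icc (-(1 / 2) : ℝ) (1 / 2)} {h : ℕ} (hx : x h = x' h) (s : S)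
    (a : A) : (hardMDP H s₀ g b a₁ x).P h s a = (hardMDP H s₀ g b a₁ x').P h s a := by
  simp only [hardMDP, hx]

/-- One-step comparison of two perturbed instances with the unperturbed one. -/
lemma hardMDP_P_mul_P_ge (hg : g ≠ s₀) (hb : b ≠ s₀) (hgb : g ≠ b)
    {x x' x₀ : ℕ → Set.Icc (-(1 / 2) : ℝ) (1 / 2)} {k : ℕ} {κ : ℝ} (hx : (x k : ℝ) = κ)
    (hx' : (x' k : ℝ) = -κ) (hx₀ : (x₀ k : ℝ) = 0) (s : S) (a : A) (z : S) :
    ((hardMDP H s₀ g b a₁ x₀).P k s a z *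
        (1 - 4 * κ ^ 2 * if s = s₀ ∧ a = a₁ ∧ z ≠ s₀ then 1 else 0)) ^ 2
      ≤ (hardMDP H s₀ g b a₁ x).P k s a z * (hardMDP H s₀ g b a₁ x').P k s a z := by
  have hκ : κ ^ 2 ≤ 1 / 4 := by
    have h1 := (x k).2.1
    have h2 := (x k).2.2
    rw [hx] at h1 h2
    nlinarith
  by_cases hs : s = s₀
  · subst hs
    simp only [hardMDP_P_wait, hx, hx', hx₀]
    by_cases ha : a = a₁
    · simp only [ha, if_true, true_and]
      have hsq : (1 - 4 * κ ^ 2) ^ 2 ≤ 1 - 4 * κ ^ 2 := by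
        nlinarith [sq_nonneg κ, mul_nonneg (sq_nonneg κ) (sub_nonneg.mpr hκ)]
      have hmain : (leave H * (1 / 2) * (1 - 4 * κ ^ 2)) ^ 2
          ≤ leave H * (1 / 2 + κ) * (leave H * (1 / 2 + -κ)) := by
        have := mul_le_mul_of_nonneg_left hsq (sq_nonneg (leave H * (1 / 2)))
        nlinarith
      by_cases hz : z = s
      · subst hz
        simp only [hg.symm, hb.symm, if_true, if_false, ne_eq, not_true_eq_false]
        nlinarith
      · by_cases hzg : z = g
        · subst hzg
          simp only [hz, hgb, if_true, if_false, ne_eq, not_false_eq_true]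
          simpa using hmain
        · by_cases hzb : z = b
          · subst hzb
            simp only [hz, hzg, if_true, if_false, ne_eq, not_false_eq_true]
            refine le_trans (le_of_eq ?_) (hmain.trans_eq ?_) <;> ring
          · simp [hz, hzg, hzb]
    · simp only [ha, if_false, false_and, and_false]
      nlinarith
  · simp only [hardMDP_P_apply_of_ne k hs, hs, false_and, if_false]
    split_ifs <;> norm_num

/-- The affinity of two hard instances that differ only at step `k`. -/
lemma hardMDP_affinity_ge (hg : g ≠ s₀) (hb : b ≠ s₀) (hgb : g ≠ b)
    {x x' x₀ : ℕ → Set.Icc (-(1 / 2) : ℝ) (1 / 2)} (k : Fin H) {κ : ℝ} (hx : (x k : ℝ) = κ)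
    (hx' : (x' k : ℝ) = -κ) (hx₀ : (x₀ k : ℝ) = 0)
    (hne : ∀ h : ℕ, h ≠ k → x h = x₀ h ∧ x' h = x₀ h) (μ : Policy S A) :
    1 - 4 * κ ^ 2 * ((hardMDP H s₀ g b a₁ x₀).occ μ k s₀ a₁ * leave H)
      ≤ ∑ q, √((hardMDP H s₀ g b a₁ x).pathProb μ q * (hardMDP H s₀ g b a₁ x').pathProb μ q) := by
  set M := hardMDP H s₀ g b a₁ x with hM
  set M' := hardMDP H s₀ g b a₁ x' with hM'
  set M₀ := hardMDP H s₀ g b a₁ x₀ with hM₀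
  let I : S → A → S → ℝ := fun s a z => if s = s₀ ∧ a = a₁ ∧ z ≠ s₀ then 1 else 0
  have hsum : ∑ q : Path S A H, M₀.pathProb μ q *
      (1 - 4 * κ ^ 2 * I (q.1 k.castSucc) (q.2 k) (q.1 k.succ))
      = 1 - 4 * κ ^ 2 * (M₀.occ μ k s₀ a₁ * leave H) := by
    have h1 := M₀.sum_pathProb_step μ k I
    have h2 : ∑ s, ∑ a, M₀.occ μ k s a * wmean (M₀.P k s a) (I s a)
        = M₀.occ μ k s₀ a₁ * leave H := by
      rw [Finset.sum_eq_single s₀, Finset.sum_eq_single a₁]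
      · congr 1
        rw [hM₀, wmean_hardMDP_wait]
        simp only [I, hg, hb, ne_eq, not_true_eq_false, not_false_eq_true, and_false, and_self,
          if_true, if_false]
        ring
      · intro a _ ha
        simp [I, ha, wmean]
      · simp
      · intro s _ hs
        simp [I, hs, wmean]
      · simp
    rw [h2] at h1
    have h3 := M₀.sum_pathProb μ
    rw [← h1, Finset.mul_sum]
    refine Eq.trans ?_ (congrArg (· - _) h3)
    rw [← Finset.sum_sub_distrib]
    refine Finset.sum_congr rfl fun q _ => ?_
    ring
  rw [← hsum]
  -- Path by path, $\sqrt{pp'}$ dominates the probability under the instance unperturbed at step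
  -- `k`, reduced by $4\kappa^2$ if the path leaves the waiting state after `a₁` at that step.
  -- Summing gives an expectation under a genuine law.
  refine Finset.sum_le_sum fun q _ => Real.le_sqrt_of_sq_le ?_
  have hprod : ∀ c : ℝ, (∏ i : Fin H, (if i = k then c else 1)) = c := fun c => by simp
  have e1 : (M₀.pathProb μ q * (1 - 4 * κ ^ 2 * I (q.1 k.castSucc) (q.2 k) (q.1 k.succ))) ^ 2
      = (uniformThree s₀ g b (q.1 0)) ^ 2 * ∏ i : Fin H, ((μ i (q.1 i.castSucc) (q.2 i)) ^ 2 *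
        (M₀.P i (q.1 i.castSucc) (q.2 i) (q.1 i.succ) * (if i = k then
          (1 - 4 * κ ^ 2 * I (q.1 k.castSucc) (q.2 k) (q.1 k.succ)) else 1)) ^ 2) := by
    simp only [mul_pow, Finset.prod_mul_distrib, Finset.prod_pow, hprod, MDP.pathProb, pathWeight]
    have e3 : M₀.init (q.1 0) = uniformThree s₀ g b (q.1 0) := rfl
    rw [e3]; ring
  have e2 : M.pathProb μ q * M'.pathProb μ q
      = (uniformThree s₀ g b (q.1 0)) ^ 2 * ∏ i : Fin H, ((μ i (q.1 i.castSucc) (q.2 i)) ^ 2 *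
        (M.P i (q.1 i.castSucc) (q.2 i) (q.1 i.succ) *
          M'.P i (q.1 i.castSucc) (q.2 i) (q.1 i.succ))) := by
    simp only [Finset.prod_mul_distrib, Finset.prod_pow, MDP.pathProb, pathWeight]
    have e3 : M.init (q.1 0) = uniformThree s₀ g b (q.1 0) := rfl
    have e4 : M'.init (q.1 0) = uniformThree s₀ g b (q.1 0) := rfl
    rw [e3, e4]; ring
  rw [e1, e2]
  refine mul_le_mul_of_nonneg_left (Finset.prod_le_prod (fun i _ => by positivity) fun i _ =>
    mul_le_mul_of_nonneg_left ?_ (sq_nonneg _)) (sq_nonneg _)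
  by_cases hi : i = k
  · subst hi
    simp only [if_true]
    exact hardMDP_P_mul_P_ge hg hb hgb hx hx' hx₀ _ _ _
  · have hi' : (i : ℕ) ≠ k := fun h => hi (Fin.ext h)
    rw [if_neg hi, mul_one, sq, hM, hM', hM₀, hardMDP_P_congr (hne i hi').1,
      hardMDP_P_congr (hne i hi').2]

variable [MeasurableSpace S] [MeasurableSpace A]

lemma hardMDP_episodeLaw (x : ℕ → Set.Icc (-(1 / 2) : ℝ) (1 / 2)) (μ : Policy S A) :
    (hardMDP H s₀ g b a₁ x).episodeLaw μ = ∑ q : Path S A H,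
      ENNReal.ofReal ((hardMDP H s₀ g b a₁ x).pathProb μ q) • Measure.dirac (hardEpisode g q) := by
  rw [MDP.episodeLaw, Fintype.sum_prod_type]
  refine Finset.sum_congr rfl fun s _ => Finset.sum_congr rfl fun a _ => ?_
  congr 1
  have h1 : (Measure.pi fun h : Fin H =>
      ((hardMDP H s₀ g b a₁ x).R h (s h.castSucc) (a h) : Measure ℝ))
      = Measure.dirac (fun h => if s h.castSucc = g then 1 else 0) := by
    exact pi_dirac _
  rw [h1, Measure.map_dirac' (by fun_prop)]
  rfl

lemma hardMDP_dataLaw (x : ℕ → Set.Icc (-(1 / 2) : ℝ) (1 / 2)) (μ : Policy S A) (n : ℕ) :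
    (hardMDP H s₀ g b a₁ x).dataLaw μ n = ∑ z : Fin n → Path S A H,
      ENNReal.ofReal (∏ i, (hardMDP H s₀ g b a₁ x).pathProb μ (z i)) •
        Measure.dirac (fun i => hardEpisode g (z i)) := by
  have h0 := hardMDP_episodeLaw (H := H) (s₀ := s₀) (g := g) (b := b) (a₁ := a₁) x μ
  have : IsFiniteMeasure (∑ q : Path S A H,
      ENNReal.ofReal ((hardMDP H s₀ g b a₁ x).pathProb μ q) •
        Measure.dirac (hardEpisode g q)) := by
    rw [← h0]; infer_instance
  rw [MDP.dataLaw, h0, pi_sum_dirac]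
  refine Finset.sum_congr rfl fun z _ => ?_
  rw [ENNReal.ofReal_prod_of_nonneg fun i _ => MDP.pathProb_nonneg _ _ _]

/-- The rewards are deterministic, so the data are a function of finitely many paths. Testing the
signs becomes a problem on a finite set once the internal randomness is averaged. -/
lemma hardMDP_integral [MeasurableSingletonClass S] [MeasurableSingletonClass A]
    (x : ℕ → Set.Icc (-(1 / 2) : ℝ) (1 / 2)) (μ : Policy S A) (n : ℕ)
    {Ω : Type*} [MeasurableSpace Ω] (ν : Measure Ω) [IsProbabilityMeasure ν]
    {F : Dataset S A H n × Ω → ℝ} (hF : Measurable F) {T : ℝ} (hT : ∀ y, |F y| ≤ T) :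
    ∫ y, F y ∂(((hardMDP H s₀ g b a₁ x).dataLaw μ n).prod ν)
      = ∑ z : Fin n → Path S A H, (∏ i, (hardMDP H s₀ g b a₁ x).pathProb μ (z i)) *
        ∫ ω, F (fun i => hardEpisode g (z i), ω) ∂ν := by
  have : IsProbabilityMeasure ((hardMDP H s₀ g b a₁ x).dataLaw μ n) := by
    unfold MDP.dataLaw; infer_instance
  rw [integral_prod _ (Integrable.of_bound hF.aestronglyMeasurable T
    (Filter.Eventually.of_forall hT)), hardMDP_dataLaw, integral_finsetSum_measure]
  · refine Finset.sum_congr rfl fun z _ => ?_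
    rw [integral_smul_measure, integral_dirac, ENNReal.toReal_ofReal
      (Finset.prod_nonneg fun i _ => MDP.pathProb_nonneg _ _ _), smul_eq_mul]
  · intro z _
    exact (integrable_dirac (by simp)).smul_measure ENNReal.ofReal_ne_top

end affinity

/-! ### Assouad's lemma. -/

section assouad

/-- Flipping one bit of a sign vector. -/
def flipAt {H : ℕ} (k : Fin H) (θ : Fin H → Bool) : Fin H → Bool := Function.update θ k (!θ k)

lemma flipAt_same {H : ℕ} (k : Fin H) (θ : Fin H → Bool) : flipAt k θ k = !θ k := by
  simp [flipAt]

lemma flipAt_of_ne {H : ℕ} {k j : Fin H} (h : j ≠ k) (θ : Fin H → Bool) : flipAt k θ j = θ j := by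
  simp [flipAt, h]

lemma flipAt_involutive {H : ℕ} (k : Fin H) : Function.Involutive (flipAt k) := by
  intro θ
  simp [flipAt]

/-- Assouad's lemma: if flipping one bit of the parameter hardly changes the law of the data, then
for some parameter the bits cannot be guessed. -/
lemma exists_sum_div_eight_le {H : ℕ} {Z : Type*} [Fintype Z] {W : (Fin H → Bool) → Z → ℝ}
    (hW0 : ∀ θ z, 0 ≤ W θ z) (hW1 : ∀ θ, ∑ z, W θ z = 1) {f : Fin H → Z → ℝ}
    (hf0 : ∀ k z, 0 ≤ f k z) (hf1 : ∀ k z, f k z ≤ 1) {c : Fin H → ℝ} (hc : ∀ k, 0 ≤ c k)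
    (haff : ∀ θ k, θ k = true → 3 / 4 ≤ ∑ z, √(W θ z * W (flipAt k θ) z)) :
    ∃ θ, (∑ k, c k) / 8 ≤ ∑ z, W θ z * ∑ k, c k * (if θ k then 1 - f k z else f k z) := by
  let E : (Fin H → Bool) → Fin H → ℝ := fun θ k =>
    ∑ z, W θ z * (if θ k then 1 - f k z else f k z)
  have hE1 : ∀ θ k, θ k = true → 1 / 4 ≤ E θ k + E (flipAt k θ) k := by
    intro θ k hθ
    have h1 := half_sq_affinity_le (hW0 θ) (hW0 (flipAt k θ)) (hW1 θ) (hW1 _) (hf0 k) (hf1 k)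
    have h2 := haff θ k hθ
    have h3 : E θ k = ∑ z, W θ z * (1 - f k z) := by simp [E, hθ]
    have h4 : E (flipAt k θ) k = ∑ z, W (flipAt k θ) z * f k z := by simp [E, flipAt_same, hθ]
    rw [h3, h4]
    nlinarith
  have hE2 : ∀ θ k, 1 / 4 ≤ E θ k + E (flipAt k θ) k := by
    intro θ k
    by_cases hθ : θ k = true
    · exact hE1 θ k hθ
    · have h1 := hE1 (flipAt k θ) k (by simpa [flipAt_same] using hθ)
      rw [flipAt_involutive k θ] at h1
      linarith
  have hE3 : ∀ k, ∑ _θ : Fin H → Bool, (1 / 8 : ℝ) ≤ ∑ θ, E θ k := by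
    intro k
    -- Flipping a bit is an involution of the cube. On average over `θ` each bit is therefore
    -- misjudged with weight at least half of the two-point bound $1/4$.
    have h1 : ∑ θ, E (flipAt k θ) k = ∑ θ, E θ k :=
      Equiv.sum_comp (flipAt_involutive k).toPerm fun θ => E θ k
    have h2 : ∑ _θ : Fin H → Bool, (1 / 4 : ℝ) ≤ ∑ θ, (E θ k + E (flipAt k θ) k) :=
      Finset.sum_le_sum fun θ _ => hE2 θ k
    rw [Finset.sum_add_distrib, h1] at h2
    simp only [Finset.sum_const, nsmul_eq_mul] at h2 ⊢
    linarith
  have hsum : ∑ _θ : Fin H → Bool, (∑ k, c k) / 8 ≤ ∑ θ, ∑ k, c k * E θ k := by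
    rw [Finset.sum_comm]
    refine le_trans (le_of_eq ?_) (Finset.sum_le_sum fun k _ =>
      (mul_le_mul_of_nonneg_left (hE3 k) (hc k)).trans_eq (Finset.mul_sum _ _ _))
    rw [← Finset.sum_mul]
    simp only [Finset.sum_const, nsmul_eq_mul]
    ring
  obtain ⟨θ, -, hθ⟩ := Finset.exists_le_of_sum_le Finset.univ_nonempty hsum
  refine ⟨θ, hθ.trans_eq ?_⟩
  simp only [E, Finset.mul_sum]
  rw [Finset.sum_comm]
  refine Finset.sum_congr rfl fun z _ => Finset.sum_congr rfl fun k _ => ?_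
  ring

end assouad

/-! ### The minimax lower bound. -/

section lower

/-- The perturbation of size `κ` whose signs are given by `θ`. -/
noncomputable def signs {H : ℕ} {κ : ℝ} (hκ0 : 0 ≤ κ) (hκ : κ ≤ 1 / 2) (θ : Fin H → Bool) (h : ℕ) :
    Set.Icc (-(1 / 2) : ℝ) (1 / 2) :=
  if hh : h < H then
    if θ ⟨h, hh⟩ then ⟨κ, by linarith, hκ⟩ else ⟨-κ, by linarith, by linarith⟩
  else ⟨0, by norm_num, by norm_num⟩

lemma signs_apply {H : ℕ} {κ : ℝ} (hκ0 : 0 ≤ κ) (hκ : κ ≤ 1 / 2) (θ : Fin H → Bool) (k : Fin H) :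
    (signs hκ0 hκ θ k : ℝ) = if θ k then κ else -κ := by
  simp only [signs, k.2, dif_pos, Fin.eta]
  split_ifs <;> rfl

lemma signs_flipAt_of_ne {H : ℕ} {κ : ℝ} (hκ0 : 0 ≤ κ) (hκ : κ ≤ 1 / 2) (θ : Fin H → Bool)
    (k : Fin H) {h : ℕ} (hne : h ≠ k) : signs hκ0 hκ (flipAt k θ) h = signs hκ0 hκ θ h := by
  unfold signs
  split_ifs with h1 h2 h3 h3 <;> try rfl
  all_goals
    rw [flipAt_of_ne fun h => hne (congrArg Fin.val h)] at h2
    exact absurd h2 (by simp_all)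

lemma decisionWeight_nonneg {H k : ℕ} (hk : k < H) : 0 ≤ decisionWeight H k := by
  have h1 : (k : ℝ) + 1 ≤ H := by exact_mod_cast hk
  have h2 : 0 ≤ 1 - leave H := by linarith [leave_le H]
  have h3 := leave_nonneg H
  have h4 : 0 ≤ (H : ℝ) - k - 1 := by linarith
  unfold decisionWeight
  positivity

lemma sum_range_sub_sub_one (m : ℝ) (n : ℕ) :
    ∑ k ∈ Finset.range n, (m - k - 1) = n * m - n * (n + 1) / 2 := by
  induction n with
  | zero => simp
  | succ n ih => rw [Finset.sum_range_succ, ih]; push_cast; ring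

/-- Waiting has probability at least $1/2$ at all steps, so the weight at `k` is at least
$(H-k-1)/(12H)$. These sum to $(H-1)/24$, and $H\ge2$ makes this at least $H/48$. -/
lemma sum_decisionWeight_ge {H : ℕ} (hH : 2 ≤ H) :
    (H : ℝ) / 48 ≤ ∑ k : Fin H, decisionWeight H k := by
  have hH' : (2 : ℝ) ≤ H := by exact_mod_cast hH
  have h1 : ∀ k ∈ Finset.range H, 1 / (12 * (H : ℝ)) * ((H : ℝ) - k - 1) ≤ decisionWeight H k := by
    intro k hk
    have hk' := Finset.mem_range.mp hk
    have h2 : (k : ℝ) + 1 ≤ H := by exact_mod_cast hk'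
    have h3 := mul_le_mul_of_nonneg_right (half_le_pow_leave hk'.le)
      (mul_nonneg (leave_nonneg H) (by linarith : (0 : ℝ) ≤ (H : ℝ) - k - 1))
    unfold decisionWeight
    refine le_trans (le_of_eq ?_) (mul_le_mul_of_nonneg_left h3 (by norm_num))
    unfold leave
    field_simp
    ring
  rw [Fin.sum_univ_eq_sum_range (fun k => decisionWeight H k)]
  refine le_trans ?_ (Finset.sum_le_sum h1)
  rw [← Finset.mul_sum, sum_range_sub_sub_one, one_div_mul_eq_div, le_div_iff₀ (by positivity)]
  nlinarith

/-- The minimax lower bound. -/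
theorem exists_hard_instance {S A : Type*} [Fintype S] [Fintype A] [MeasurableSpace S]
    [MeasurableSpace A] [MeasurableSingletonClass S] [MeasurableSingletonClass A] {H n : ℕ}
    {d ε : ℝ} (hS : 3 ≤ Fintype.card S) (hA : 2 ≤ Fintype.card A) (hH : 2 ≤ H) (hd : 0 < d)
    (hdA : d ≤ 1 / 5000000 / Fintype.card A) (hε : 0 < ε) (hεH : ε ≤ 1 / 5000000 * H)
    (hn : (n : ℝ) ≤ 1 / 5000000 * ((H : ℝ) ^ 3 / (d * ε ^ 2))) {Ω : Type*} [MeasurableSpace Ω]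
    (ν : Measure Ω) [IsProbabilityMeasure ν] {alg : Dataset S A H n × Ω → Policy S A}
    (halg : Measurable alg) :
    ∃ (M : MDP S A H) (μ : Policy S A), M.dm μ = d ∧
      ENNReal.ofReal (1 / 16) ≤ ((M.dataLaw μ n).prod ν) {x | ε < M.vstar - M.v (alg x)} := by
  classical
  obtain ⟨s₀, g, b, hsg, hsb, hgb⟩ := Fintype.two_lt_card_iff.mp (show 2 < Fintype.card S from hS)
  obtain ⟨a₁, a₂, ha⟩ := Fintype.one_lt_card_iff.mp (show 1 < Fintype.card A from hA)
  have hH' : (2 : ℝ) ≤ H := by exact_mod_cast hH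
  have hA' : (2 : ℝ) ≤ Fintype.card A := by exact_mod_cast hA
  obtain ⟨μ, hμ⟩ := exists_behavior (H := H) (g := g) (b := b) (s₀ := s₀) (by omega) hsg.symm
    hsb.symm hA hd (hdA.trans (by gcongr; norm_num)) a₁
  have hd1 : d ≤ 1 := hdA.trans (by rw [div_le_one (by positivity)]; linarith)
  -- Chosen so that the total stake $\kappa\cdot H/48$ equals $16\epsilon$; the reverse Markov
  -- inequality loses exactly the factor 16.
  set κ : ℝ := 768 * ε / H with hκdef
  have hκ0 : 0 < κ := by positivity
  have hκ4 : κ ≤ 1 / 4 := by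
    rw [hκdef, div_le_iff₀ (by positivity)]
    linarith
  have hκ : κ ≤ 1 / 2 := by linarith
  let x : (Fin H → Bool) → ℕ → Set.Icc (-(1 / 2) : ℝ) (1 / 2) := fun θ => signs hκ0.le hκ θ
  let M : (Fin H → Bool) → MDP S A H := fun θ => hardMDP H s₀ g b a₁ (x θ)
  let Y : Fin H → Dataset S A H n × Ω → ℝ := fun k y => alg y k s₀ a₁
  have hYm : ∀ k, Measurable (Y k) := fun k =>
    ((measurable_pi_apply a₁).comp measurable_subtype_coe).comp
      ((measurable_pi_apply s₀).comp ((measurable_pi_apply (k : ℕ)).comp halg))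
  have hY0 : ∀ k y, 0 ≤ Y k y := fun k y => stdSimplex.zero_le _ _
  have hY1 : ∀ k y, Y k y ≤ 1 := fun k y => stdSimplex.le_one _ _
  let c : Fin H → ℝ := fun k => decisionWeight H k * κ
  have hc : ∀ k, 0 ≤ c k := fun k => mul_nonneg (decisionWeight_nonneg k.2) hκ0.le
  let X : (Fin H → Bool) → Dataset S A H n × Ω → ℝ := fun θ y =>
    ∑ k, c k * (if θ k then 1 - Y k y else Y k y)
  have hXm : ∀ θ, Measurable (X θ) := fun θ => Finset.measurable_sum _ fun k _ => by
    by_cases hθ : θ k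
    · simp only [hθ, if_true]
      exact (measurable_const.sub (hYm k)).const_mul (c k)
    · simp only [hθ]
      exact (hYm k).const_mul (c k)
  have hX0 : ∀ θ y, 0 ≤ X θ y := fun θ y => Finset.sum_nonneg fun k _ =>
    mul_nonneg (hc k) (by split_ifs <;> linarith [hY0 k y, hY1 k y])
  have hX1 : ∀ θ y, X θ y ≤ ∑ k, c k := fun θ y => Finset.sum_le_sum fun k _ =>
    mul_le_of_le_one_right (hc k) (by split_ifs <;> linarith [hY0 k y, hY1 k y])
  have hXreg : ∀ θ y, X θ y ≤ (M θ).vstar - (M θ).v (alg y) := by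
    intro θ y
    refine le_trans (le_of_eq ?_) (hardMDP_regret_ge hsg.symm hsb.symm hgb ha.symm (alg y))
    rw [← Fin.sum_univ_eq_sum_range (fun k => decisionWeight H k * (if 0 < (x θ k : ℝ) then
      x θ k * (1 - alg y k s₀ a₁) else -x θ k * alg y k s₀ a₁))]
    refine Finset.sum_congr rfl fun k _ => ?_
    simp only [x, signs_apply, c, Y]
    by_cases hθ : θ k
    · simp only [hθ, if_true, hκ0]; ring
    · have : ¬ 0 < -κ := by linarith
      simp only [hθ, if_false, this, Bool.false_eq_true]; ring
  have hT : 16 * ε ≤ ∑ k, c k := by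
    have h1 := mul_le_mul_of_nonneg_right (sum_decisionWeight_ge hH) hκ0.le
    rw [Finset.sum_mul] at h1
    refine le_trans (le_of_eq ?_) h1
    rw [hκdef]
    field_simp
    norm_num
  have hlaw : ∀ θ, IsProbabilityMeasure ((M θ).dataLaw μ n) := fun θ => by
    unfold MDP.dataLaw; infer_instance
  let W : (Fin H → Bool) → (Fin n → Path S A H) → ℝ := fun θ z => ∏ i, (M θ).pathProb μ (z i)
  -- The probability of `a₁`, averaged over the internal randomness of the algorithm, serves as a
  -- randomized test for the sign at step `k`.
  let f : Fin H → (Fin n → Path S A H) → ℝ := fun k z =>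
    ∫ ω, Y k (fun i => hardEpisode g (z i), ω) ∂ν
  have hYi : ∀ (k : Fin H) (z : Fin n → Path S A H),
      Integrable (fun ω => Y k (fun i => hardEpisode g (z i), ω)) ν := fun k z => Integrable.of_bound ((hYm k).comp measurable_prodMk_left).aestronglyMeasurable 1
      (Filter.Eventually.of_forall fun ω => by
        rw [Real.norm_eq_abs, abs_of_nonneg (hY0 _ _)]; exact hY1 _ _)
  have haff : ∀ θ k, θ k = true → 3 / 4 ≤ ∑ z, √(W θ z * W (flipAt k θ) z) := by
    intro θ k hθ
    -- The reference instance keeps the signs of `θ` except for a zero at step `k`; its occupancy of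
    -- `a₁` there is again $d$.
    have h1 := hardMDP_affinity_ge (a₁ := a₁) hsg.symm hsb.symm hgb (x := x θ)
      (x' := x (flipAt k θ)) (x₀ := Function.update (x θ) k ⟨0, by norm_num, by norm_num⟩) k
      (κ := κ) (by simp [x, signs_apply, hθ]) (by simp [x, signs_apply, flipAt_same, hθ])
      (by simp) (fun h hne => ⟨by simp [hne],
        by rw [Function.update_of_ne hne]; exact signs_flipAt_of_ne hκ0.le hκ θ k hne⟩) μ
    rw [(hμ _).2 k k.2] at h1
    simp only [W]
    rw [sum_sqrt_prod_mul_prod _ _ (MDP.pathProb_nonneg _ _) (MDP.pathProb_nonneg _ _)]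
    set t : ℝ := 4 * κ ^ 2 * (d * leave H) with ht
    have hκ2 : κ ^ 2 ≤ 1 := by nlinarith
    have hdl : d * leave H ≤ 1 / 2 := by nlinarith [leave_le H, leave_nonneg H]
    have hdl0 : 0 ≤ d * leave H := mul_nonneg hd.le (leave_nonneg H)
    have hκ16 : κ ^ 2 ≤ 1 / 16 := by nlinarith
    have ht1 : t ≤ 1 := by rw [ht]; nlinarith
    have h2 := one_add_mul_le_pow (a := -t) (by linarith) n
    -- Here $t=2\cdot768^2\,d\epsilon^2/H^3$, so $nt\le2\cdot768^2/5000000<1/4$, and Bernoulli's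
    -- inequality leaves an affinity of at least $3/4$.
    have h3 : n * t ≤ 1 / 4 := by
      have h4 : (n : ℝ) * t ≤ 1 / 5000000 * ((H : ℝ) ^ 3 / (d * ε ^ 2)) * t :=
        mul_le_mul_of_nonneg_right hn (by positivity)
      refine h4.trans ?_
      have h5 : 1 / 5000000 * ((H : ℝ) ^ 3 / (d * ε ^ 2)) * t = 1 / 5000000 * (2 * 768 ^ 2) := by
        rw [ht, hκdef, leave]
        field_simp
        ring
      rw [h5]
      norm_num
    have h6 : (1 + -t) ^ n ≤ (∑ q, √((M θ).pathProb μ q * (M (flipAt k θ)).pathProb μ q)) ^ n :=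
      pow_le_pow_left₀ (by linarith) (by linarith) n
    linarith
  obtain ⟨θ, hθ⟩ := exists_sum_div_eight_le (W := W) (f := f) (c := c)
    (fun θ z => Finset.prod_nonneg fun i _ => MDP.pathProb_nonneg _ _ _)
    (fun θ => by
      have h1 := Fintype.sum_pow (fun q => (M θ).pathProb μ q) n
      rw [(M θ).sum_pathProb μ, one_pow] at h1
      exact h1.symm)
    (fun k z => integral_nonneg fun ω => hY0 _ _)
    (fun k z => (integral_mono (hYi k z) (integrable_const 1) fun ω => hY1 _ _).trans_eq (by simp))
    hc haff
  refine ⟨M θ, μ, (hμ _).1, ?_⟩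
  have hint : (∑ k, c k) / 8 ≤ ∫ y, X θ y ∂(((M θ).dataLaw μ n).prod ν) := by
    refine hθ.trans_eq ?_
    rw [hardMDP_integral (x θ) μ n ν (hXm θ) (T := ∑ k, c k) fun y => by
      rw [abs_of_nonneg (hX0 _ _)]; exact hX1 _ _]
    refine Finset.sum_congr rfl fun z _ => ?_
    congr 1
    simp only [X]
    rw [integral_finsetSum]
    · refine Finset.sum_congr rfl fun k _ => ?_
      rw [integral_const_mul]
      congr 1
      by_cases hk : θ k
      · simp only [hk, if_true]
        rw [integral_sub (integrable_const _) (hYi k z)]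
        simp [f]
      · simp only [hk]
        simp [f]
    · intro k _
      refine Integrable.const_mul ?_ _
      by_cases hk : θ k
      · simp only [hk, if_true]
        exact (integrable_const (1 : ℝ)).sub (hYi k z)
      · simp only [hk]
        exact hYi k z
  -- The surrogate regret `X θ` is at most the total stake and has mean at least an eighth of it, so
  -- it exceeds a sixteenth, which is at least $\epsilon$, with probability at least $1/16$.
  refine (le_measure_of_le_integral _ (hXm θ) (by linarith) (hX0 θ) (hX1 θ) hint).trans
    (measure_mono fun y hy => ?_)
  have h1 : (∑ k, c k) / 16 < X θ y := hy
  have h2 := hXreg θ y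
  change ε < _
  linarith

end lower

end OfflineRL

theorem mainTheorem7 :
    -- the intrinsic bound is at most `√(H³ / (n d_m))`
    (∀ (S A : Type) [Fintype S] [Fintype A] (H n : ℕ) (M : OfflineRL.MDP S A H)
        (μ πs : OfflineRL.Policy S A),
        0 < H → 0 < n → 0 < M.dm μ → M.IsOptimal πs →
        M.intrinsicBound μ πs n ≤ √((H : ℝ) ^ 3 / (n * M.dm μ))) ∧
    -- APVI is `ε`-optimal with probability at least `1 - δ` from `Õ(H³ / (d_m ε²))` episodes
    (∃ (C : ℝ) (k : ℕ), 0 < C ∧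
      ∀ (S A : Type) [Fintype S] [Fintype A] [DecidableEq S] [DecidableEq A]
        [MeasurableSpace S] [MeasurableSpace A] [MeasurableSingletonClass S]
        [MeasurableSingletonClass A] (H n : ℕ) (M : OfflineRL.MDP S A H)
        (μ : OfflineRL.Policy S A) (δ ε K : ℝ),
        0 < H → 0 < M.dm μ → 0 < δ → δ < 1 → 0 < ε → 0 < K →
        C * Real.log (3 * H * Fintype.card S * Fintype.card A / (δ * M.dm μ) * (1 + 1 / ε)) ^ k *
          ((H : ℝ) ^ 3 / (M.dm μ * ε ^ 2) + (H : ℝ) ^ 3 / (M.dm μ * ε)) ≤ n →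
        M.dataLaw μ n {D | ¬ ∀ π : OfflineRL.Policy S A, OfflineRL.IsAPVIOutput δ K D π →
          0 ≤ M.vstar - M.v π ∧ M.vstar - M.v π ≤ ε} ≤ ENNReal.ofReal δ) ∧
    -- minimax: below `Ω(H³ / (d_m ε²))` episodes every (randomized) algorithm fails on an instance
    (∃ c : ℝ, 0 < c ∧
      ∀ (S A : Type) [Fintype S] [Fintype A] [MeasurableSpace S] [MeasurableSpace A]
        [MeasurableSingletonClass S] [MeasurableSingletonClass A] (H n : ℕ) (d ε : ℝ),
        3 ≤ Fintype.card S → 2 ≤ Fintype.card A → 2 ≤ H →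
        0 < d → d ≤ c / Fintype.card A → 0 < ε → ε ≤ c * H →
        (n : ℝ) ≤ c * ((H : ℝ) ^ 3 / (d * ε ^ 2)) →
        ∀ (Ω : Type) [MeasurableSpace Ω] (ν : MeasureTheory.Measure Ω)
          [MeasureTheory.IsProbabilityMeasure ν]
          (alg : OfflineRL.Dataset S A H n × Ω → OfflineRL.Policy S A), Measurable alg →
        ∃ (M : OfflineRL.MDP S A H) (μ : OfflineRL.Policy S A), M.dm μ = d ∧
          ENNReal.ofReal c ≤
            ((M.dataLaw μ n).prod ν) {x | ε < M.vstar - M.v (alg x)}) := by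
  refine ⟨fun S A _ _ H n M μ πs _ hn hd hπ => M.intrinsicBound_le μ πs hn hd hπ,
    ⟨4000000, 1, by norm_num, fun S A _ _ _ _ _ _ _ _ H n M μ δ ε K hH hd hδ hδ1 hε _ hn =>
      M.dataLaw_not_near_optimal_le μ K hH hd hδ hδ1 hε hn⟩,
    ⟨1 / 5000000, by norm_num, fun S A _ _ _ _ _ _ H n d ε hS hA hH hd hdA hε hεH hn Ω _ ν _ alg
        halg => ?_⟩⟩
  obtain ⟨M, μ, h1, h2⟩ := OfflineRL.exists_hard_instance hS hA hH hd hdA hε hεH hn ν halg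
  exact ⟨M, μ, h1, (ENNReal.ofReal_le_ofReal (by norm_num)).trans h2⟩
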